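/- A form with real coefficients is called positive semidefinite (psd) if it takes only nonnegative values, and positive definite if it is positive at every real point other than the origin. **Hilbert's theorem.** (1) Every psd quartic form $f\in\mathbb R[x,y,z]$ is a sum of three squares of quadratic forms in $\mathbb R[x,y,z]$. Moreover, let $f=z^4+f_2z^2+f_3z+f_4$, where $f_j\in\mathbb R[x,y]$ is a form of degree $j$ ($j=2,3,4$). For $t\in\mathbb R$, a solution of $C_t$ is a pair $(\xi,\eta)$ of forms in $\mathbb R[x,y]$ with $\deg\xi=2$, $\deg\eta=3$, $$\eta^2+f_3^2=(f_2-t\xi)(4f_4-\xi^2),$$ such that $f_2-t\xi$ and $4f_4-\xi^2$ are psd. For $i,j\in\{2,3,4\}$ let $g_{ij}=\frac{\partial f_i}{\partial y}\frac{\partial f_j}{\partial x}-\frac{\partial f_j}{\partial y}\frac{\partial f_i}{\partial x}$, a binary form of degree $i+j-2$ whose value at $y=1$ is $i\,f_if_j'-j\,f_jf_i'$ (with $'=\frac{d}{dx}$ applied to the dehomogenized forms), and put $$P=g_{23}g_{34}-g_{24}^2,\quad Q=f_4^2g_{23}(2f_4g_{23}-f_3g_{24}),\quad R=(8f_2f_4-3f_3^2)g_{23}+2f_2f_3g_{24}.$$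 Let $\operatorname{disc}_m$ denote the discriminant of binary forms of degree $m$. For a binary form $F$ of degree $m$ and binary forms $G,H$ of degree $n$, with dehomogenizations $F(x,1)=a_0\prod_{i=1}^m(x-\alpha_i)$, $g=G(x,1)$, $h=H(x,1)$, let $$\Phi_{m,n}(F,G,H)=a_0^{(m-1)(n-1)}\prod_{1\le i<j\le m}\frac{g(\alpha_i)h(\alpha_j)-g(\alpha_j)h(\alpha_i)}{\alpha_i-\alpha_j},$$ which is a polynomial in the coefficients of $F,G,H$ and is thereby defined also when $F$ has multiple zeros or $a_0=0$. Consider the exceptional conditions - $(E_1)$ $\operatorname{disc}_2(f_2)=0$; - $(E_2)$ $f_2\mid f_3$; - $(E_3)$ $\operatorname{disc}_6(4f_2f_4-f_3^2)=0$; - $(E_4)$ $\operatorname{disc}_3(f_3)=0$; - $(E_5)$ $\gcd(f_3,f_4)\ne1$; - $(E_6)$ $\gcd(g_{23},g_{24})\ne1$; - $(E_7)$ $\gcd(g_{24},g_{34})\ne1$; - $(E_8)$ $\Phi_{3,4}(f_3,f_2^2,f_4)=0$; - $(E_9)$ $\operatorname{disc}_8(P)=0$; - $(E_{10})$ $\Phi_{8,18}(P,Q,R^2)=0$;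 where the greatest common divisors are those of binary forms. (2) If $f$ is positive definite, $f-z^4$ is psd, and none of $(E_1),\dots,(E_{10})$ holds, then $C_0$ has a solution, and every solution $(\xi_0,\eta_0)$ of $C_0$ extends in a unique continuous way to solutions of $C_t$ for $0\le t\le1$: there is exactly one family $(\xi_t,\eta_t)_{0\le t\le1}$ whose coefficients depend continuously on $t$, which starts at $(\xi_0,\eta_0)$, and for which $(\xi_t,\eta_t)$ is a solution of $C_t$ for every $t\in[0,1]$. (3) There are nonzero real polynomials $\Psi_1,\dots,\Psi_{10}$ in the twelve coefficients of $f_2,f_3,f_4$ such that, for every $i$ and every $f=z^4+f_2z^2+f_3z+f_4$ with $f-z^4$ psd, $\Psi_i(f)\neq0$ if and only if $(E_i)$ does not hold for $f$; and the set of positive definite forms $f=z^4+f_2z^2+f_3z+f_4$ with $\prod_{i=1}^{10}\Psi_i(f)\ne0$ is dense in the set of all psd forms of this shape. Likewise, the set of those which satisfy in addition that $f-z^4$ is psd is dense in the set of all forms of this shape for which $f-z^4$ is psd. -/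

import Mathlib

open MvPolynomial

namespace TernaryQuartic

/-- A real polynomial is positive semidefinite if it takes nonnegative values everywhere. -/
def IsPSD {n : ℕ} (p : MvPolynomial (Fin n) ℝ) : Prop :=
  ∀ v : Fin n → ℝ, 0 ≤ eval v p

/-- A real form is (strictly) positive definite if it is positive away from the origin. -/
def IsPosDef {n : ℕ} (p : MvPolynomial (Fin n) ℝ) : Prop :=
  ∀ v : Fin n → ℝ, v ≠ 0 → 0 < eval v p

/-- A polynomial in `x, y` regarded as a polynomial in `x, y, z`. The variables `x, y, z` are
`X 0, X 1, X 2`. -/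
noncomputable def lift (p : MvPolynomial (Fin 2) ℝ) : MvPolynomial (Fin 3) ℝ :=
  rename Fin.castSucc p

/-- The quartic `z ^ 4 + f₂ z ^ 2 + f₃ z + f₄`. -/
noncomputable def normalQuartic (f₂ f₃ f₄ : MvPolynomial (Fin 2) ℝ) : MvPolynomial (Fin 3) ℝ :=
  X 2 ^ 4 + lift f₂ * X 2 ^ 2 + lift f₃ * X 2 + lift f₄

/-- `f₂, f₃, f₄` are binary forms of degrees `2, 3, 4`. -/
structure AreForms (f₂ f₃ f₄ : MvPolynomial (Fin 2) ℝ) : Prop where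
  hom₂ : f₂.IsHomogeneous 2
  hom₃ : f₃.IsHomogeneous 3
  hom₄ : f₄.IsHomogeneous 4

/-- The pair `s = (ξ, η)` of binary forms of degrees `2` and `3` is a solution of
`C_t : η ^ 2 + f₃ ^ 2 = (f₂ - t ξ) (4 f₄ - ξ ^ 2)` with the side conditions that both factors on
the right be positive semidefinite. -/
structure IsSolution (f₂ f₃ f₄ : MvPolynomial (Fin 2) ℝ) (t : ℝ)
    (s : MvPolynomial (Fin 2) ℝ × MvPolynomial (Fin 2) ℝ) : Prop where
  hom_xi : s.1.IsHomogeneous 2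
  hom_eta : s.2.IsHomogeneous 3
  eq : s.2 ^ 2 + f₃ ^ 2 = (f₂ - C t * s.1) * (4 * f₄ - s.1 ^ 2)
  psd_left : IsPSD (f₂ - C t * s.1)
  psd_right : IsPSD (4 * f₄ - s.1 ^ 2)

/-- A family of pairs of binary forms is continuous if all coefficients are continuous. -/
def IsContinuousFamily {T : Type} [TopologicalSpace T]
    (γ : T → MvPolynomial (Fin 2) ℝ × MvPolynomial (Fin 2) ℝ) : Prop :=
  ∀ d : Fin 2 →₀ ℕ,
    Continuous (fun t => coeff d (γ t).1) ∧ Continuous (fun t => coeff d (γ t).2)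

/-! ### Discriminant and `Φ`-invariant of binary forms

A binary form `F` of degree `m` corresponds to the polynomial `F(x, 1)` of degree at most `m`;
when the degree drops to `d < m`, the missing `m - d` roots lie at infinity. -/

/-- The complex polynomial `F(x, 1)`. -/
noncomputable def dehom (F : MvPolynomial (Fin 2) ℝ) : Polynomial ℂ :=
  aeval ![Polynomial.X, 1] F

/-- The zeros of `F` on the projective line, with multiplicity, in homogeneous coordinates:
`(α, 1)` for the roots `α` of `F(x, 1)`, and `(-1, 0)` for each of the missing roots. If
`F ≠ 0` has degree `m` and the list is `(a₁, b₁), …, (aₘ, bₘ)`, then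
`F(x, 1) = c * ∏ i, (bᵢ x - aᵢ)` where `c` is the leading coefficient of `F(x, 1)`. -/
noncomputable def projZeros (m : ℕ) (F : MvPolynomial (Fin 2) ℝ) : List (ℂ × ℂ) :=
  (dehom F).roots.toList.map (fun α => (α, 1)) ++
    List.replicate (m - (dehom F).natDegree) (-1, 0)

/-- `∏ i < j, B(pᵢ, pⱼ)` over the pairs of entries of a list. -/
def pairProd (B : ℂ × ℂ → ℂ × ℂ → ℂ) : List (ℂ × ℂ) → ℂ
  | [] => 1
  | p :: l => (l.map (B p)).prod * pairProd B l

/-- The discriminant `disc_m` of a binary form of degree `m`. If `F(x, 1)` has degree `m`,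
leading coefficient `a₀` and roots `αᵢ`, this is `a₀ ^ (2m - 2) * ∏ i < j, (αᵢ - αⱼ) ^ 2`. -/
noncomputable def disc (m : ℕ) (F : MvPolynomial (Fin 2) ℝ) : ℂ :=
  (dehom F).leadingCoeff ^ (2 * m - 2) *
    pairProd (fun p q => (p.1 * q.2 - q.1 * p.2) ^ 2) (projZeros m F)

/-- For binary forms `G, H` of degree `n`, with `g = G(x, 1)` and `h = H(x, 1)`, the value at
`(u, v)` of the polynomial `(g(u) h(v) - g(v) h(u)) / (u - v)`, homogenized to degree `n - 1` in
each argument, `u = p.1 / p.2` and `v = q.1 / q.2`. Written out by means of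
`g(u) h(v) - g(v) h(u) = ∑ j < k, (g_k h_j - g_j h_k) (u ^ k v ^ j - u ^ j v ^ k)`. -/
noncomputable def bezoutian (n : ℕ) (G H : MvPolynomial (Fin 2) ℝ) (p q : ℂ × ℂ) : ℂ :=
  ∑ k ∈ Finset.range (n + 1), ∑ j ∈ Finset.range k,
    ((dehom G).coeff k * (dehom H).coeff j - (dehom G).coeff j * (dehom H).coeff k) *
      ∑ l ∈ Finset.range (k - j),
        p.1 ^ (j + l) * p.2 ^ (n - 1 - (j + l)) * q.1 ^ (k - 1 - l) * q.2 ^ (n - k + l)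

/-- The invariant `Φ_{m,n}(F, G, H)` of a binary form `F` of degree `m` and binary forms `G, H` of
degree `n`. If `f = F(x, 1)` has degree `m`, leading coefficient `a₀` and roots `αᵢ`, this is
`a₀ ^ ((m - 1) (n - 1)) * ∏ i < j, (g(αᵢ) h(αⱼ) - g(αⱼ) h(αᵢ)) / (αᵢ - αⱼ)`, the quotients
being understood as polynomials in `αᵢ, αⱼ`. -/
noncomputable def phiInv (m n : ℕ) (F G H : MvPolynomial (Fin 2) ℝ) : ℂ :=
  (dehom F).leadingCoeff ^ ((m - 1) * (n - 1)) * pairProd (bezoutian n G H) (projZeros m F)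

/-- The binary form `∂F/∂y ∂G/∂x - ∂G/∂y ∂F/∂x`. For `F`, `G` homogeneous of degrees `i`, `j`, its
value at `y = 1` is `i f g' - j g f'`, where `f = F(x, 1)`, `g = G(x, 1)`; so for `F = f_i`,
`G = f_j` this is the form `g_{ij}` of degree `i + j - 2`. -/
noncomputable def jac (F G : MvPolynomial (Fin 2) ℝ) : MvPolynomial (Fin 2) ℝ :=
  pderiv 1 F * pderiv 0 G - pderiv 1 G * pderiv 0 F

/-- `P = g₂₃ g₃₄ - g₂₄ ^ 2`, a form of degree `8`. -/
noncomputable def formP (f₂ f₃ f₄ : MvPolynomial (Fin 2) ℝ) : MvPolynomial (Fin 2) ℝ :=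
  jac f₂ f₃ * jac f₃ f₄ - jac f₂ f₄ ^ 2

/-- `Q = f₄ ^ 2 g₂₃ (2 f₄ g₂₃ - f₃ g₂₄)`, a form of degree `18`. -/
noncomputable def formQ (f₂ f₃ f₄ : MvPolynomial (Fin 2) ℝ) : MvPolynomial (Fin 2) ℝ :=
  f₄ ^ 2 * jac f₂ f₃ * (2 * f₄ * jac f₂ f₃ - f₃ * jac f₂ f₄)

/-- `R = (8 f₂ f₄ - 3 f₃ ^ 2) g₂₃ + 2 f₂ f₃ g₂₄`, a form of degree `9`. -/
noncomputable def formR (f₂ f₃ f₄ : MvPolynomial (Fin 2) ℝ) : MvPolynomial (Fin 2) ℝ :=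
  (8 * f₂ * f₄ - 3 * f₃ ^ 2) * jac f₂ f₃ + 2 * f₂ * f₃ * jac f₂ f₄

/-- The ten exceptional conditions `(E₁), …, (E₁₀)` on `(f₂, f₃, f₄)`, numbered from `0`. -/
noncomputable def Exceptional (f₂ f₃ f₄ : MvPolynomial (Fin 2) ℝ) : Fin 10 → Prop :=
  ![disc 2 f₂ = 0,
    f₂ ∣ f₃,
    disc 6 (4 * f₂ * f₄ - f₃ ^ 2) = 0,
    disc 3 f₃ = 0,
    ¬ IsRelPrime f₃ f₄,
    ¬ IsRelPrime (jac f₂ f₃) (jac f₂ f₄),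
    ¬ IsRelPrime (jac f₂ f₄) (jac f₃ f₄),
    phiInv 3 4 f₃ (f₂ ^ 2) f₄ = 0,
    disc 8 (formP f₂ f₃ f₄) = 0,
    phiInv 8 18 (formP f₂ f₃ f₄) (formQ f₂ f₃ f₄) (formR f₂ f₃ f₄ ^ 2) = 0]

/-- The coefficient of `x ^ k y ^ (m - k)`. -/
noncomputable def binCoeff (m k : ℕ) (F : MvPolynomial (Fin 2) ℝ) : ℝ :=
  coeff (Finsupp.single 0 k + Finsupp.single 1 (m - k)) F

/-- The twelve coefficients of `f₂`, `f₃`, `f₄`. -/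
noncomputable def coeffVec (f₂ f₃ f₄ : MvPolynomial (Fin 2) ℝ) : Fin 3 ⊕ Fin 4 ⊕ Fin 5 → ℝ :=
  Sum.elim (fun k => binCoeff 2 k f₂)
    (Sum.elim (fun k => binCoeff 3 k f₃) (fun k => binCoeff 4 k f₄))

end TernaryQuartic

open TernaryQuartic

/-!
Let `f = z ^ 4 + f₂ z ^ 2 + f₃ z + f₄` be positive definite with `f - z ^ 4` psd. A solution
`(ξ, η)` of `C_1` makes `f - (z ^ 2 + ξ / 2) ^ 2` a psd quadratic polynomial in `z` whose
discriminant is minus a square, and such a polynomial is a sum of two squares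
(`isSumThreeSq_of_isSolution_one`). The system `C_0` says `4 f₂ f₄ - f₃ ^ 2 = f₂ ξ ^ 2 + η ^ 2`,
with a psd left side, and is solvable because the psd binary forms are the ones represented by
`⟨f₂, 1⟩` (`exists_isSolution_zero`).

The solutions are continued from `t = 0` to `t = 1` as follows. The equation of `C_t` is a system
of seven equations for the seven coefficients of `ξ` and `η`. Its derivative at a solution sends
`(δξ, δη)` to a combination of `δξ` and `δη` whose coefficients are the forms `L` and `2 η` of
degrees `4` and `3`, where `L = t (4 f₄ - ξ ^ 2) + 2 ξ (f₂ - t ξ)`; it is injective if `L` and `η`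
have no common complex zero. A common zero would be a singularity of the curve
`t ^ 2 z ^ 4 + f₂ z ^ 2 + f₃ z + f₄ = 0`, apart from degenerate cases. If it is real, it
contradicts the positivity of `f`. If it is not real, then the elimination of `z` shows that `P`
vanishes there and that `R ^ 2 = 128 t ^ 2 Q`; so `Q / R ^ 2` takes the same value at this zero of
`P` and at its conjugate, and `Φ_{8,18}(P, Q, R ^ 2) = 0`. The degenerate cases lead to other
exceptional conditions (`IsSolution.eq_zero_of_common_zero`). By the inverse function theorem, and
because the psd side conditions are stable under small deformations that preserve the equation
(`eventually_psd`), the projection from the space of all solutions of the `C_t`, `0 ≤ t ≤ 1`, to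
`[0, 1]` is a local homeomorphism. As the space is compact, it is a covering map
(`isCoveringMap_solProj`), and the continuation is path lifting (`existsUnique_continuation`).

The exceptional conditions are algebraic. Discriminants and `Φ` are symmetric in the zeros of a
form and homogeneous in the homogeneous coordinates of each of them, hence polynomials in the
coefficients (`exists_eval_zerosCoeff`); conditions on common divisors are expressed by resultants
(`isRelPrime_iff_formRes_ne_zero`), and `f₂ ∣ f₃` by remainders (`eval_dvdPoly_eq_zero_iff`). An
example for each condition shows that it does not always hold (`exists_not_exceptional`), and
therefore the generic forms are dense (`exists_near_generic`).

A positive definite quartic acquires the above shape, up to a positive factor, by moving a point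
of the sphere at which it is minimal to `(0, 0, 1)` (`exists_normal_form`). As the set of sums of
three squares is closed under limits (`isSumThreeSq_of_tendsto`), every psd quartic is such a sum.
-/

open scoped Polynomial

namespace TernaryQuartic

/-! ### Binary forms and univariate polynomials -/

/-- The real polynomial `F(x, 1)`. -/
noncomputable def toPoly : MvPolynomial (Fin 2) ℝ →ₐ[ℝ] ℝ[X] := aeval ![Polynomial.X, 1]

/-- The binary form `∑ uᵢ x ^ i y ^ (k - i)` of degree `k` with coefficients those of `u`;
coefficients of `u` beyond degree `k` are ignored. -/
noncomputable def homog (k : ℕ) (u : ℝ[X]) : MvPolynomial (Fin 2) ℝ :=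
  ∑ i ∈ Finset.range (k + 1), C (u.coeff i) * X 0 ^ i * X 1 ^ (k - i)

theorem dehom_eq_map (F : MvPolynomial (Fin 2) ℝ) :
    dehom F = (toPoly F).map (algebraMap ℝ ℂ) := by
  have h : (aeval ![(Polynomial.X : ℂ[X]), 1] : MvPolynomial (Fin 2) ℝ →ₐ[ℝ] ℂ[X]) =
      (Polynomial.mapAlgHom (Algebra.ofId ℝ ℂ)).comp toPoly := by
    ext i : 1
    fin_cases i <;> simp [toPoly]
  have := congrArg (fun φ => φ F) h
  simpa [dehom] using this

theorem coeff_dehom (F : MvPolynomial (Fin 2) ℝ) (k : ℕ) :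
    (dehom F).coeff k = ((toPoly F).coeff k : ℂ) := by
  rw [dehom_eq_map, Polynomial.coeff_map]; rfl

theorem natDegree_dehom (F : MvPolynomial (Fin 2) ℝ) :
    (dehom F).natDegree = (toPoly F).natDegree := by
  rw [dehom_eq_map, Polynomial.natDegree_map]

theorem isHomogeneous_homog (k : ℕ) (u : ℝ[X]) : (homog k u).IsHomogeneous k := by
  refine IsHomogeneous.sum _ _ _ fun i hi => ?_
  have h1 : i + (k - i) = k := by have := Finset.mem_range.1 hi; omega
  have h2 := (((isHomogeneous_C (Fin 2) (u.coeff i)).mul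
    ((isHomogeneous_X ℝ (0 : Fin 2)).pow i)).mul ((isHomogeneous_X ℝ (1 : Fin 2)).pow (k - i)))
  simpa [h1] using h2

theorem toPoly_homog {k : ℕ} {u : ℝ[X]} (hu : u.natDegree ≤ k) : toPoly (homog k u) = u := by
  have : toPoly (homog k u) =
      ∑ i ∈ Finset.range (k + 1), Polynomial.C (u.coeff i) * Polynomial.X ^ i := by
    simp [toPoly, homog, Polynomial.C_eq_algebraMap]
  rw [this, ← Polynomial.as_sum_range_C_mul_X_pow' u (by omega)]

theorem form_eq_sum {m : ℕ} {F : MvPolynomial (Fin 2) ℝ} (hF : F.IsHomogeneous m) :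
    F = ∑ i ∈ Finset.range (m + 1), C (binCoeff m i F) * X 0 ^ i * X 1 ^ (m - i) := by
  classical
  have hmono : ∀ i, (C (binCoeff m i F) * X 0 ^ i * X 1 ^ (m - i) : MvPolynomial (Fin 2) ℝ) =
      monomial (Finsupp.single 0 i + Finsupp.single 1 (m - i)) (binCoeff m i F) := by
    intro i
    rw [X_pow_eq_monomial, X_pow_eq_monomial, C_mul_monomial, monomial_mul]
    simp
  ext d
  simp_rw [hmono, coeff_sum, coeff_monomial]
  by_cases hd : d.degree = m
  · have hsum : d 0 + d 1 = m := by
      rw [← hd, Finsupp.degree_eq_sum, Fin.sum_univ_two]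
    rw [Finset.sum_eq_single (d 0)]
    · have : Finsupp.single (0 : Fin 2) (d 0) + Finsupp.single 1 (m - d 0) = d := by
        ext j
        fin_cases j
        · simp
        · simp; omega
      rw [if_pos this, binCoeff, this]
    · intro b _ hb
      rw [if_neg]
      intro h
      apply hb
      rw [← h]; simp
    · intro h
      exact absurd (Finset.mem_range.2 (by omega)) h
  · have h0 : coeff d F = 0 := hF.coeff_eq_zero hd
    rw [h0, Finset.sum_eq_zero]
    intro i hi
    rw [if_neg]
    intro h
    apply hd
    rw [← h, Finsupp.degree_eq_sum, Fin.sum_univ_two]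
    simp
    have := Finset.mem_range.1 hi; omega

theorem toPoly_form {m : ℕ} {F : MvPolynomial (Fin 2) ℝ} (hF : F.IsHomogeneous m) :
    toPoly F = ∑ i ∈ Finset.range (m + 1),
      Polynomial.C (binCoeff m i F) * Polynomial.X ^ i := by
  conv_lhs => rw [form_eq_sum hF]
  simp [toPoly, Polynomial.C_eq_algebraMap]

theorem coeff_toPoly {m : ℕ} {F : MvPolynomial (Fin 2) ℝ} (hF : F.IsHomogeneous m) (k : ℕ) :
    (toPoly F).coeff k = if k ≤ m then binCoeff m k F else 0 := by
  rw [toPoly_form hF, Polynomial.finsetSum_coeff]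
  simp only [Polynomial.coeff_C_mul_X_pow]
  by_cases h : k ≤ m
  · rw [if_pos h, Finset.sum_eq_single k]
    · simp
    · intro b _ hb
      rw [if_neg hb.symm]
    · intro hk
      exact absurd (Finset.mem_range.2 (by omega)) hk
  · rw [if_neg h, Finset.sum_eq_zero]
    intro i hi
    rw [if_neg]
    have := Finset.mem_range.1 hi; omega

theorem natDegree_toPoly_le {m : ℕ} {F : MvPolynomial (Fin 2) ℝ} (hF : F.IsHomogeneous m) :
    (toPoly F).natDegree ≤ m := by
  rw [Polynomial.natDegree_le_iff_coeff_eq_zero]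
  intro k hk
  rw [coeff_toPoly hF, if_neg (by omega)]

theorem homog_toPoly {m : ℕ} {F : MvPolynomial (Fin 2) ℝ} (hF : F.IsHomogeneous m) :
    homog m (toPoly F) = F := by
  conv_rhs => rw [form_eq_sum hF]
  refine Finset.sum_congr rfl fun i hi => ?_
  rw [coeff_toPoly hF, if_pos (by have := Finset.mem_range.1 hi; omega)]

theorem form_ext {m : ℕ} {F G : MvPolynomial (Fin 2) ℝ} (hF : F.IsHomogeneous m)
    (hG : G.IsHomogeneous m) (h : toPoly F = toPoly G) : F = G := by
  rw [← homog_toPoly hF, h, homog_toPoly hG]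

theorem toPoly_eq_zero {m : ℕ} {F : MvPolynomial (Fin 2) ℝ} (hF : F.IsHomogeneous m) :
    toPoly F = 0 ↔ F = 0 :=
  ⟨fun h => form_ext hF (isHomogeneous_zero _ _ _) (by simpa using h), fun h => by simp [h]⟩

theorem toPoly_pderiv_zero (F : MvPolynomial (Fin 2) ℝ) :
    toPoly (pderiv 0 F) = Polynomial.derivative (toPoly F) := by
  induction F using MvPolynomial.induction_on with
  | C a => simp [toPoly]
  | add p q hp hq => simp [hp, hq]
  | mul_X p i hp =>
    rw [Derivation.leibniz, map_add, smul_eq_mul, smul_eq_mul, map_mul, map_mul, map_mul, hp,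
      Polynomial.derivative_mul]
    fin_cases i
    · simp [toPoly]; ring
    · simp [toPoly, pderiv_X]

/-- Euler's identity for `F`, solved for `∂F/∂y` at `y = 1`. -/
theorem toPoly_pderiv_one {m : ℕ} {F : MvPolynomial (Fin 2) ℝ} (hF : F.IsHomogeneous m) :
    toPoly (pderiv 1 F) =
      (m : ℝ[X]) * toPoly F - Polynomial.X * Polynomial.derivative (toPoly F) := by
  have h := congrArg toPoly hF.sum_X_mul_pderiv
  rw [Fin.sum_univ_two, map_add, map_mul, map_mul, toPoly_pderiv_zero, nsmul_eq_mul, map_mul] at h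
  have h0 : toPoly (X 0) = Polynomial.X := by simp [toPoly]
  have h1 : toPoly (X 1) = 1 := by simp [toPoly]
  rw [h0, h1, map_natCast] at h
  rw [← h]; ring

theorem isHomogeneous_jac {m n k : ℕ} {F G : MvPolynomial (Fin 2) ℝ} (hF : F.IsHomogeneous m)
    (hG : G.IsHomogeneous n) (hk : m - 1 + (n - 1) = k) : (jac F G).IsHomogeneous k := by
  subst hk
  refine (hF.pderiv.mul hG.pderiv).sub ?_
  rw [add_comm]
  exact hG.pderiv.mul hF.pderiv

/-! ### Evaluation of real forms at complex points -/

theorem aeval_form {m : ℕ} {F : MvPolynomial (Fin 2) ℝ} (hF : F.IsHomogeneous m) (p : Fin 2 → ℂ) :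
    aeval p F = ∑ i ∈ Finset.range (m + 1), (binCoeff m i F : ℂ) * p 0 ^ i * p 1 ^ (m - i) := by
  conv_lhs => rw [form_eq_sum hF]
  simp

theorem eval_form {m : ℕ} {F : MvPolynomial (Fin 2) ℝ} (hF : F.IsHomogeneous m) (p : Fin 2 → ℝ) :
    eval p F = ∑ i ∈ Finset.range (m + 1), binCoeff m i F * p 0 ^ i * p 1 ^ (m - i) := by
  conv_lhs => rw [form_eq_sum hF]
  simp

theorem aeval_form_of_ne_zero {m : ℕ} {F : MvPolynomial (Fin 2) ℝ} (hF : F.IsHomogeneous m)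
    {p : Fin 2 → ℂ} (hp : p 1 ≠ 0) :
    aeval p F = p 1 ^ m * (dehom F).eval (p 0 / p 1) := by
  rw [aeval_form hF, dehom_eq_map, toPoly_form hF, Polynomial.map_sum, Polynomial.eval_finsetSum,
    Finset.mul_sum]
  refine Finset.sum_congr rfl fun i hi => ?_
  have h1 : m = i + (m - i) := by have := Finset.mem_range.1 hi; omega
  have h2 : p 1 ^ m = p 1 ^ i * p 1 ^ (m - i) := by rw [← pow_add, ← h1]
  simp only [Polynomial.map_mul, Polynomial.map_C, Polynomial.map_pow, Polynomial.map_X,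
    Polynomial.eval_mul, Polynomial.eval_C, Polynomial.eval_pow, Polynomial.eval_X, h2,
    Complex.coe_algebraMap, div_pow]
  field_simp

theorem aeval_form_of_eq_zero {m : ℕ} {F : MvPolynomial (Fin 2) ℝ} (hF : F.IsHomogeneous m)
    {p : Fin 2 → ℂ} (hp : p 1 = 0) :
    aeval p F = p 0 ^ m * (dehom F).coeff m := by
  rw [aeval_form hF, Finset.sum_eq_single m, coeff_dehom, coeff_toPoly hF, if_pos le_rfl]
  · simp [mul_comm]
  · intro i hi him
    have : m - i ≠ 0 := by have := Finset.mem_range.1 hi; omega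
    simp [hp, this]
  · simp

theorem aeval_ofReal {n : ℕ} (F : MvPolynomial (Fin n) ℝ) (v : Fin n → ℝ) :
    aeval (fun i => (v i : ℂ)) F = (eval v F : ℂ) := by
  have h := aeval_algebraMap_apply (A := ℝ) (B := ℂ) v F
  simpa [Function.comp_def, MvPolynomial.coe_aeval_eq_eval] using h

theorem aeval_conj (F : MvPolynomial (Fin 2) ℝ) (p : Fin 2 → ℂ) :
    aeval (fun i => starRingEnd ℂ (p i)) F = starRingEnd ℂ (aeval p F) := by
  induction F using MvPolynomial.induction_on with
  | C a => simp
  | add p q hp hq => simp [hp, hq]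
  | mul_X p i hp => simp [hp]

theorem eval_smul_form {n m : ℕ} {F : MvPolynomial (Fin n) ℝ} (hF : F.IsHomogeneous m) (r : ℝ)
    (v : Fin n → ℝ) : eval (fun i => r * v i) F = r ^ m * eval v F := by
  rw [eval_eq, eval_eq, Finset.mul_sum]
  refine Finset.sum_congr rfl fun d hd => ?_
  have h1 : d.degree = m := by
    by_contra h
    exact (mem_support_iff.1 hd) (hF.coeff_eq_zero h)
  have h2 : ∏ i ∈ d.support, (r * v i) ^ d i = r ^ m * ∏ i ∈ d.support, v i ^ d i := by
    simp_rw [mul_pow, Finset.prod_mul_distrib]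
    rw [Finset.prod_pow_eq_pow_sum, ← h1]; rfl
  rw [h2]; ring

theorem eval_zero_form {n m : ℕ} {F : MvPolynomial (Fin n) ℝ} (hF : F.IsHomogeneous m)
    (hm : m ≠ 0) : eval 0 F = 0 := by
  have h := eval_smul_form hF 0 0
  simp only [zero_pow hm, zero_mul] at h
  exact h

/-! ### Coprimality of binary forms and the resultant -/

/-- The resultant of two binary forms of degrees `m` and `n`. -/
noncomputable def formRes (m n : ℕ) (F G : MvPolynomial (Fin 2) ℝ) : ℝ :=
  Polynomial.resultant (toPoly F) (toPoly G) m n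

theorem isRelPrime_X_pow (M N : ℕ) :
    IsRelPrime (X 0 ^ M : MvPolynomial (Fin 2) ℝ) (X 1 ^ N) := by
  have h : IsRelPrime (X 0 : MvPolynomial (Fin 2) ℝ) (X 1) := by
    rw [(X_prime (i := (0 : Fin 2)) (R := ℝ)).irreducible.isRelPrime_iff_not_dvd, X_dvd_X]
    decide
  exact h.pow

section

variable {m n : ℕ} {F G : MvPolynomial (Fin 2) ℝ}

/-- If the resultant of two forms does not vanish, they generate all forms of degree one less than
the sum of their degrees. -/
theorem exists_combination_of_formRes_ne_zero (hF : F.IsHomogeneous (m + 1))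
    (hG : G.IsHomogeneous (n + 1)) (h : formRes (m + 1) (n + 1) F G ≠ 0) {w : ℝ[X]}
    (hw : w.natDegree ≤ m + n + 1) :
    ∃ U V : MvPolynomial (Fin 2) ℝ, F * V + G * U = homog (m + n + 1) w := by
  have hw' : w ∈ Polynomial.degreeLT ℝ (m + 1 + (n + 1)) := by
    rw [Polynomial.mem_degreeLT]
    exact (Polynomial.degree_le_of_natDegree_le hw).trans_lt (by exact_mod_cast (by omega))
  have key := congrArg (fun φ => (φ ⟨w, hw'⟩).1) (Polynomial.sylveserMap_comp_adjSylvester _ _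
    (natDegree_toPoly_le hF) (natDegree_toPoly_le hG))
  obtain ⟨⟨⟨u, hu⟩, ⟨v, hv⟩⟩, huv⟩ : ∃ q, q = (Polynomial.adjSylvester (m := m + 1) (n := n + 1)
    (toPoly F) (toPoly G)) ⟨w, hw'⟩ := ⟨_, rfl⟩
  simp only [LinearMap.comp_apply, ← huv, LinearMap.smul_apply, LinearMap.id_apply,
    Polynomial.sylvesterMap_apply_coe] at key
  have hu' : u.natDegree ≤ m := by
    rw [Polynomial.mem_degreeLT] at hu
    exact Polynomial.natDegree_le_of_degree_le (Order.lt_succ_iff.1 hu)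
  have hv' : v.natDegree ≤ n := by
    rw [Polynomial.mem_degreeLT] at hv
    exact Polynomial.natDegree_le_of_degree_le (Order.lt_succ_iff.1 hv)
  refine ⟨C (formRes (m + 1) (n + 1) F G)⁻¹ * homog m u,
    C (formRes (m + 1) (n + 1) F G)⁻¹ * homog n v, ?_⟩
  have e1 : F * homog n v + G * homog m u =
      C (formRes (m + 1) (n + 1) F G) * homog (m + n + 1) w := by
    refine form_ext (m := m + n + 1) ?_ ?_ ?_
    · refine IsHomogeneous.add ?_ ?_
      · have := hF.mul (isHomogeneous_homog n v)
        rwa [show m + 1 + n = m + n + 1 by ring] at this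
      · have := hG.mul (isHomogeneous_homog m u)
        rwa [show n + 1 + m = m + n + 1 by ring] at this
    · exact (isHomogeneous_homog _ _).C_mul _
    · rw [map_add, map_mul, map_mul, map_mul, toPoly_homog hu', toPoly_homog hv',
        toPoly_homog hw, key]
      simp [toPoly, formRes, Polynomial.smul_eq_C_mul, Polynomial.C_eq_algebraMap]
  calc _ = C (formRes (m + 1) (n + 1) F G)⁻¹ * (F * homog n v + G * homog m u) := by ring
    _ = _ := by rw [e1, ← mul_assoc, ← C_mul, inv_mul_cancel₀ h, C_1, one_mul]

theorem exists_combination_eq_X_pow (hF : F.IsHomogeneous (m + 1))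
    (hG : G.IsHomogeneous (n + 1)) (h : formRes (m + 1) (n + 1) F G ≠ 0) (i : Fin 2) :
    ∃ U V : MvPolynomial (Fin 2) ℝ, F * V + G * U = X i ^ (m + n + 1) := by
  have key : ∃ w : ℝ[X], w.natDegree ≤ m + n + 1 ∧
      homog (m + n + 1) w = X i ^ (m + n + 1) := by
    fin_cases i
    · refine ⟨Polynomial.X ^ (m + n + 1), by simp, ?_⟩
      refine form_ext (isHomogeneous_homog _ _) (isHomogeneous_X_pow _ _) ?_
      rw [toPoly_homog (by simp)]
      simp [toPoly]
    · refine ⟨1, by simp, ?_⟩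
      refine form_ext (isHomogeneous_homog _ _) (isHomogeneous_X_pow _ _) ?_
      rw [toPoly_homog (by simp)]
      simp [toPoly]
  obtain ⟨w, hw, e⟩ := key
  rw [← e]
  exact exists_combination_of_formRes_ne_zero hF hG h hw

theorem isRelPrime_of_formRes_ne_zero (hF : F.IsHomogeneous (m + 1))
    (hG : G.IsHomogeneous (n + 1)) (h : formRes (m + 1) (n + 1) F G ≠ 0) : IsRelPrime F G := by
  intro d hdF hdG
  have key : ∀ i, d ∣ X i ^ (m + n + 1) := by
    intro i
    obtain ⟨U, V, e⟩ := exists_combination_eq_X_pow hF hG h i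
    rw [← e]
    exact dvd_add (hdF.mul_right _) (hdG.mul_right _)
  exact isRelPrime_X_pow _ _ (key 0) (key 1)

theorem ne_zero_of_isRelPrime (hG : G.IsHomogeneous (n + 1)) (h : IsRelPrime F G) : F ≠ 0 := by
  rintro rfl
  have hu : IsUnit G := isRelPrime_zero_left.1 h
  exact (hu.map (eval (0 : Fin 2 → ℝ))).ne_zero (eval_zero_form hG n.succ_ne_zero)

theorem eq_zero_of_form_dvd {k l : ℕ} (hkl : l < k) (hF : F.IsHomogeneous k)
    (hG : G.IsHomogeneous l) (h : F ∣ G) : G = 0 := by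
  by_contra hG0
  obtain ⟨H, rfl⟩ := h
  have hF0 : F ≠ 0 := left_ne_zero_of_mul hG0
  have hH0 : H ≠ 0 := right_ne_zero_of_mul hG0
  have h1 := hG.totalDegree hG0
  rw [totalDegree_mul_of_isDomain hF0 hH0, hF.totalDegree hF0] at h1
  omega

/-- The Sylvester map of coprime forms is injective, so its determinant, the resultant, does not
vanish. -/
theorem formRes_ne_zero_of_isRelPrime (hF : F.IsHomogeneous (m + 1))
    (hG : G.IsHomogeneous (n + 1)) (h : IsRelPrime F G) : formRes (m + 1) (n + 1) F G ≠ 0 := by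
  have hF0 := ne_zero_of_isRelPrime hG h
  set S := Polynomial.sylvesterMap _ _ (natDegree_toPoly_le hF) (natDegree_toPoly_le hG) with hS
  have hinj : Function.Injective S := by
    rw [injective_iff_map_eq_zero]
    rintro ⟨⟨u, hu⟩, ⟨v, hv⟩⟩ huv
    have e := congrArg Subtype.val huv
    simp only [hS, Polynomial.sylvesterMap_apply_coe, ZeroMemClass.coe_zero] at e
    have hu' : u.natDegree ≤ m := by
      rw [Polynomial.mem_degreeLT] at hu
      exact Polynomial.natDegree_le_of_degree_le (Order.lt_succ_iff.1 hu)
    have hv' : v.natDegree ≤ n := by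
      rw [Polynomial.mem_degreeLT] at hv
      exact Polynomial.natDegree_le_of_degree_le (Order.lt_succ_iff.1 hv)
    have e1 : F * homog n v + G * homog m u = 0 := by
      refine form_ext (m := m + n + 1) ?_ (isHomogeneous_zero _ _ _) ?_
      · refine IsHomogeneous.add ?_ ?_
        · have := hF.mul (isHomogeneous_homog n v)
          rwa [show m + 1 + n = m + n + 1 by ring] at this
        · have := hG.mul (isHomogeneous_homog m u)
          rwa [show n + 1 + m = m + n + 1 by ring] at this
      · rw [map_add, map_mul, map_mul, toPoly_homog hu', toPoly_homog hv', map_zero, e]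
    have e2 : homog m u = 0 := by
      refine eq_zero_of_form_dvd (Nat.lt_succ_self m) hF (isHomogeneous_homog _ _) ?_
      refine h.dvd_of_dvd_mul_left ?_
      exact ⟨-homog n v, by linear_combination e1⟩
    have e3 : homog n v = 0 := by
      rw [e2, mul_zero, add_zero] at e1
      exact (mul_eq_zero.1 e1).resolve_left hF0
    have e4 : u = 0 := by rw [← toPoly_homog hu', e2, map_zero]
    have e5 : v = 0 := by rw [← toPoly_homog hv', e3, map_zero]
    subst e4 e5
    rfl
  have hfr : Module.finrank ℝ (Polynomial.degreeLT ℝ (m + 1) × Polynomial.degreeLT ℝ (n + 1)) =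
      Module.finrank ℝ (Polynomial.degreeLT ℝ (m + 1 + (n + 1))) := by
    rw [Module.finrank_eq_card_basis (((Polynomial.degreeLT.basis ℝ (m + 1)).prod
      (Polynomial.degreeLT.basis ℝ (n + 1))).reindex finSumFinEquiv),
      Module.finrank_eq_card_basis (Polynomial.degreeLT.basis ℝ (m + 1 + (n + 1)))]
  have : FiniteDimensional ℝ (Polynomial.degreeLT ℝ (m + 1)) :=
    (Polynomial.degreeLT.basis ℝ (m + 1)).finiteDimensional_of_finite
  have : FiniteDimensional ℝ (Polynomial.degreeLT ℝ (n + 1)) :=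
    (Polynomial.degreeLT.basis ℝ (n + 1)).finiteDimensional_of_finite
  have : FiniteDimensional ℝ (Polynomial.degreeLT ℝ (m + 1 + (n + 1))) :=
    (Polynomial.degreeLT.basis ℝ (m + 1 + (n + 1))).finiteDimensional_of_finite
  have hdet := (LinearEquiv.isUnit_det (LinearMap.linearEquivOfInjective S hinj hfr)
    (((Polynomial.degreeLT.basis ℝ (m + 1)).prod
      (Polynomial.degreeLT.basis ℝ (n + 1))).reindex finSumFinEquiv)
    (Polynomial.degreeLT.basis ℝ (m + 1 + (n + 1)))).ne_zero
  have hS' : ((LinearMap.linearEquivOfInjective S hinj hfr : _ ≃ₗ[ℝ] _) : _ →ₗ[ℝ] _) = S := by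
    exact LinearMap.ext fun x => rfl
  rw [hS', Polynomial.toMatrix_sylvesterMap'] at hdet
  exact hdet

theorem isRelPrime_iff_formRes_ne_zero (hF : F.IsHomogeneous (m + 1))
    (hG : G.IsHomogeneous (n + 1)) : IsRelPrime F G ↔ formRes (m + 1) (n + 1) F G ≠ 0 :=
  ⟨formRes_ne_zero_of_isRelPrime hF hG, isRelPrime_of_formRes_ne_zero hF hG⟩

/-- Two binary forms without common complex zeros admit no syzygy in degrees below the Koszul
one. -/
theorem eq_zero_of_no_common_zero (hF : F.IsHomogeneous (m + 1)) (hG : G.IsHomogeneous (n + 1))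
    (h : ∀ p : Fin 2 → ℂ, aeval p F = 0 → aeval p G = 0 → p = 0)
    {U V : MvPolynomial (Fin 2) ℝ} (hU : U.IsHomogeneous m) (hV : V.IsHomogeneous n)
    (e : F * V + G * U = 0) : U = 0 ∧ V = 0 := by
  have hcop : IsCoprime (toPoly F) (toPoly G) := by
    rw [Polynomial.isCoprime_iff_aeval_ne_zero_of_isAlgClosed ℝ ℂ]
    intro a
    by_contra! hc
    have hp : (![a, 1] : Fin 2 → ℂ) 1 ≠ 0 := by simp
    have := h ![a, 1]
      (by rw [aeval_form_of_ne_zero hF hp, dehom_eq_map, Polynomial.eval_map_algebraMap]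
          simp [hc.1])
      (by rw [aeval_form_of_ne_zero hG hp, dehom_eq_map, Polynomial.eval_map_algebraMap]
          simp [hc.2])
    simpa using congrFun this 1
  have hdeg : ¬ ((toPoly F).natDegree ≤ m ∧ (toPoly G).natDegree ≤ n) := by
    rintro ⟨h1, h2⟩
    have hp : (![1, 0] : Fin 2 → ℂ) 1 = 0 := by simp
    have := h ![1, 0]
      (by rw [aeval_form_of_eq_zero hF hp, coeff_dehom,
            Polynomial.coeff_eq_zero_of_natDegree_lt (by omega)]; simp)
      (by rw [aeval_form_of_eq_zero hG hp, coeff_dehom,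
            Polynomial.coeff_eq_zero_of_natDegree_lt (by omega)]; simp)
    simpa using congrFun this 0
  have e' := congrArg toPoly e
  rw [map_add, map_mul, map_mul, map_zero] at e'
  obtain ⟨k, hk⟩ : toPoly F ∣ toPoly U := by
    refine hcop.dvd_of_dvd_mul_left ⟨-toPoly V, ?_⟩
    linear_combination e'
  have hF0 : toPoly F ≠ 0 := by
    intro h0
    rw [h0, isCoprime_zero_left] at hcop
    exact hdeg ⟨by simp [h0], by simp [Polynomial.natDegree_eq_zero_of_isUnit hcop]⟩
  have hVk : toPoly V = - (toPoly G * k) := by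
    apply mul_left_cancel₀ hF0
    rw [hk] at e'
    linear_combination e'
  have hk0 : k = 0 := by
    by_contra hk0
    apply hdeg
    constructor
    · have := natDegree_toPoly_le hU
      rw [hk, Polynomial.natDegree_mul hF0 hk0] at this
      omega
    · by_cases hG0 : toPoly G = 0
      · simp [hG0]
      have := natDegree_toPoly_le hV
      rw [hVk, Polynomial.natDegree_neg, Polynomial.natDegree_mul hG0 hk0] at this
      omega
  exact ⟨(toPoly_eq_zero hU).1 (by simp [hk, hk0]), (toPoly_eq_zero hV).1 (by simp [hVk, hk0])⟩

end

/-! ### Vanishing of the discriminant and of the invariant `Φ` -/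

theorem pairProd_ne_zero_iff (B : ℂ × ℂ → ℂ × ℂ → ℂ) (l : List (ℂ × ℂ)) :
    pairProd B l ≠ 0 ↔ l.Pairwise (fun p q => B p q ≠ 0) := by
  induction l with
  | nil => simp [pairProd]
  | cons p l ih =>
    rw [pairProd, mul_ne_zero_iff, ih, List.pairwise_cons]
    refine and_congr_left fun _ => ?_
    rw [ne_eq, List.prod_eq_zero_iff]
    simp only [List.mem_map, not_exists, not_and]

/-- The Bezoutian of the binary forms of degree `n` with coefficients `g` and `h`. -/
noncomputable def bezoutianOf (n : ℕ) (g h : ℕ → ℂ) (p q : ℂ × ℂ) : ℂ :=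
  ∑ k ∈ Finset.range (n + 1), ∑ j ∈ Finset.range k, (g k * h j - g j * h k) *
    ∑ l ∈ Finset.range (k - j),
      p.1 ^ (j + l) * p.2 ^ (n - 1 - (j + l)) * q.1 ^ (k - 1 - l) * q.2 ^ (n - k + l)

theorem bezoutianOf_symm (n : ℕ) (g h : ℕ → ℂ) (p q : ℂ × ℂ) :
    bezoutianOf n g h p q = bezoutianOf n g h q p := by
  unfold bezoutianOf
  refine Finset.sum_congr rfl fun k hk => Finset.sum_congr rfl fun j hj => ?_
  rw [← Finset.sum_range_reflect]
  congr 1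
  refine Finset.sum_congr rfl fun l hl => ?_
  have hk' := Finset.mem_range.1 hk
  have hj' := Finset.mem_range.1 hj
  have hl' := Finset.mem_range.1 hl
  have e1 : j + (k - j - 1 - l) = k - 1 - l := by omega
  have e2 : n - 1 - (k - 1 - l) = n - k + l := by omega
  have e3 : k - 1 - (k - j - 1 - l) = j + l := by omega
  have e4 : n - k + (k - j - 1 - l) = n - 1 - (j + l) := by omega
  rw [e1, e2, e3, e4]
  ring

theorem bezoutian_symm (n : ℕ) (G H : MvPolynomial (Fin 2) ℝ) (p q : ℂ × ℂ) :
    bezoutian n G H p q = bezoutian n G H q p :=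
  bezoutianOf_symm n _ _ p q

theorem sum_range_sum_range_eq_sum_lt {M : Type*} [AddCommMonoid M] (c : ℕ → ℕ → M) (N : ℕ) :
    ∑ k ∈ Finset.range N, ∑ j ∈ Finset.range N, c k j =
      ∑ k ∈ Finset.range N, (∑ j ∈ Finset.range k, (c k j + c j k) + c k k) := by
  induction N with
  | zero => simp
  | succ N ih =>
    rw [Finset.sum_range_succ _ N, Finset.sum_range_succ
      (fun k => ∑ j ∈ Finset.range k, (c k j + c j k) + c k k) N, ← ih]
    simp_rw [Finset.sum_range_succ _ N, Finset.sum_add_distrib]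
    abel

/-- The Bezoutian is the quotient `(g(u) h(v) - g(v) h(u)) / (u - v)`. -/
theorem bezoutian_mul_sub {n : ℕ} {G H : MvPolynomial (Fin 2) ℝ} (hG : (dehom G).natDegree ≤ n)
    (hH : (dehom H).natDegree ≤ n) (u v : ℂ) :
    bezoutian n G H (u, 1) (v, 1) * (u - v) =
      (dehom G).eval u * (dehom H).eval v - (dehom G).eval v * (dehom H).eval u := by
  have e : (dehom G).eval u * (dehom H).eval v - (dehom G).eval v * (dehom H).eval u =
      ∑ k ∈ Finset.range (n + 1), ∑ j ∈ Finset.range (n + 1),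
        (dehom G).coeff k * (dehom H).coeff j * (u ^ k * v ^ j - v ^ k * u ^ j) := by
    simp only [Polynomial.eval_eq_sum_range' (Nat.lt_succ_of_le hG),
      Polynomial.eval_eq_sum_range' (Nat.lt_succ_of_le hH), Finset.sum_mul_sum,
      ← Finset.sum_sub_distrib]
    refine Finset.sum_congr rfl fun k _ => Finset.sum_congr rfl fun j _ => ?_
    ring
  rw [e, sum_range_sum_range_eq_sum_lt, bezoutian, Finset.sum_mul]
  refine Finset.sum_congr rfl fun k _ => ?_
  have hd : (dehom G).coeff k * (dehom H).coeff k * (u ^ k * v ^ k - v ^ k * u ^ k) = 0 := by ring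
  rw [hd, add_zero, Finset.sum_mul]
  refine Finset.sum_congr rfl fun j hj => ?_
  have hj' := Finset.mem_range.1 hj
  have hgeom : (∑ l ∈ Finset.range (k - j), u ^ (j + l) * v ^ (k - 1 - l)) * (u - v) =
      u ^ k * v ^ j - u ^ j * v ^ k := by
    have hg := geom_sum₂_mul u v (k - j)
    have e1 : ∑ l ∈ Finset.range (k - j), u ^ (j + l) * v ^ (k - 1 - l) =
        (u * v) ^ j * ∑ l ∈ Finset.range (k - j), u ^ l * v ^ (k - j - 1 - l) := by
      rw [Finset.mul_sum]
      refine Finset.sum_congr rfl fun l hl => ?_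
      have hl' := Finset.mem_range.1 hl
      have : k - 1 - l = j + (k - j - 1 - l) := by omega
      rw [this, pow_add, pow_add, mul_pow]; ring
    rw [e1, mul_assoc, hg]
    have e2 : u ^ k = u ^ j * u ^ (k - j) := by rw [← pow_add]; congr 1; omega
    have e3 : v ^ k = v ^ j * v ^ (k - j) := by rw [← pow_add]; congr 1; omega
    rw [e2, e3, mul_pow]; ring
  simp only [one_pow, mul_one]
  rw [mul_assoc, hgeom]
  ring

theorem mem_projZeros {m : ℕ} {F : MvPolynomial (Fin 2) ℝ} (h0 : dehom F ≠ 0) {α : ℂ}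
    (hα : (dehom F).eval α = 0) : (α, 1) ∈ projZeros m F := by
  refine List.mem_append_left _ (List.mem_map.2 ⟨α, ?_, rfl⟩)
  rw [Multiset.mem_toList, Polynomial.mem_roots h0]
  exact hα

/-- If `G / H` takes the same value at a nonreal zero of `F` and at its conjugate, then
`Φ(F, G, H)` vanishes. -/
theorem phiInv_eq_zero_of_nonreal_zero {m n : ℕ} (hm : 2 ≤ m) (hn : 2 ≤ n)
    {F G H : MvPolynomial (Fin 2) ℝ} (hF : F.IsHomogeneous m) (hG : G.IsHomogeneous n)
    (hH : H.IsHomogeneous n) {p : Fin 2 → ℂ}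
    (hp : p 0 * starRingEnd ℂ (p 1) ≠ starRingEnd ℂ (p 0) * p 1) (hpF : aeval p F = 0)
    (hGH : aeval p G * starRingEnd ℂ (aeval p H) = starRingEnd ℂ (aeval p G) * aeval p H) :
    phiInv m n F G H = 0 := by
  by_cases h0 : dehom F = 0
  · rw [phiInv, h0, Polynomial.leadingCoeff_zero, zero_pow, zero_mul]
    exact Nat.mul_ne_zero (by omega) (by omega)
  have hp1 : p 1 ≠ 0 := by
    intro h
    apply hp
    simp [h]
  have hp1' : starRingEnd ℂ (p 1) ≠ 0 := by simpa using hp1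
  set α := p 0 / p 1 with hα
  set β := starRingEnd ℂ α with hβ
  have hαβ : α ≠ β := by
    intro h
    rw [hβ, hα, map_div₀, div_eq_div_iff hp1 hp1'] at h
    exact hp h
  have hβ' : β = starRingEnd ℂ (p 0) / starRingEnd ℂ (p 1) := by rw [hβ, hα, map_div₀]
  have ev : ∀ {k : ℕ} {K : MvPolynomial (Fin 2) ℝ}, K.IsHomogeneous k →
      aeval p K = p 1 ^ k * (dehom K).eval α ∧
      starRingEnd ℂ (aeval p K) = starRingEnd ℂ (p 1) ^ k * (dehom K).eval β := by
    intro k K hK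
    refine ⟨aeval_form_of_ne_zero hK hp1, ?_⟩
    rw [← aeval_conj, aeval_form_of_ne_zero hK hp1', hβ']
  have hFα : (dehom F).eval α = 0 := by
    rw [(ev hF).1] at hpF
    exact (mul_eq_zero.1 hpF).resolve_left (pow_ne_zero _ hp1)
  have hFβ : (dehom F).eval β = 0 := by
    have := (ev hF).2
    rw [hpF, map_zero] at this
    exact (mul_eq_zero.1 this.symm).resolve_left (pow_ne_zero _ hp1')
  have hB : bezoutian n G H (α, 1) (β, 1) = 0 := by
    have h1 := bezoutian_mul_sub (n := n) (G := G) (H := H)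
      (by rw [natDegree_dehom]; exact natDegree_toPoly_le hG)
      (by rw [natDegree_dehom]; exact natDegree_toPoly_le hH) α β
    rw [(ev hG).2, (ev hH).2, (ev hG).1, (ev hH).1] at hGH
    have h2 : (p 1 ^ n * starRingEnd ℂ (p 1) ^ n) * ((dehom G).eval α * (dehom H).eval β -
        (dehom G).eval β * (dehom H).eval α) = 0 := by linear_combination hGH
    rw [(mul_eq_zero.1 h2).resolve_left
      (mul_ne_zero (pow_ne_zero _ hp1) (pow_ne_zero _ hp1'))] at h1
    exact (mul_eq_zero.1 h1).resolve_right (sub_ne_zero.2 hαβ)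
  rw [phiInv]
  refine mul_eq_zero_of_right _ ?_
  by_contra hne
  rw [← ne_eq, pairProd_ne_zero_iff] at hne
  have hsymm : Std.Symm (fun p q => bezoutian n G H p q ≠ 0) :=
    ⟨fun p q h => by rwa [bezoutian_symm]⟩
  exact hne.forall (mem_projZeros h0 hFα) (mem_projZeros h0 hFβ)
    (fun h => hαβ (congrArg Prod.fst h)) hB

theorem dehom_pderiv_zero (F : MvPolynomial (Fin 2) ℝ) :
    dehom (pderiv 0 F) = Polynomial.derivative (dehom F) := by
  rw [dehom_eq_map, dehom_eq_map, toPoly_pderiv_zero, Polynomial.derivative_map]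

/-- The discriminant of a form vanishes if the form has a multiple zero on the complex projective
line. -/
theorem disc_eq_zero_of_singular {m : ℕ} (hm : 2 ≤ m) {F : MvPolynomial (Fin 2) ℝ}
    (hF : F.IsHomogeneous m) {p : Fin 2 → ℂ} (hp : p ≠ 0)
    (h0 : aeval p (pderiv 0 F) = 0) (h1 : aeval p (pderiv 1 F) = 0) : disc m F = 0 := by
  by_cases hd : dehom F = 0
  · rw [disc, hd, Polynomial.leadingCoeff_zero, zero_pow (by omega), zero_mul]
  rw [disc]
  refine mul_eq_zero_of_right _ ?_
  by_contra hne
  rw [← ne_eq, pairProd_ne_zero_iff] at hne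
  have key : ∃ x, [x, x].Sublist (projZeros m F) := by
    by_cases hp1 : p 1 = 0
    · have hp0 : p 0 ≠ 0 := by
        intro h
        apply hp
        ext i
        fin_cases i
        · exact h
        · exact hp1
      rw [aeval_form_of_eq_zero hF.pderiv hp1, dehom_pderiv_zero, Polynomial.coeff_derivative] at h0
      rw [aeval_form_of_eq_zero hF.pderiv hp1, coeff_dehom, toPoly_pderiv_one hF] at h1
      obtain ⟨k, rfl⟩ : ∃ k, m = k + 2 := ⟨m - 2, by omega⟩
      have c1 : (dehom F).coeff (k + 2) = 0 := by
        have := (mul_eq_zero.1 h0).resolve_left (pow_ne_zero _ hp0)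
        rw [show k + 2 - 1 + 1 = k + 2 by omega] at this
        refine (mul_eq_zero.1 this).resolve_right ?_
        exact Nat.cast_add_one_ne_zero _
      have c2 : (dehom F).coeff (k + 1) = 0 := by
        have := (mul_eq_zero.1 h1).resolve_left (pow_ne_zero _ hp0)
        rw [show k + 2 - 1 = k + 1 by omega, Polynomial.coeff_sub, Polynomial.coeff_X_mul,
          Polynomial.coeff_derivative, ← Polynomial.C_eq_natCast, Polynomial.coeff_C_mul] at this
        rw [coeff_dehom]
        push_cast at this ⊢
        linear_combination this
      have hdeg : (dehom F).natDegree ≤ k := by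
        have h2 : (dehom F).natDegree ≤ k + 2 := by
          rw [natDegree_dehom]; exact natDegree_toPoly_le hF
        rw [Polynomial.natDegree_le_iff_coeff_eq_zero]
        intro N hN
        obtain h | h | h : N = k + 1 ∨ N = k + 2 ∨ k + 2 < N := by omega
        · rw [h, c2]
        · rw [h, c1]
        · exact Polynomial.coeff_eq_zero_of_natDegree_lt (by omega)
      refine ⟨(-1, 0), List.Sublist.trans ?_ (List.sublist_append_right _ _)⟩
      have : [((-1 : ℂ), (0 : ℂ)), (-1, 0)] = List.replicate 2 (-1, 0) := rfl
      rw [this, List.replicate_sublist_replicate]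
      omega
    · refine ⟨(p 0 / p 1, 1), List.Sublist.trans ?_ (List.sublist_append_left _ _)⟩
      have hF0 : aeval p F = 0 := by
        have := congrArg (aeval p) hF.sum_X_mul_pderiv
        rw [Fin.sum_univ_two, map_add, map_mul, map_mul, h0, h1, nsmul_eq_mul, map_mul,
          map_natCast] at this
        have hm0 : (m : ℂ) ≠ 0 := by exact_mod_cast (by omega)
        simpa [hm0] using this.symm
      rw [aeval_form_of_ne_zero hF hp1] at hF0
      rw [aeval_form_of_ne_zero hF.pderiv hp1, dehom_pderiv_zero] at h0
      have hmult := (Polynomial.one_lt_rootMultiplicity_iff_isRoot hd).2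
        ⟨(mul_eq_zero.1 hF0).resolve_left (pow_ne_zero _ hp1),
          (mul_eq_zero.1 h0).resolve_left (pow_ne_zero _ hp1)⟩
      rw [← Polynomial.count_roots, ← Multiset.coe_toList (dehom F).roots,
        Multiset.coe_count] at hmult
      have h2 := (List.duplicate_iff_sublist).1 (List.duplicate_iff_two_le_count.2 hmult)
      exact h2.map (fun α => (α, (1 : ℂ)))
  obtain ⟨x, hx⟩ := key
  have := hne.sublist hx
  simp at this

/-! ### Regularity of the solutions of `C_t` -/

theorem eval_lift (F : MvPolynomial (Fin 2) ℝ) (v : Fin 3 → ℝ) :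
    eval v (lift F) = eval (v ∘ Fin.castSucc) F := by
  rw [lift, eval_rename]

theorem eval_snoc_lift (F : MvPolynomial (Fin 2) ℝ) (r : Fin 2 → ℝ) (z : ℝ) :
    eval (Fin.snoc r z : Fin 3 → ℝ) (lift F) = eval r F := by
  rw [eval_lift]
  congr 2
  ext i
  exact Fin.snoc_castSucc (α := fun _ => ℝ) z r i

theorem eval_normalQuartic (f₂ f₃ f₄ : MvPolynomial (Fin 2) ℝ) (r : Fin 2 → ℝ) (z : ℝ) :
    eval (Fin.snoc r z : Fin 3 → ℝ) (normalQuartic f₂ f₃ f₄) =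
      z ^ 4 + eval r f₂ * z ^ 2 + eval r f₃ * z + eval r f₄ := by
  have h2 : (Fin.snoc r z : Fin 3 → ℝ) 2 = z := Fin.snoc_last (α := fun _ => ℝ) z r
  simp only [normalQuartic, map_add, map_mul, map_pow, eval_X, eval_snoc_lift, h2]

theorem eval_normalQuartic_sub (f₂ f₃ f₄ : MvPolynomial (Fin 2) ℝ) (r : Fin 2 → ℝ) (z : ℝ) :
    eval (Fin.snoc r z : Fin 3 → ℝ) (normalQuartic f₂ f₃ f₄ - X 2 ^ 4) =
      eval r f₂ * z ^ 2 + eval r f₃ * z + eval r f₄ := by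
  have h2 : (Fin.snoc r z : Fin 3 → ℝ) 2 = z := Fin.snoc_last (α := fun _ => ℝ) z r
  rw [map_sub, eval_normalQuartic, map_pow, eval_X, h2]
  ring

theorem forall_quadratic_nonneg_of_isPSD_sub {f₂ f₃ f₄ : MvPolynomial (Fin 2) ℝ}
    (h : IsPSD (normalQuartic f₂ f₃ f₄ - X 2 ^ 4)) (r : Fin 2 → ℝ) (z : ℝ) :
    0 ≤ eval r f₂ * z ^ 2 + eval r f₃ * z + eval r f₄ := by
  rw [← eval_normalQuartic_sub]
  exact h _

/-- A polynomial `a z ^ 2 + b z + c` which is nonnegative for all `z` has `a ≥ 0`. -/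
theorem isPSD_leading_of_isPSD_sub {f₂ f₃ f₄ : MvPolynomial (Fin 2) ℝ}
    (h : IsPSD (normalQuartic f₂ f₃ f₄ - X 2 ^ 4)) : IsPSD f₂ := by
  intro r
  by_contra! hneg
  set b := eval r f₃ with hb
  set c := eval r f₄ with hc
  set a := eval r f₂ with ha
  have h1 := forall_quadratic_nonneg_of_isPSD_sub h r ((|b| + |c| + 1) / (-a) + 1)
  rw [← ha, ← hb, ← hc] at h1
  set z := (|b| + |c| + 1) / (-a) + 1 with hz
  have hpos : 0 ≤ (|b| + |c| + 1) / (-a) := div_nonneg (by positivity) (by linarith)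
  have hz1 : 1 ≤ z := by linarith
  have haz : a * (z - 1) = -(|b| + |c| + 1) := by
    rw [hz]
    have : a ≠ 0 := hneg.ne
    field_simp
    ring
  have hb1 := le_abs_self b
  have hc1 := le_abs_self c
  nlinarith [abs_nonneg b, abs_nonneg c, mul_nonneg (abs_nonneg c) (sub_nonneg.2 hz1),
    mul_le_mul_of_nonneg_right hb1 (by linarith : (0 : ℝ) ≤ z)]

theorem hasDerivAt_eval_line {n : ℕ} (F : MvPolynomial (Fin n) ℝ) (r : Fin n → ℝ) (i : Fin n) :
    HasDerivAt (fun s : ℝ => eval (fun j => r j + s * if j = i then 1 else 0) F)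
      (eval r (pderiv i F)) 0 := by
  induction F using MvPolynomial.induction_on with
  | C a => simpa using hasDerivAt_const (0 : ℝ) a
  | add p q hp hq =>
    simp only [map_add]
    exact hp.fun_add hq
  | mul_X p j hp =>
    have hX : HasDerivAt (fun s : ℝ => r j + s * if j = i then 1 else 0)
        (if j = i then 1 else 0) 0 := by
      simpa using ((hasDerivAt_id (0 : ℝ)).mul_const (if j = i then (1 : ℝ) else 0)).const_add (r j)
    have h := hp.fun_mul hX
    simp only [map_mul, eval_X]
    refine h.congr_deriv ?_
    rw [Derivation.leibniz, pderiv_X, map_add, smul_eq_mul, smul_eq_mul, map_mul, map_mul, eval_X,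
      Pi.single_apply]
    simp only [zero_mul, add_zero]
    split_ifs
    · rw [map_one]; ring
    · rw [map_zero]; ring

theorem eval_pderiv_eq_zero_of_isPSD {n : ℕ} {F : MvPolynomial (Fin n) ℝ} (hF : IsPSD F)
    {r : Fin n → ℝ} (hr : eval r F = 0) (i : Fin n) : eval r (pderiv i F) = 0 := by
  refine IsLocalMin.hasDerivAt_eq_zero ?_ (hasDerivAt_eval_line F r i)
  refine Filter.Eventually.of_forall fun s => ?_
  have : eval (fun j => r j + 0 * if j = i then (1 : ℝ) else 0) F = 0 := by simpa using hr
  beta_reduce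
  rw [this]
  exact hF _

theorem aeval_smul_form {m : ℕ} {F : MvPolynomial (Fin 2) ℝ} (hF : F.IsHomogeneous m) (c : ℂ)
    (q : Fin 2 → ℂ) : aeval (fun i => c * q i) F = c ^ m * aeval q F := by
  rw [aeval_form hF, aeval_form hF, Finset.mul_sum]
  refine Finset.sum_congr rfl fun i hi => ?_
  have h1 : c ^ m = c ^ i * c ^ (m - i) := by
    rw [← pow_add]; congr 1; have := Finset.mem_range.1 hi; omega
  rw [h1]; ring

/-- A point of the complex projective line equal to its conjugate has real homogeneous
coordinates. -/
theorem exists_real_multiple {p : Fin 2 → ℂ} (hp : p ≠ 0)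
    (h : p 0 * starRingEnd ℂ (p 1) = starRingEnd ℂ (p 0) * p 1) :
    ∃ (c : ℂ) (r : Fin 2 → ℝ), c ≠ 0 ∧ r ≠ 0 ∧ p = fun i => c * (r i : ℂ) := by
  by_cases hp1 : p 1 = 0
  · have hp0 : p 0 ≠ 0 := by
      intro h
      apply hp
      ext i
      fin_cases i
      · exact h
      · exact hp1
    refine ⟨p 0, ![1, 0], hp0, fun h => by simpa using congrFun h 0, ?_⟩
    ext i
    fin_cases i <;> simp [hp1]
  · have hp1' : starRingEnd ℂ (p 1) ≠ 0 := by simpa using hp1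
    have hre : starRingEnd ℂ (p 0 / p 1) = p 0 / p 1 := by
      rw [map_div₀, div_eq_div_iff hp1' hp1, h]
    obtain ⟨x, hx⟩ := Complex.conj_eq_iff_real.1 hre
    refine ⟨p 1, ![x, 1], hp1, fun h => by simpa using congrFun h 1, ?_⟩
    ext i
    fin_cases i
    · simp [← hx, mul_div_cancel₀ _ hp1]
    · simp

section

variable {f₂ f₃ f₄ : MvPolynomial (Fin 2) ℝ}

/-- A real zero of a psd form is a minimum, hence a multiple zero. -/
theorem isPosDef_of_disc_ne_zero {m : ℕ} (hm : 2 ≤ m) {F : MvPolynomial (Fin 2) ℝ}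
    (hF : F.IsHomogeneous m) (hpsd : IsPSD F) (hd : disc m F ≠ 0) : IsPosDef F := by
  intro r hr
  refine lt_of_le_of_ne (hpsd r) fun h0 => hd ?_
  refine disc_eq_zero_of_singular hm hF (p := fun i => (r i : ℂ)) ?_ ?_ ?_
  · intro h
    apply hr
    ext i
    simpa using congrFun h i
  all_goals rw [aeval_ofReal, eval_pderiv_eq_zero_of_isPSD hpsd h0.symm, Complex.ofReal_zero]

/-- A nonzero real quadratic form with a nonreal zero `p` divides every real form vanishing at
`p`. -/
theorem exists_eq_mul_of_common_nonreal_zero {m : ℕ} {F G : MvPolynomial (Fin 2) ℝ}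
    (hF : F.IsHomogeneous 2) (hF0 : F ≠ 0) (hG : G.IsHomogeneous (m + 2)) {p : Fin 2 → ℂ}
    (hp : p 0 * starRingEnd ℂ (p 1) ≠ starRingEnd ℂ (p 0) * p 1) (hpF : aeval p F = 0)
    (hpG : aeval p G = 0) : ∃ H : MvPolynomial (Fin 2) ℝ, H.IsHomogeneous m ∧ G = F * H := by
  have hp1 : p 1 ≠ 0 := by
    intro h
    apply hp
    simp [h]
  have hp1' : starRingEnd ℂ (p 1) ≠ 0 := by simpa using hp1
  set α := p 0 / p 1 with hα
  have him : α.im ≠ 0 := by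
    intro h
    have h2 : starRingEnd ℂ α = α := Complex.conj_eq_iff_im.2 h
    rw [hα, map_div₀, div_eq_div_iff hp1' hp1] at h2
    exact hp h2.symm
  have root : ∀ {k : ℕ} {K : MvPolynomial (Fin 2) ℝ}, K.IsHomogeneous k → aeval p K = 0 →
      Polynomial.aeval α (toPoly K) = 0 := by
    intro k K hK h0
    rw [aeval_form_of_ne_zero hK hp1, dehom_eq_map, Polynomial.eval_map_algebraMap] at h0
    exact (mul_eq_zero.1 h0).resolve_left (pow_ne_zero _ hp1)
  obtain ⟨u, hu⟩ := Polynomial.quadratic_dvd_of_aeval_eq_zero_im_ne_zero _ (root hF hpF) him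
  obtain ⟨w, hw⟩ := Polynomial.quadratic_dvd_of_aeval_eq_zero_im_ne_zero _ (root hG hpG) him
  set q : ℝ[X] := Polynomial.X ^ 2 - Polynomial.C (2 * α.re) * Polynomial.X +
    Polynomial.C (‖α‖ ^ 2) with hq
  have hqd : q.natDegree = 2 := by rw [hq]; compute_degree!
  have hq0 : q ≠ 0 := by
    intro h
    rw [h] at hqd
    simp at hqd
  have hFp : toPoly F ≠ 0 := fun h => hF0 ((toPoly_eq_zero hF).1 h)
  have hu0 : u ≠ 0 := by rintro rfl; exact hFp (by rw [hu, mul_zero])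
  have hud : u.natDegree = 0 := by
    have := natDegree_toPoly_le hF
    rw [hu, Polynomial.natDegree_mul hq0 hu0] at this
    omega
  obtain ⟨c, rfl⟩ := Polynomial.natDegree_eq_zero.1 hud
  have hc : c ≠ 0 := by rintro rfl; simp at hu0
  have hwd : w.natDegree ≤ m := by
    by_cases hw0 : w = 0
    · simp [hw0]
    have := natDegree_toPoly_le hG
    rw [hw, Polynomial.natDegree_mul hq0 hw0] at this
    omega
  refine ⟨homog m (Polynomial.C c⁻¹ * w), isHomogeneous_homog _ _, ?_⟩
  refine form_ext hG ?_ ?_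
  · rw [add_comm]
    exact hF.mul (isHomogeneous_homog _ _)
  · rw [map_mul, toPoly_homog ((Polynomial.natDegree_C_mul_le _ _).trans hwd), hu, hw]
    have : (Polynomial.C c * Polynomial.C c⁻¹ : ℝ[X]) = 1 := by
      rw [← Polynomial.C_mul, mul_inv_cancel₀ hc, Polynomial.C_1]
    linear_combination (-q * w) * this

theorem isHomogeneous_ofNat_mul {m : ℕ} (k : ℕ) [k.AtLeastTwo] {F : MvPolynomial (Fin 2) ℝ}
    (hF : F.IsHomogeneous m) : (OfNat.ofNat k * F).IsHomogeneous m := by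
  have : (OfNat.ofNat k : MvPolynomial (Fin 2) ℝ) = C (OfNat.ofNat k : ℝ) :=
    (map_ofNat C k).symm
  rw [this]
  exact hF.C_mul _

theorem AreForms.isHomogeneous_formP (h : AreForms f₂ f₃ f₄) :
    (formP f₂ f₃ f₄).IsHomogeneous 8 :=
  ((isHomogeneous_jac (k := 3) h.hom₂ h.hom₃ rfl).mul
    (isHomogeneous_jac (k := 5) h.hom₃ h.hom₄ rfl)).sub
    ((isHomogeneous_jac (k := 4) h.hom₂ h.hom₄ rfl).pow 2)

theorem AreForms.isHomogeneous_formQ (h : AreForms f₂ f₃ f₄) :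
    (formQ f₂ f₃ f₄).IsHomogeneous 18 := by
  have h23 := isHomogeneous_jac (k := 3) h.hom₂ h.hom₃ rfl
  have h24 := isHomogeneous_jac (k := 4) h.hom₂ h.hom₄ rfl
  exact ((h.hom₄.pow 2).mul h23).mul
    (((isHomogeneous_ofNat_mul 2 h.hom₄).mul h23).sub (h.hom₃.mul h24))

theorem AreForms.isHomogeneous_formR (h : AreForms f₂ f₃ f₄) :
    (formR f₂ f₃ f₄).IsHomogeneous 9 := by
  have h23 := isHomogeneous_jac (k := 3) h.hom₂ h.hom₃ rfl
  have h24 := isHomogeneous_jac (k := 4) h.hom₂ h.hom₄ rfl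
  exact ((((isHomogeneous_ofNat_mul 8 h.hom₂).mul h.hom₄).sub
    (isHomogeneous_ofNat_mul 3 (h.hom₃.pow 2))).mul h23).add
    (((isHomogeneous_ofNat_mul 2 h.hom₂).mul h.hom₃).mul h24)

/-- At a common zero `p` of `f₂ - t ξ`, `f₃`, `4 f₄ - ξ ^ 2` and `η`, either `f₃` has a double zero
or `Φ(f₃, f₂ ^ 2, f₄)` vanishes. -/
theorem false_of_left_factor_zero (h : AreForms f₂ f₃ f₄) (hE₄ : disc 3 f₃ ≠ 0)
    (hE₈ : phiInv 3 4 f₃ (f₂ ^ 2) f₄ ≠ 0) {t : ℝ}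
    {s : MvPolynomial (Fin 2) ℝ × MvPolynomial (Fin 2) ℝ} (hs : IsSolution f₂ f₃ f₄ t s)
    {p : Fin 2 → ℂ} (hp : p ≠ 0) (hη : aeval p s.2 = 0) (hA : aeval p (f₂ - C t * s.1) = 0)
    (hB : aeval p (4 * f₄ - s.1 ^ 2) = 0) : False := by
  have hf₃ : aeval p f₃ = 0 := by
    have := congrArg (aeval p) hs.eq
    rw [map_add, map_mul, hA, map_pow, map_pow, hη] at this
    simpa using this
  by_cases hre : p 0 * starRingEnd ℂ (p 1) = starRingEnd ℂ (p 0) * p 1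
  · obtain ⟨c, r, hc, hr, rfl⟩ := exists_real_multiple hp hre
    have red : ∀ {k : ℕ} {K : MvPolynomial (Fin 2) ℝ}, K.IsHomogeneous k →
        aeval (fun i => c * (r i : ℂ)) K = 0 → eval r K = 0 := by
      intro k K hK h0
      rw [aeval_smul_form hK, aeval_ofReal] at h0
      exact_mod_cast (mul_eq_zero.1 h0).resolve_left (pow_ne_zero _ hc)
    have hA' := red (h.hom₂.sub (hs.hom_xi.C_mul t)) hA
    have hB' := red ((isHomogeneous_ofNat_mul 4 h.hom₄).sub (hs.hom_xi.pow 2)) hB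
    have hη' := red hs.hom_eta hη
    have hf₃' := red h.hom₃ hf₃
    -- the second derivative of the equation at `r` reads `2 (∂η) ^ 2 + 2 (∂f₃) ^ 2 = 0`
    have hd : ∀ i, eval r (pderiv i f₃) = 0 := by
      intro i
      have hA1 := eval_pderiv_eq_zero_of_isPSD hs.psd_left hA' i
      have hB1 := eval_pderiv_eq_zero_of_isPSD hs.psd_right hB' i
      have e := congrArg (fun F => eval r (pderiv i (pderiv i F))) hs.eq
      simp only [Derivation.leibniz, Derivation.leibniz_pow, smul_eq_mul, nsmul_eq_mul, map_add,
        map_mul] at e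
      generalize f₂ - C t * s.1 = A at *
      generalize 4 * f₄ - s.1 ^ 2 = B at *
      simp [hA', hB', hA1, hB1, hη', hf₃'] at e
      nlinarith [sq_nonneg (eval r (pderiv i f₃)), sq_nonneg (eval r (pderiv i s.2))]
    refine hE₄ (disc_eq_zero_of_singular (by norm_num) h.hom₃ (p := fun i => (r i : ℂ)) ?_ ?_ ?_)
    · intro h0
      apply hr
      ext i
      simpa using congrFun h0 i
    all_goals rw [aeval_ofReal, hd, Complex.ofReal_zero]
  · refine hE₈ (phiInv_eq_zero_of_nonreal_zero (by norm_num) (by norm_num) h.hom₃ (h.hom₂.pow 2)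
      h.hom₄ hre hf₃ ?_)
    have e2 : aeval p f₂ = t * aeval p s.1 := by
      simpa [sub_eq_zero] using hA
    have e4 : aeval p f₄ = aeval p s.1 ^ 2 / 4 := by
      have : 4 * aeval p f₄ = aeval p s.1 ^ 2 := by simpa [sub_eq_zero] using hB
      linear_combination this / 4
    rw [map_pow, e2, e4]
    simp only [map_pow, map_mul, map_div₀, Complex.conj_ofReal]
    have h4 : starRingEnd ℂ 4 = 4 := map_ofNat _ _
    rw [h4]
    ring

end

section

variable {f₂ f₃ f₄ : MvPolynomial (Fin 2) ℝ}

/-- At `t = 0`, a common zero of `η` and `ξ f₂` is either a multiple zero of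
`4 f₂ f₄ - f₃ ^ 2 = f₂ ξ ^ 2 + η ^ 2` or a zero of `f₂`. In the latter case, it is also a zero of
`f₃`, and nonreal because `f₂` is positive definite, so that `f₂` divides `f₃`. -/
theorem false_of_common_zero_at_zero (h : AreForms f₂ f₃ f₄) (hpsd : IsPSD f₂)
    (hE₁ : disc 2 f₂ ≠ 0) (hE₂ : ¬ f₂ ∣ f₃) (hE₃ : disc 6 (4 * f₂ * f₄ - f₃ ^ 2) ≠ 0)
    {s : MvPolynomial (Fin 2) ℝ × MvPolynomial (Fin 2) ℝ} (hs : IsSolution f₂ f₃ f₄ 0 s)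
    {p : Fin 2 → ℂ} (hp : p ≠ 0) (hη : aeval p s.2 = 0) (hL : aeval p (s.1 * f₂) = 0) : False := by
  have heq := hs.eq
  rw [C_0, zero_mul, sub_zero] at heq
  rw [map_mul, mul_eq_zero] at hL
  rcases hL with hξ | hf₂
  · have hD : 4 * f₂ * f₄ - f₃ ^ 2 = f₂ * s.1 ^ 2 + s.2 ^ 2 := by linear_combination -heq
    have hD6 : (4 * f₂ * f₄ - f₃ ^ 2).IsHomogeneous 6 :=
      ((isHomogeneous_ofNat_mul 4 h.hom₂).mul h.hom₄).sub (h.hom₃.pow 2)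
    refine hE₃ (disc_eq_zero_of_singular (by norm_num) hD6 hp ?_ ?_) <;>
    · rw [hD]
      simp [hξ, hη]
  · by_cases hre : p 0 * starRingEnd ℂ (p 1) = starRingEnd ℂ (p 0) * p 1
    · obtain ⟨c, r, hc, hr, rfl⟩ := exists_real_multiple hp hre
      rw [aeval_smul_form h.hom₂, aeval_ofReal] at hf₂
      have h0 : eval r f₂ = 0 := by
        exact_mod_cast (mul_eq_zero.1 hf₂).resolve_left (pow_ne_zero _ hc)
      exact (isPosDef_of_disc_ne_zero le_rfl h.hom₂ hpsd hE₁ r hr).ne' h0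
    · have hf₂0 : f₂ ≠ 0 := by
        rintro rfl
        apply hE₁
        simp [disc, dehom]
      have hf₃ : aeval p f₃ = 0 := by
        have := congrArg (aeval p) heq
        rw [map_add, map_mul, hf₂, map_pow, map_pow, hη] at this
        simpa using this
      obtain ⟨H, -, hH⟩ :=
        exists_eq_mul_of_common_nonreal_zero (m := 1) h.hom₂ hf₂0 h.hom₃ hre hf₂ hf₃
      exact hE₂ ⟨H, hH⟩

/-- Let `r` be a common real zero of the two partial derivatives of the equation of `C_t`, with
`f₂ - t ξ ≠ 0` at `r`. For `z = -f₃ / (2 (f₂ - t ξ))` one gets `f₂ z ^ 2 + f₃ z + f₄ = -t ^ 2 z ^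
4` at `r`. As the left side is nonnegative, `z = 0`, and `(r, 0)` is a zero of `f`. -/
theorem false_of_common_real_zero (hpos : IsPosDef (normalQuartic f₂ f₃ f₄))
    (hpsd : IsPSD (normalQuartic f₂ f₃ f₄ - X 2 ^ 4)) {t : ℝ} (ht : 0 < t)
    {s : MvPolynomial (Fin 2) ℝ × MvPolynomial (Fin 2) ℝ} (hs : IsSolution f₂ f₃ f₄ t s)
    {r : Fin 2 → ℝ} (hr : r ≠ 0) (hη : eval r s.2 = 0) (hA : eval r (f₂ - C t * s.1) ≠ 0)
    (hL : eval r (C t * (4 * f₄ - s.1 ^ 2) + 2 * s.1 * (f₂ - C t * s.1)) = 0) : False := by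
  have e := congrArg (eval r) hs.eq
  have h4 : eval r (4 : MvPolynomial (Fin 2) ℝ) = 4 := map_ofNat _ _
  have h2 : eval r (2 : MvPolynomial (Fin 2) ℝ) = 2 := map_ofNat _ _
  simp only [map_add, map_mul, map_sub, map_pow, eval_C, hη, h4, h2] at e hA hL
  set a := eval r f₂
  set b := eval r f₃
  set c := eval r f₄
  set x := eval r s.1
  set A := a - t * x with hAdef
  set z := -b / (2 * A) with hz
  have hb : b = -2 * A * z := by rw [hz]; field_simp
  have hB : 4 * c - x ^ 2 = 4 * A * z ^ 2 := by
    apply mul_left_cancel₀ hA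
    rw [← e, hb]; ring
  have hx : x = -2 * t * z ^ 2 := by
    rw [hB] at hL
    have : 2 * A * (2 * t * z ^ 2 + x) = 0 := by linear_combination hL
    have := (mul_eq_zero.1 this).resolve_left (mul_ne_zero two_ne_zero hA)
    linarith
  have hc : c = A * z ^ 2 + t ^ 2 * z ^ 4 := by
    rw [hx] at hB
    linear_combination hB / 4
  have ha : a = A - 2 * t ^ 2 * z ^ 2 := by rw [hAdef, hx]; ring
  have hq := forall_quadratic_nonneg_of_isPSD_sub hpsd r z
  have hzero : a * z ^ 2 + b * z + c = -t ^ 2 * z ^ 4 := by rw [hc, hb, ha]; ring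
  have hq' : 0 ≤ -t ^ 2 * z ^ 4 := by rw [← hzero]; exact hq
  have hz4 : z ^ 4 ≤ 0 := by
    have ht2 : 0 < t ^ 2 := by positivity
    by_contra! h
    nlinarith
  have hz0 : z = 0 := by
    have : z ^ 4 = 0 := le_antisymm hz4 (by positivity)
    exact pow_eq_zero_iff (by norm_num) |>.1 this
  have hv : (Fin.snoc r z : Fin 3 → ℝ) ≠ 0 := by
    intro h0
    apply hr
    ext i
    have := congrFun h0 i.castSucc
    rwa [Fin.snoc_castSucc] at this
  have hp := hpos _ hv
  rw [eval_normalQuartic] at hp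
  have : z ^ 4 + a * z ^ 2 + b * z + c = 0 := by
    rw [hc, hz0]; ring
  linarith

/-- A nonreal common zero `p` of the two partial derivatives of the equation of `C_t` yields a
singular point of the curve `t ^ 2 z ^ 4 + f₂ z ^ 2 + f₃ z + f₄ = 0` over `p`. Eliminating the
coordinate `z` shows `P(p) = 0` and `R(p) ^ 2 = 128 t ^ 2 Q(p)`, so that `Q / R ^ 2` is real
at `p`. -/
theorem phiInv_eq_zero_of_common_nonreal_zero (h : AreForms f₂ f₃ f₄) {t : ℝ}
    {s : MvPolynomial (Fin 2) ℝ × MvPolynomial (Fin 2) ℝ} (hs : IsSolution f₂ f₃ f₄ t s)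
    {p : Fin 2 → ℂ} (hp : p 0 * starRingEnd ℂ (p 1) ≠ starRingEnd ℂ (p 0) * p 1)
    (hη : aeval p s.2 = 0) (hA : aeval p (f₂ - C t * s.1) ≠ 0)
    (hL : aeval p (C t * (4 * f₄ - s.1 ^ 2) + 2 * s.1 * (f₂ - C t * s.1)) = 0) :
    phiInv 8 18 (formP f₂ f₃ f₄) (formQ f₂ f₃ f₄) (formR f₂ f₃ f₄ ^ 2) = 0 := by
  have e := congrArg (aeval p) hs.eq
  have ed : ∀ i, aeval p (2 * s.2 * pderiv i s.2 + 2 * f₃ * pderiv i f₃) =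
      aeval p ((pderiv i f₂ - C t * pderiv i s.1) * (4 * f₄ - s.1 ^ 2) +
        (f₂ - C t * s.1) * (4 * pderiv i f₄ - 2 * s.1 * pderiv i s.1)) := by
    intro i
    have h1 := congrArg (pderiv i) hs.eq
    have h4 : pderiv i (4 : MvPolynomial (Fin 2) ℝ) = 0 := by
      rw [← map_ofNat C 4, pderiv_C]
    congr 1
    simp only [Derivation.leibniz, Derivation.leibniz_pow, smul_eq_mul, nsmul_eq_mul, map_add,
      map_sub, pderiv_C, h4] at h1
    norm_num at h1
    linear_combination h1
  have e0 := ed 0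
  have e1 := ed 1
  simp only [map_add, map_mul, map_sub, map_pow, algHom_C, hη, map_ofNat,
    Complex.coe_algebraMap] at e hA hL e0 e1
  set a := aeval p f₂ with ha'
  set b := aeval p f₃ with hb'
  set c := aeval p f₄ with hc'
  set x := aeval p s.1
  set A := a - t * x with hAdef
  set z := -b / (2 * A) with hz
  have hb : b = -2 * A * z := by rw [hz]; field_simp
  have hB : 4 * c - x ^ 2 = 4 * A * z ^ 2 := by
    apply mul_left_cancel₀ hA
    rw [← e, hb]; ring
  have hx : x = -2 * t * z ^ 2 := by
    rw [hB] at hL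
    have : 2 * A * (2 * t * z ^ 2 + x) = 0 := by linear_combination hL
    have := (mul_eq_zero.1 this).resolve_left (mul_ne_zero two_ne_zero hA)
    linear_combination this
  have hc : c = A * z ^ 2 + t ^ 2 * z ^ 4 := by
    rw [hx] at hB
    linear_combination hB / 4
  have ha : a = A - 2 * t ^ 2 * z ^ 2 := by rw [hAdef, hx]; ring
  have hh : ∀ k₂ k₃ k₄ y w : ℂ, 2 * 0 * w + 2 * b * k₃ =
      (k₂ - t * y) * (4 * c - x ^ 2) + A * (4 * k₄ - 2 * x * y) →
      k₂ * z ^ 2 + k₃ * z + k₄ = 0 := by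
    intro k₂ k₃ k₄ y w hi
    rw [hB, hx, hb] at hi
    apply mul_left_cancel₀ (mul_ne_zero (by norm_num : (4 : ℂ) ≠ 0) hA)
    linear_combination -hi
  have h0 := hh _ _ _ _ _ e0
  have h1 := hh _ _ _ _ _ e1
  have hP : ∀ F G : MvPolynomial (Fin 2) ℝ, aeval p (jac F G) =
      aeval p (pderiv 1 F) * aeval p (pderiv 0 G) -
        aeval p (pderiv 1 G) * aeval p (pderiv 0 F) := by
    intro F G
    simp [jac]
  have h24 : aeval p (jac f₂ f₄) = - z * aeval p (jac f₂ f₃) := by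
    rw [hP, hP]
    linear_combination aeval p (pderiv 1 f₂) * h0 - aeval p (pderiv 0 f₂) * h1
  have h34 : aeval p (jac f₃ f₄) = z ^ 2 * aeval p (jac f₂ f₃) := by
    rw [hP, hP]
    linear_combination aeval p (pderiv 1 f₃) * h0 - aeval p (pderiv 0 f₃) * h1
  have hPz : aeval p (formP f₂ f₃ f₄) = 0 := by
    rw [formP, map_sub, map_mul, map_pow, h24, h34]
    ring
  have hQR : aeval p (formR f₂ f₃ f₄ ^ 2) = 128 * t ^ 2 * aeval p (formQ f₂ f₃ f₄) := by
    simp only [formR, formQ, map_add, map_mul, map_sub, map_pow, map_ofNat, h24]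
    rw [← ha', ← hb', ← hc', ha, hb, hc]
    ring
  refine phiInv_eq_zero_of_nonreal_zero (by norm_num) (by norm_num) h.isHomogeneous_formP
    h.isHomogeneous_formQ (h.isHomogeneous_formR.pow 2) hp hPz ?_
  rw [hQR]
  simp only [map_mul, map_pow, Complex.conj_ofReal]
  have h128 : starRingEnd ℂ 128 = 128 := map_ofNat _ _
  rw [h128]
  ring

/-- For non-exceptional `f`, the two partial derivatives of the equation of `C_t` at a solution have
no common complex zero. -/
theorem IsSolution.eq_zero_of_common_zero (h : AreForms f₂ f₃ f₄)
    (hpos : IsPosDef (normalQuartic f₂ f₃ f₄)) (hpsd : IsPSD (normalQuartic f₂ f₃ f₄ - X 2 ^ 4))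
    (hE : ∀ i, ¬ Exceptional f₂ f₃ f₄ i) {t : ℝ} (ht : 0 ≤ t)
    {s : MvPolynomial (Fin 2) ℝ × MvPolynomial (Fin 2) ℝ} (hs : IsSolution f₂ f₃ f₄ t s)
    {p : Fin 2 → ℂ} (hη : aeval p s.2 = 0)
    (hL : aeval p (C t * (4 * f₄ - s.1 ^ 2) + 2 * s.1 * (f₂ - C t * s.1)) = 0) : p = 0 := by
  by_contra hp
  rcases ht.eq_or_lt with rfl | ht
  · refine false_of_common_zero_at_zero h (isPSD_leading_of_isPSD_sub hpsd) (hE 0) (hE 1) (hE 2) hs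
      hp hη ?_
    simp only [map_mul, map_zero, zero_mul, zero_add, sub_zero, map_ofNat] at hL
    rw [map_mul]
    linear_combination hL / 2
  by_cases hA : aeval p (f₂ - C t * s.1) = 0
  · refine false_of_left_factor_zero h (hE 3) (hE 7) hs hp hη hA ?_
    rw [map_add, map_mul, map_mul _ (2 * s.1), hA, mul_zero, add_zero, algHom_C] at hL
    exact (mul_eq_zero.1 hL).resolve_left (by simpa using ht.ne')
  by_cases hre : p 0 * starRingEnd ℂ (p 1) = starRingEnd ℂ (p 0) * p 1
  · obtain ⟨c, r, hc, hr, rfl⟩ := exists_real_multiple hp hre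
    have red : ∀ {k : ℕ} {K : MvPolynomial (Fin 2) ℝ}, K.IsHomogeneous k →
        (aeval (fun i => c * (r i : ℂ)) K = 0 ↔ eval r K = 0) := by
      intro k K hK
      rw [aeval_smul_form hK, aeval_ofReal, mul_eq_zero]
      simp [hc]
    have hA2 := h.hom₂.sub (hs.hom_xi.C_mul t)
    have hL4 : (C t * (4 * f₄ - s.1 ^ 2) + 2 * s.1 * (f₂ - C t * s.1)).IsHomogeneous 4 :=
      (((isHomogeneous_ofNat_mul 4 h.hom₄).sub (hs.hom_xi.pow 2)).C_mul t).add
        ((isHomogeneous_ofNat_mul 2 hs.hom_xi).mul hA2)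
    exact false_of_common_real_zero hpos hpsd ht hs hr ((red hs.hom_eta).1 hη)
      (fun h0 => hA ((red hA2).2 h0)) ((red hL4).1 hL)
  · exact hE 9 (phiInv_eq_zero_of_common_nonreal_zero h hs hre hη hA hL)

end

/-! ### Coefficient vectors of binary forms -/

/-- The binary form of degree `m` with a given vector of coefficients. -/
noncomputable def vecForm (m : ℕ) (c : Fin (m + 1) → ℝ) : MvPolynomial (Fin 2) ℝ :=
  ∑ i : Fin (m + 1), C (c i) * X 0 ^ (i : ℕ) * X 1 ^ (m - i)

theorem isHomogeneous_vecForm (m : ℕ) (c : Fin (m + 1) → ℝ) : (vecForm m c).IsHomogeneous m := by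
  refine IsHomogeneous.sum _ _ _ fun i _ => ?_
  have h1 : (i : ℕ) + (m - i) = m := by omega
  have h2 := (((isHomogeneous_C (Fin 2) (c i)).mul
    ((isHomogeneous_X ℝ (0 : Fin 2)).pow i)).mul ((isHomogeneous_X ℝ (1 : Fin 2)).pow (m - i)))
  simpa [h1] using h2

theorem vecForm_binCoeff {m : ℕ} {F : MvPolynomial (Fin 2) ℝ} (hF : F.IsHomogeneous m) :
    vecForm m (fun i => binCoeff m i F) = F := by
  conv_rhs => rw [form_eq_sum hF]
  rw [vecForm, Finset.sum_range]

theorem eval_vecForm {m : ℕ} (c : Fin (m + 1) → ℝ) (r : Fin 2 → ℝ) :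
    eval r (vecForm m c) = ∑ i : Fin (m + 1), c i * r 0 ^ (i : ℕ) * r 1 ^ (m - i) := by
  simp [vecForm]

theorem coeff_vecForm {m : ℕ} (c : Fin (m + 1) → ℝ) (d : Fin 2 →₀ ℕ) :
    coeff d (vecForm m c) =
      ∑ i : Fin (m + 1), c i *
        coeff d (X 0 ^ (i : ℕ) * X 1 ^ (m - i) : MvPolynomial (Fin 2) ℝ) := by
  simp [vecForm, coeff_sum, mul_assoc, coeff_C_mul]

theorem toPoly_vecForm {m : ℕ} (c : Fin (m + 1) → ℝ) :
    toPoly (vecForm m c) = ∑ i : Fin (m + 1), Polynomial.C (c i) * Polynomial.X ^ (i : ℕ) := by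
  simp [toPoly, vecForm, Polynomial.C_eq_algebraMap]

theorem binCoeff_vecForm {m : ℕ} (c : Fin (m + 1) → ℝ) (i : Fin (m + 1)) :
    binCoeff m i (vecForm m c) = c i := by
  have h := coeff_toPoly (isHomogeneous_vecForm m c) i
  rw [if_pos (by omega)] at h
  rw [← h, toPoly_vecForm, Polynomial.finsetSum_coeff, Finset.sum_eq_single i]
  · simp
  · intro j _ hj
    rw [Polynomial.coeff_C_mul_X_pow, if_neg (fun h => hj (Fin.ext h.symm))]
  · simp

theorem eval_eq_eval_toPoly {m : ℕ} {F : MvPolynomial (Fin 2) ℝ} (hF : F.IsHomogeneous m) (x : ℝ) :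
    eval ![x, 1] F = (toPoly F).eval x := by
  rw [toPoly_form hF, eval_form hF, Polynomial.eval_finsetSum]
  simp

/-- A binary form of degree `m` vanishing at the `m + 1` points `(0 : 1), …, (m : 1)` is zero. -/
theorem form_eq_zero_of_eval_eq_zero {m : ℕ} {F : MvPolynomial (Fin 2) ℝ}
    (hF : F.IsHomogeneous m) (h : ∀ k : Fin (m + 1), eval ![(k : ℝ), 1] F = 0) : F = 0 := by
  rw [← toPoly_eq_zero hF]
  refine Polynomial.eq_zero_of_natDegree_lt_card_of_eval_eq_zero (ι := Fin (m + 1)) _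
    (f := fun k => (k : ℝ)) ?_ ?_ ?_
  · intro a b hab
    exact Fin.ext (Nat.cast_injective hab)
  · intro k
    rw [← eval_eq_eval_toPoly hF, h]
  · rw [Fintype.card_fin]
    exact Nat.lt_succ_of_le (natDegree_toPoly_le hF)

theorem continuous_eval_vecForm {m : ℕ} {Y : Type*} [TopologicalSpace Y]
    {c : Y → Fin (m + 1) → ℝ} {r : Y → Fin 2 → ℝ} (hc : Continuous c) (hr : Continuous r) :
    Continuous fun y => eval (r y) (vecForm m (c y)) := by
  simp only [eval_vecForm]
  fun_prop

theorem contDiff_eval_vecForm {m : ℕ} {Y : Type*} [NormedAddCommGroup Y] [NormedSpace ℝ Y]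
    {c : Y → Fin (m + 1) → ℝ} (hc : ContDiff ℝ 1 c) (r : Fin 2 → ℝ) :
    ContDiff ℝ 1 fun y => eval r (vecForm m (c y)) := by
  simp only [eval_vecForm]
  fun_prop

theorem eval_vecForm_add_smul {m : ℕ} (c d : Fin (m + 1) → ℝ) (s : ℝ) (r : Fin 2 → ℝ) :
    eval r (vecForm m (c + s • d)) = eval r (vecForm m c) + s * eval r (vecForm m d) := by
  simp only [eval_vecForm, Finset.mul_sum, ← Finset.sum_add_distrib]
  refine Finset.sum_congr rfl fun i _ => ?_
  simp only [Pi.add_apply, Pi.smul_apply, smul_eq_mul]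
  ring

/-- The values of a form at `m + 1` points determine its coefficient vector. -/
noncomputable def valuesMap (m : ℕ) : (Fin (m + 1) → ℝ) →ₗ[ℝ] (Fin (m + 1) → ℝ) where
  toFun c k := eval ![(k : ℝ), 1] (vecForm m c)
  map_add' c d := by
    ext k
    have := eval_vecForm_add_smul c d 1 ![(k : ℝ), 1]
    simpa using this
  map_smul' s c := by
    ext k
    have := eval_vecForm_add_smul 0 c s ![(k : ℝ), 1]
    have h0 : eval ![(k : ℝ), 1] (vecForm m 0) = 0 := by simp [eval_vecForm]
    simpa [h0] using this

theorem vecForm_injective (m : ℕ) : Function.Injective (vecForm m) := by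
  intro c d h
  ext i
  rw [← binCoeff_vecForm c, h, binCoeff_vecForm]

theorem valuesMap_injective (m : ℕ) : Function.Injective (valuesMap m) := by
  rw [injective_iff_map_eq_zero]
  intro c hc
  apply vecForm_injective m
  have h0 : vecForm m 0 = 0 := by simp [vecForm]
  rw [h0]
  exact form_eq_zero_of_eval_eq_zero (isHomogeneous_vecForm m c) fun k => congrFun hc k

/-- Coefficient vectors of forms whose values at `m + 1` points are bounded form a compact set. -/
theorem isCompact_setOf_values_le (m : ℕ) (M : Fin (m + 1) → ℝ) :
    IsCompact {c : Fin (m + 1) → ℝ |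
      ∀ k : Fin (m + 1), |eval ![(k : ℝ), 1] (vecForm m c)| ≤ M k} := by
  have h := (LinearMap.isClosedEmbedding_of_injective
    (LinearMap.ker_eq_bot.2 (valuesMap_injective m))).isCompact_preimage
    (isCompact_univ_pi fun k => isCompact_Icc (a := -M k) (b := M k))
  convert h using 1
  ext c
  simp only [Set.mem_preimage, Set.mem_univ_pi, Set.mem_Icc, ← abs_le]
  exact Iff.rfl

/-! ### The solution space is a covering of the unit interval -/

/-- Coefficient vectors of pairs `(ξ, η)`. -/
abbrev PairVec : Type := (Fin 3 → ℝ) × (Fin 4 → ℝ)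

/-- The pair of forms `(ξ, η)` with given coefficients. -/
noncomputable def vecPair (x : PairVec) : MvPolynomial (Fin 2) ℝ × MvPolynomial (Fin 2) ℝ :=
  (vecForm 2 x.1, vecForm 3 x.2)

/-- The coefficients of a pair of forms `(ξ, η)`. -/
noncomputable def pairVec (s : MvPolynomial (Fin 2) ℝ × MvPolynomial (Fin 2) ℝ) : PairVec :=
  (fun i => binCoeff 2 i s.1, fun i => binCoeff 3 i s.2)

theorem vecPair_pairVec {s : MvPolynomial (Fin 2) ℝ × MvPolynomial (Fin 2) ℝ}
    (h₁ : s.1.IsHomogeneous 2) (h₂ : s.2.IsHomogeneous 3) : vecPair (pairVec s) = s :=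
  Prod.ext (vecForm_binCoeff h₁) (vecForm_binCoeff h₂)

section

variable (f₂ f₃ f₄ : MvPolynomial (Fin 2) ℝ)

/-- The values at seven points of the difference of the two sides of the equation of `C_t`, as a
function of `t` and of the coefficients of `(ξ, η)`. -/
noncomputable def eqnMap (y : ℝ × PairVec) (k : Fin 7) : ℝ :=
  (eval ![(k : ℝ), 1] f₂ - y.1 * eval ![(k : ℝ), 1] (vecForm 2 y.2.1)) *
      (4 * eval ![(k : ℝ), 1] f₄ - eval ![(k : ℝ), 1] (vecForm 2 y.2.1) ^ 2) -
    eval ![(k : ℝ), 1] (vecForm 3 y.2.2) ^ 2 - eval ![(k : ℝ), 1] f₃ ^ 2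

/-- The value of `f₂ - t ξ` at `r`. -/
noncomputable def leftVal (y : ℝ × PairVec) (r : Fin 2 → ℝ) : ℝ :=
  eval r f₂ - y.1 * eval r (vecForm 2 y.2.1)

/-- The value of `4 f₄ - ξ ^ 2` at `r`. -/
noncomputable def rightVal (y : ℝ × PairVec) (r : Fin 2 → ℝ) : ℝ :=
  4 * eval r f₄ - eval r (vecForm 2 y.2.1) ^ 2

variable {f₂ f₃ f₄}

theorem equation_iff_eqnMap (h : AreForms f₂ f₃ f₄) (y : ℝ × PairVec) :
    (vecPair y.2).2 ^ 2 + f₃ ^ 2 = (f₂ - C y.1 * (vecPair y.2).1) * (4 * f₄ - (vecPair y.2).1 ^ 2) ↔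
      eqnMap f₂ f₃ f₄ y = 0 := by
  have h4 : ∀ r : Fin 2 → ℝ, eval r (4 : MvPolynomial (Fin 2) ℝ) = 4 := fun r => map_ofNat _ _
  constructor
  · intro e
    ext k
    have := congrArg (eval ![(k : ℝ), 1]) e
    simp only [vecPair, map_add, map_mul, map_sub, map_pow, eval_C, h4] at this
    rw [eqnMap, ← this, Pi.zero_apply]
    ring
  · intro e
    rw [← sub_eq_zero]
    refine form_eq_zero_of_eval_eq_zero (m := 6) ?_ ?_
    · have h1 := isHomogeneous_vecForm 2 y.2.1
      have h2 := isHomogeneous_vecForm 3 y.2.2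
      exact ((h2.pow 2).add (h.hom₃.pow 2)).sub ((h.hom₂.sub (h1.C_mul y.1)).mul
        ((isHomogeneous_ofNat_mul 4 h.hom₄).sub (h1.pow 2)))
    · intro k
      have := congrFun e k
      rw [eqnMap, Pi.zero_apply] at this
      simp only [vecPair, map_add, map_mul, map_sub, map_pow, eval_C, h4]
      linear_combination -this

theorem isSolution_vecPair_iff (h : AreForms f₂ f₃ f₄) (y : ℝ × PairVec) :
    IsSolution f₂ f₃ f₄ y.1 (vecPair y.2) ↔
      eqnMap f₂ f₃ f₄ y = 0 ∧ ∀ r, 0 ≤ leftVal f₂ y r ∧ 0 ≤ rightVal f₄ y r := by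
  have h4 : ∀ r : Fin 2 → ℝ, eval r (4 : MvPolynomial (Fin 2) ℝ) = 4 := fun r => map_ofNat _ _
  have hl : ∀ r, eval r (f₂ - C y.1 * (vecPair y.2).1) = leftVal f₂ y r := by
    intro r; simp [leftVal, vecPair]
  have hr : ∀ r, eval r (4 * f₄ - (vecPair y.2).1 ^ 2) = rightVal f₄ y r := by
    intro r; simp [rightVal, vecPair]
  constructor
  · intro hs
    refine ⟨(equation_iff_eqnMap h y).1 hs.eq, fun r => ⟨?_, ?_⟩⟩
    · rw [← hl]; exact hs.psd_left r
    · rw [← hr]; exact hs.psd_right r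
  · rintro ⟨he, hp⟩
    exact ⟨isHomogeneous_vecForm 2 _, isHomogeneous_vecForm 3 _, (equation_iff_eqnMap h y).2 he,
      fun r => by rw [hl]; exact (hp r).1, fun r => by rw [hr]; exact (hp r).2⟩

theorem contDiff_eqnMap : ContDiff ℝ 1 (eqnMap f₂ f₃ f₄) := by
  rw [contDiff_pi]
  intro k
  have h1 : ContDiff ℝ 1 fun y : ℝ × PairVec => eval ![(k : ℝ), 1] (vecForm 2 y.2.1) :=
    contDiff_eval_vecForm (m := 2) (contDiff_fst.comp contDiff_snd) _
  have h2 : ContDiff ℝ 1 fun y : ℝ × PairVec => eval ![(k : ℝ), 1] (vecForm 3 y.2.2) :=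
    contDiff_eval_vecForm (m := 3) (contDiff_snd.comp contDiff_snd) _
  exact (((contDiff_const.sub (contDiff_fst.mul h1)).mul (contDiff_const.sub (h1.pow 2))).sub
    (h2.pow 2)).sub contDiff_const

theorem continuous_leftVal {Y : Type*} [TopologicalSpace Y] {y : Y → ℝ × PairVec}
    {r : Y → Fin 2 → ℝ} (hy : Continuous y) (hr : Continuous r) :
    Continuous fun z => leftVal f₂ (y z) (r z) :=
  (f₂.continuous_eval.comp hr).sub ((continuous_fst.comp hy).mul
    (continuous_eval_vecForm (m := 2) (continuous_fst.comp (continuous_snd.comp hy)) hr))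

theorem continuous_rightVal {Y : Type*} [TopologicalSpace Y] {y : Y → ℝ × PairVec}
    {r : Y → Fin 2 → ℝ} (hy : Continuous y) (hr : Continuous r) :
    Continuous fun z => rightVal f₄ (y z) (r z) :=
  (continuous_const.mul (f₄.continuous_eval.comp hr)).sub
    ((continuous_eval_vecForm (m := 2) (continuous_fst.comp (continuous_snd.comp hy)) hr).pow 2)

variable (f₂ f₃ f₄) in
/-- The solutions of all `C_t`, `0 ≤ t ≤ 1`, in coefficients. -/
def solSet : Set (ℝ × PairVec) :=
  {y | y.1 ∈ Set.Icc (0 : ℝ) 1 ∧ IsSolution f₂ f₃ f₄ y.1 (vecPair y.2)}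

theorem isClosed_solSet (h : AreForms f₂ f₃ f₄) : IsClosed (solSet f₂ f₃ f₄) := by
  have : solSet f₂ f₃ f₄ = {y | y.1 ∈ Set.Icc (0 : ℝ) 1} ∩ ({y | eqnMap f₂ f₃ f₄ y = 0} ∩
      ⋂ r, ({y | 0 ≤ leftVal f₂ y r} ∩ {y | 0 ≤ rightVal f₄ y r})) := by
    ext y
    simp only [solSet, isSolution_vecPair_iff h, Set.mem_inter_iff, Set.mem_ofPred_eq,
      Set.mem_iInter]
  rw [this]
  refine (isClosed_Icc.preimage continuous_fst).inter
    ((isClosed_eq contDiff_eqnMap.continuous continuous_const).inter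
      (isClosed_iInter fun r => IsClosed.inter ?_ ?_))
  · exact isClosed_le continuous_const
      (continuous_leftVal continuous_id continuous_const)
  · exact isClosed_le continuous_const
      (continuous_rightVal continuous_id continuous_const)

theorem abs_le_one_add_sq (x : ℝ) : |x| ≤ 1 + x ^ 2 := by
  rw [← sq_abs]
  nlinarith [sq_nonneg (|x| - 1), abs_nonneg x]

/-- For solutions of `C_t`, `ξ ^ 2 ≤ 4 f₄` bounds `ξ`, and then the equation bounds `η`. -/
theorem isCompact_solSet (h : AreForms f₂ f₃ f₄) : IsCompact (solSet f₂ f₃ f₄) := by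
  set M : ℝ → ℝ := fun k => 1 + 4 * eval ![k, 1] f₄ with hM
  set N : ℝ → ℝ := fun k => 1 + (|eval ![k, 1] f₂| + M k) * (4 * eval ![k, 1] f₄) with hN
  refine ((isCompact_Icc (a := (0 : ℝ)) (b := 1)).prod
    ((isCompact_setOf_values_le 2 fun k => M k).prod
      (isCompact_setOf_values_le 3 fun k => N k))).of_isClosed_subset (isClosed_solSet h) ?_
  rintro ⟨t, a, b⟩ ⟨ht, hs⟩
  have hs' := (isSolution_vecPair_iff h (t, a, b)).1 hs
  have hξ : ∀ k : ℝ, |eval ![k, 1] (vecForm 2 a)| ≤ M k := by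
    intro k
    have := (hs'.2 ![k, 1]).2
    simp only [rightVal] at this
    refine (abs_le_one_add_sq _).trans ?_
    simp only [hM]
    linarith
  refine ⟨ht, fun k => hξ k, fun k => ?_⟩
  refine (abs_le_one_add_sq _).trans ?_
  have e := congrArg (eval ![((k : ℕ) : ℝ), 1]) hs.eq
  have h4 : eval ![((k : ℕ) : ℝ), 1] (4 : MvPolynomial (Fin 2) ℝ) = 4 := map_ofNat _ _
  simp only [vecPair, map_add, map_mul, map_sub, map_pow, eval_C, h4] at e
  obtain ⟨h1, h2⟩ := hs'.2 ![((k : ℕ) : ℝ), 1]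
  simp only [leftVal, rightVal] at h1 h2
  have h3 := hξ k
  simp only [hN]
  set x := eval ![((k : ℕ) : ℝ), 1] (vecForm 2 a)
  set c₂ := eval ![((k : ℕ) : ℝ), 1] f₂
  set c₄ := eval ![((k : ℕ) : ℝ), 1] f₄
  have h5 : c₂ - t * x ≤ |c₂| + M k := by
    have : -(t * x) ≤ |x| := by
      refine (neg_le_abs _).trans ?_
      rw [abs_mul, abs_of_nonneg ht.1]
      exact mul_le_of_le_one_left (abs_nonneg _) ht.2
    linarith [le_abs_self c₂]
  have h6 : (c₂ - t * x) * (4 * c₄ - x ^ 2) ≤ (|c₂| + M k) * (4 * c₄) := by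
    refine mul_le_mul h5 (by nlinarith [sq_nonneg x]) h2 (h1.trans h5)
  nlinarith [sq_nonneg (eval ![((k : ℕ) : ℝ), 1] f₃)]

/-- The psd side conditions persist under small deformations that preserve the equation, because
at each real point one of the two factors is positive. -/
theorem eventually_psd {y₀ : ℝ × PairVec}
    (hy : ∀ r, 0 ≤ leftVal f₂ y₀ r ∧ 0 ≤ rightVal f₄ y₀ r)
    (hnd : ∀ r, r ≠ 0 → leftVal f₂ y₀ r ≠ 0 ∨ rightVal f₄ y₀ r ≠ 0) (h : AreForms f₂ f₃ f₄) :
    ∀ᶠ y in nhds y₀, eqnMap f₂ f₃ f₄ y = 0 → ∀ r, 0 ≤ leftVal f₂ y r ∧ 0 ≤ rightVal f₄ y r := by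
  have hprod : ∀ y, eqnMap f₂ f₃ f₄ y = 0 → ∀ r, 0 ≤ leftVal f₂ y r * rightVal f₄ y r := by
    intro y hy r
    have e := congrArg (eval r) ((equation_iff_eqnMap h y).2 hy)
    have h4 : eval r (4 : MvPolynomial (Fin 2) ℝ) = 4 := map_ofNat _ _
    simp only [vecPair, map_add, map_mul, map_sub, map_pow, eval_C, h4] at e
    rw [leftVal, rightVal, ← e]
    positivity
  have key := (isCompact_sphere (0 : Fin 2 → ℝ) 1).eventually_forall_of_forall_eventually (x₀ := y₀)
    (P := fun y r => eqnMap f₂ f₃ f₄ y = 0 → 0 ≤ leftVal f₂ y r ∧ 0 ≤ rightVal f₄ y r) (by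
      intro r hr
      have hr0 : r ≠ 0 := by
        rintro rfl
        simp at hr
      rcases hnd r hr0 with h0 | h0
      · have hpos : 0 < leftVal f₂ y₀ r := lt_of_le_of_ne (hy r).1 (Ne.symm h0)
        filter_upwards [(continuous_leftVal continuous_fst
          continuous_snd).continuousAt.eventually_const_lt hpos] with z hz he
        exact ⟨hz.le, nonneg_of_mul_nonneg_right (hprod _ he _) hz⟩
      · have hpos : 0 < rightVal f₄ y₀ r := lt_of_le_of_ne (hy r).2 (Ne.symm h0)
        filter_upwards [(continuous_rightVal continuous_fst
          continuous_snd).continuousAt.eventually_const_lt hpos] with z hz he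
        exact ⟨nonneg_of_mul_nonneg_left (hprod _ he _) hz, hz.le⟩)
  filter_upwards [key] with y hy1 he r
  have hsc : ∀ (c : ℝ) (r' : Fin 2 → ℝ),
      leftVal f₂ y (fun i => c * r' i) = c ^ 2 * leftVal f₂ y r' ∧
      rightVal f₄ y (fun i => c * r' i) = c ^ 4 * rightVal f₄ y r' := by
    intro c r'
    constructor
    · rw [leftVal, leftVal, eval_smul_form h.hom₂, eval_smul_form (isHomogeneous_vecForm 2 _)]
      ring
    · rw [rightVal, rightVal, eval_smul_form h.hom₄, eval_smul_form (isHomogeneous_vecForm 2 _)]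
      ring
  by_cases hr : r = 0
  · subst hr
    have h0 := hsc 0 0
    simp only [zero_mul, Pi.zero_apply, ne_eq, OfNat.ofNat_ne_zero, not_false_eq_true,
      zero_pow] at h0
    exact ⟨h0.1.ge, h0.2.ge⟩
  · have hn : ‖r‖ ≠ 0 := norm_ne_zero_iff.2 hr
    have h1 := hy1 (fun i => ‖r‖⁻¹ * r i) (by
      have : (fun i => ‖r‖⁻¹ * r i) = ‖r‖⁻¹ • r := rfl
      rw [mem_sphere_zero_iff_norm, this, norm_smul, norm_inv, norm_norm, inv_mul_cancel₀ hn]) he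
    rw [(hsc _ _).1, (hsc _ _).2] at h1
    have hp : 0 < ‖r‖⁻¹ := inv_pos.2 (norm_pos_iff.2 hr)
    exact ⟨nonneg_of_mul_nonneg_right h1.1 (by positivity),
      nonneg_of_mul_nonneg_right h1.2 (by positivity)⟩

end

section

variable {f₂ f₃ f₄ : MvPolynomial (Fin 2) ℝ}

/-- The derivative of the difference of the two sides of the equation of `C_t` in the direction
`(δξ, δη)`. -/
theorem hasDerivAt_eqnMap_line (y : ℝ × PairVec) (d : PairVec) (k : Fin 7) :
    HasDerivAt (fun σ : ℝ => eqnMap f₂ f₃ f₄ (y + σ • ((0 : ℝ), d)) k)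
      (-(eval ![(k : ℝ), 1] ((C y.1 * (4 * f₄ - (vecPair y.2).1 ^ 2) +
          2 * (vecPair y.2).1 * (f₂ - C y.1 * (vecPair y.2).1)) * vecForm 2 d.1 +
        2 * (vecPair y.2).2 * vecForm 3 d.2))) 0 := by
  set r : Fin 2 → ℝ := ![(k : ℝ), 1] with hr
  have h4 : eval r (4 : MvPolynomial (Fin 2) ℝ) = 4 := map_ofNat _ _
  have h2 : eval r (2 : MvPolynomial (Fin 2) ℝ) = 2 := map_ofNat _ _
  have e : (fun σ : ℝ => eqnMap f₂ f₃ f₄ (y + σ • ((0 : ℝ), d)) k) = fun σ : ℝ =>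
      (eval r f₂ - y.1 * (eval r (vecForm 2 y.2.1) + σ * eval r (vecForm 2 d.1))) *
        (4 * eval r f₄ - (eval r (vecForm 2 y.2.1) + σ * eval r (vecForm 2 d.1)) ^ 2) -
      (eval r (vecForm 3 y.2.2) + σ * eval r (vecForm 3 d.2)) ^ 2 - eval r f₃ ^ 2 := by
    ext σ
    rw [← eval_vecForm_add_smul (m := 2), ← eval_vecForm_add_smul (m := 3)]
    simp [eqnMap, hr]
  rw [e]
  have hx : ∀ a b : ℝ, HasDerivAt (fun σ : ℝ => a + σ * b) b 0 := fun a b => by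
    simpa using ((hasDerivAt_id (0 : ℝ)).mul_const b).const_add a
  have hξ := hx (eval r (vecForm 2 y.2.1)) (eval r (vecForm 2 d.1))
  have hη := hx (eval r (vecForm 3 y.2.2)) (eval r (vecForm 3 d.2))
  have h := ((((hξ.const_mul y.1).const_sub (eval r f₂)).fun_mul
    ((hξ.fun_pow 2).const_sub (4 * eval r f₄))).fun_sub (hη.fun_pow 2)).sub_const (eval r f₃ ^ 2)
  refine h.congr_deriv ?_
  simp only [vecPair, map_add, map_mul, map_sub, map_pow, eval_C, h4, h2]
  push_cast
  ring

/-- The map `(t, x) ↦ (t, eqnMap (t, x))`, to which the inverse function theorem is applied. -/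
noncomputable def graphMap (f₂ f₃ f₄ : MvPolynomial (Fin 2) ℝ) (y : ℝ × PairVec) :
    ℝ × (Fin 7 → ℝ) :=
  (y.1, eqnMap f₂ f₃ f₄ y)

theorem contDiff_graphMap : ContDiff ℝ 1 (graphMap f₂ f₃ f₄) :=
  contDiff_fst.prodMk contDiff_eqnMap

/-- The derivative of `graphMap` is injective where the two partial derivatives of the equation
have no common zero: an element of the kernel is a syzygy between them in degrees below the Koszul
one. -/
theorem fderiv_graphMap_injective (h : AreForms f₂ f₃ f₄) (y : ℝ × PairVec)
    (hnd : ∀ p : Fin 2 → ℂ, aeval p (vecPair y.2).2 = 0 →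
      aeval p (C y.1 * (4 * f₄ - (vecPair y.2).1 ^ 2) +
        2 * (vecPair y.2).1 * (f₂ - C y.1 * (vecPair y.2).1)) = 0 → p = 0) :
    Function.Injective (fderiv ℝ (graphMap f₂ f₃ f₄) y) := by
  rw [injective_iff_map_eq_zero]
  rintro ⟨τ, d⟩ hd
  have hdiff : DifferentiableAt ℝ (graphMap f₂ f₃ f₄) y :=
    contDiff_graphMap.contDiffAt.differentiableAt (by norm_num)
  have hline : HasDerivAt (fun σ : ℝ => y + σ • (τ, d)) (τ, d) 0 := by
    simpa using ((hasDerivAt_id (0 : ℝ)).smul_const (τ, d)).const_add y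
  have hf := hdiff.hasFDerivAt
  have hy0 : y = y + (0 : ℝ) • (τ, d) := by simp
  rw [hy0] at hf
  have hcomp := hf.comp_hasDerivAt (0 : ℝ) hline
  rw [← hy0, hd] at hcomp
  have hτ : τ = 0 := by
    have h1 : HasDerivAt (fun σ : ℝ => (graphMap f₂ f₃ f₄ (y + σ • (τ, d))).1) 0 0 :=
      (ContinuousLinearMap.fst ℝ ℝ (Fin 7 → ℝ)).hasFDerivAt.comp_hasDerivAt (0 : ℝ) hcomp
    have h2 : HasDerivAt (fun σ : ℝ => (graphMap f₂ f₃ f₄ (y + σ • (τ, d))).1) τ 0 := by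
      simpa [graphMap] using ((hasDerivAt_id (0 : ℝ)).mul_const τ).const_add y.1
    exact h2.unique h1
  subst hτ
  set L := C y.1 * (4 * f₄ - (vecPair y.2).1 ^ 2) +
        2 * (vecPair y.2).1 * (f₂ - C y.1 * (vecPair y.2).1) with hLdef
  set η := (vecPair y.2).2 with hηdef
  have hξ2 : (vecPair y.2).1.IsHomogeneous 2 := isHomogeneous_vecForm 2 _
  have hη3 : η.IsHomogeneous 3 := isHomogeneous_vecForm 3 _
  have hL4 : L.IsHomogeneous 4 :=
    (((isHomogeneous_ofNat_mul 4 h.hom₄).sub (hξ2.pow 2)).C_mul y.1).add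
      ((isHomogeneous_ofNat_mul 2 hξ2).mul (h.hom₂.sub (hξ2.C_mul y.1)))
  have hδξ := isHomogeneous_vecForm 2 d.1
  have hδη := isHomogeneous_vecForm 3 d.2
  have hval : ∀ k : Fin 7, eval ![(k : ℝ), 1] (L * vecForm 2 d.1 + 2 * η * vecForm 3 d.2) = 0 := by
    intro k
    have h1 : HasDerivAt (fun σ : ℝ => eqnMap f₂ f₃ f₄ (y + σ • ((0 : ℝ), d)) k) 0 0 :=
      (hasDerivAt_pi.1 (hasFDerivAt_snd.comp_hasDerivAt (0 : ℝ) hcomp)) k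
    have h2 := (hasDerivAt_eqnMap_line y d k).unique h1
    rw [← hLdef, ← hηdef] at h2
    linarith
  have hzero : L * vecForm 2 d.1 + 2 * η * vecForm 3 d.2 = 0 :=
    form_eq_zero_of_eval_eq_zero (m := 6)
      ((hL4.mul hδξ).add ((isHomogeneous_ofNat_mul 2 hη3).mul hδη)) hval
  obtain ⟨e1, e2⟩ := eq_zero_of_no_common_zero (m := 2) (n := 3) hη3 hL4 hnd hδξ
    (isHomogeneous_ofNat_mul 2 hδη) (by linear_combination hzero)
  have z2 : vecForm 2 0 = 0 := by simp [vecForm]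
  have z3 : vecForm 3 0 = 0 := by simp [vecForm]
  have d1 : d.1 = 0 := vecForm_injective 2 (by rw [e1, z2])
  have d2 : d.2 = 0 := vecForm_injective 3 (by
    rw [z3]
    exact (mul_eq_zero.1 e2).resolve_left two_ne_zero)
  exact Prod.ext rfl (Prod.ext d1 d2)

theorem exists_openPartialHomeomorph_graphMap (y : ℝ × PairVec)
    (hinj : Function.Injective (fderiv ℝ (graphMap f₂ f₃ f₄) y)) :
    ∃ e : OpenPartialHomeomorph (ℝ × PairVec) (ℝ × (Fin 7 → ℝ)),
      y ∈ e.source ∧ ∀ x, e x = graphMap f₂ f₃ f₄ x := by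
  have hfr : Module.finrank ℝ (ℝ × PairVec) = Module.finrank ℝ (ℝ × (Fin 7 → ℝ)) := by
    simp [PairVec]
  have hbij : Function.Bijective (fderiv ℝ (graphMap f₂ f₃ f₄) y) :=
    ⟨hinj, (LinearMap.injective_iff_surjective_of_finrank_eq_finrank hfr).1 hinj⟩
  set D := (LinearEquiv.ofBijective (fderiv ℝ (graphMap f₂ f₃ f₄) y).toLinearMap
    hbij).toContinuousLinearEquiv with hD
  have hs : HasStrictFDerivAt (graphMap f₂ f₃ f₄) (D : (ℝ × PairVec) →L[ℝ] ℝ × (Fin 7 → ℝ)) y := by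
    have := contDiff_graphMap (f₂ := f₂) (f₃ := f₃) (f₄ := f₄) |>.contDiffAt (x := y)
      |>.hasStrictFDerivAt (by norm_num)
    have hDe : (D : (ℝ × PairVec) →L[ℝ] ℝ × (Fin 7 → ℝ)) = fderiv ℝ (graphMap f₂ f₃ f₄) y :=
      ContinuousLinearMap.ext fun x => rfl
    rw [hDe]
    exact this
  exact ⟨hs.toOpenPartialHomeomorph _, hs.mem_toOpenPartialHomeomorph_source, fun x => rfl⟩

/-- The projection of the solution space to the parameter. -/
def solProj (f₂ f₃ f₄ : MvPolynomial (Fin 2) ℝ) (y : solSet f₂ f₃ f₄) : unitInterval :=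
  ⟨y.1.1, y.2.1⟩

theorem continuous_solProj : Continuous (solProj f₂ f₃ f₄) :=
  (continuous_fst.comp continuous_subtype_val).subtype_mk _

/-- For non-exceptional `f`, the solutions of the `C_t` form a covering space of `[0, 1]`: the
projection is a local homeomorphism by the inverse function theorem, and its domain is
compact. -/
theorem isCoveringMap_solProj (h : AreForms f₂ f₃ f₄)
    (hpos : IsPosDef (normalQuartic f₂ f₃ f₄)) (hpsd : IsPSD (normalQuartic f₂ f₃ f₄ - X 2 ^ 4))
    (hE : ∀ i, ¬ Exceptional f₂ f₃ f₄ i) : IsCoveringMap (solProj f₂ f₃ f₄) := by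
  have : CompactSpace (solSet f₂ f₃ f₄) := isCompact_iff_compactSpace.1 (isCompact_solSet h)
  rw [← isLocalHomeomorph_iff_isCoveringMap, isLocalHomeomorph_iff_isOpenEmbedding_restrict]
  have hcommon : ∀ y : solSet f₂ f₃ f₄, ∀ p : Fin 2 → ℂ, aeval p (vecPair y.1.2).2 = 0 →
      aeval p (C y.1.1 * (4 * f₄ - (vecPair y.1.2).1 ^ 2) +
        2 * (vecPair y.1.2).1 * (f₂ - C y.1.1 * (vecPair y.1.2).1)) = 0 → p = 0 :=
    fun y p h1 h2 => y.2.2.eq_zero_of_common_zero h hpos hpsd hE y.2.1.1 h1 h2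
  have hmap : ∀ y : solSet f₂ f₃ f₄, graphMap f₂ f₃ f₄ y.1 = (y.1.1, 0) := fun y =>
    Prod.ext rfl ((isSolution_vecPair_iff h y.1).1 y.2.2).1
  have hopen : IsOpenMap (solProj f₂ f₃ f₄) := by
    rw [isOpenMap_iff_nhds_le]
    intro y W hW
    rw [Filter.mem_map, mem_nhds_subtype] at hW
    obtain ⟨W', hW', hsub⟩ := hW
    obtain ⟨e, hye, he⟩ := exists_openPartialHomeomorph_graphMap y.1
      (fderiv_graphMap_injective h y.1 (hcommon y))
    have hy0 : e y.1 = (y.1.1, 0) := by rw [he, hmap]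
    have hnd : ∀ r, r ≠ 0 → leftVal f₂ y.1 r ≠ 0 ∨ rightVal f₄ y.1 r ≠ 0 := by
      intro r hr
      by_contra! hc
      have h4 : eval r (4 : MvPolynomial (Fin 2) ℝ) = 4 := map_ofNat _ _
      have h2 : eval r (2 : MvPolynomial (Fin 2) ℝ) = 2 := map_ofNat _ _
      have hl : eval r (f₂ - C y.1.1 * (vecPair y.1.2).1) = 0 := by
        rw [← hc.1]; simp [leftVal, vecPair]
      have hr' : eval r (4 * f₄ - (vecPair y.1.2).1 ^ 2) = 0 := by
        rw [← hc.2]; simp [rightVal, vecPair]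
      have heq := congrArg (eval r) y.2.2.eq
      rw [map_mul, hl, zero_mul, map_add, map_pow, map_pow] at heq
      have hη : eval r (vecPair y.1.2).2 = 0 := by
        nlinarith [sq_nonneg (eval r (vecPair y.1.2).2), sq_nonneg (eval r f₃)]
      have := hcommon y (fun i => (r i : ℂ)) (by rw [aeval_ofReal, hη, Complex.ofReal_zero])
        (by rw [aeval_ofReal, map_add, map_mul, map_mul _ (2 * (vecPair y.1.2).1), hl, hr']; simp)
      apply hr
      ext i
      simpa using congrFun this i
    have hpsd' := eventually_psd ((isSolution_vecPair_iff h y.1).1 y.2.2).2 hnd h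
    have hcont : Filter.Tendsto (fun t : unitInterval => e.symm ((t : ℝ), (0 : Fin 7 → ℝ)))
        (nhds (solProj f₂ f₃ f₄ y)) (nhds y.1) := by
      have h1 : Filter.Tendsto e.symm (nhds (y.1.1, (0 : Fin 7 → ℝ))) (nhds y.1) := by
        have := e.symm.continuousAt (x := e y.1) (e.map_source hye)
        rw [ContinuousAt, e.left_inv hye, hy0] at this
        exact this
      refine h1.comp ?_
      exact (continuous_subtype_val.prodMk continuous_const).continuousAt.tendsto
    have htarget : ∀ᶠ t : unitInterval in nhds (solProj f₂ f₃ f₄ y),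
        ((t : ℝ), (0 : Fin 7 → ℝ)) ∈ e.target := by
      have hm : (((solProj f₂ f₃ f₄ y : unitInterval) : ℝ), (0 : Fin 7 → ℝ)) ∈ e.target := by
        have := e.map_source hye
        rw [hy0] at this
        exact this
      exact (continuous_subtype_val.prodMk continuous_const).continuousAt.eventually_mem
        (e.open_target.mem_nhds hm)
    filter_upwards [hcont.eventually hpsd', hcont.eventually hW', htarget] with t ht1 ht2 ht3
    set x := e.symm ((t : ℝ), (0 : Fin 7 → ℝ)) with hx
    have hex : graphMap f₂ f₃ f₄ x = ((t : ℝ), 0) := by rw [← he, hx, e.right_inv ht3]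
    have hx1 : x.1 = t := congrArg Prod.fst hex
    have hx2 : eqnMap f₂ f₃ f₄ x = 0 := congrArg Prod.snd hex
    have hxS : x ∈ solSet f₂ f₃ f₄ :=
      ⟨by rw [hx1]; exact t.2, (isSolution_vecPair_iff h x).2 ⟨hx2, ht1 hx2⟩⟩
    have hxW : (⟨x, hxS⟩ : solSet f₂ f₃ f₄) ∈ solProj f₂ f₃ f₄ ⁻¹' W := hsub ht2
    have hpt : solProj f₂ f₃ f₄ ⟨x, hxS⟩ = t := Subtype.ext hx1
    rw [Set.mem_preimage, hpt] at hxW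
    exact hxW
  intro y
  obtain ⟨e, hye, he⟩ := exists_openPartialHomeomorph_graphMap y.1
    (fderiv_graphMap_injective h y.1 (hcommon y))
  have hU : IsOpen (Subtype.val ⁻¹' e.source : Set (solSet f₂ f₃ f₄)) :=
    e.open_source.preimage continuous_subtype_val
  refine ⟨_, hU.mem_nhds hye, .of_continuous_injective_isOpenMap
    (continuous_solProj.comp continuous_subtype_val) ?_ (hopen.comp hU.isOpenMap_subtype_val)⟩
  rintro ⟨a, ha⟩ ⟨b, hb⟩ hab
  have h1 : a.1.1 = b.1.1 := congrArg Subtype.val hab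
  refine Subtype.ext (Subtype.ext (e.injOn ha hb ?_))
  rw [he, he, hmap, hmap, h1]

theorem isContinuousFamily_vecPair {T : Type} [TopologicalSpace T] {x : T → PairVec}
    (hx : Continuous x) : IsContinuousFamily fun t => vecPair (x t) := by
  intro d
  simp only [vecPair, coeff_vecForm]
  exact ⟨continuous_finsetSum _ fun i _ =>
      ((continuous_apply i).comp (continuous_fst.comp hx)).mul continuous_const,
    continuous_finsetSum _ fun i _ =>
      ((continuous_apply i).comp (continuous_snd.comp hx)).mul continuous_const⟩

theorem continuous_pairVec {T : Type} [TopologicalSpace T]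
    {γ : T → MvPolynomial (Fin 2) ℝ × MvPolynomial (Fin 2) ℝ} (hγ : IsContinuousFamily γ) :
    Continuous fun t => pairVec (γ t) :=
  (continuous_pi fun _ => (hγ _).1).prodMk (continuous_pi fun _ => (hγ _).2)

/-- Unique continuation of solutions along `0 ≤ t ≤ 1`, by path lifting. -/
theorem existsUnique_continuation (h : AreForms f₂ f₃ f₄)
    (hpos : IsPosDef (normalQuartic f₂ f₃ f₄)) (hpsd : IsPSD (normalQuartic f₂ f₃ f₄ - X 2 ^ 4))
    (hE : ∀ i, ¬ Exceptional f₂ f₃ f₄ i)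
    {s : MvPolynomial (Fin 2) ℝ × MvPolynomial (Fin 2) ℝ} (hs : IsSolution f₂ f₃ f₄ 0 s) :
    ∃! γ : unitInterval → MvPolynomial (Fin 2) ℝ × MvPolynomial (Fin 2) ℝ,
      IsContinuousFamily γ ∧ γ 0 = s ∧
        ∀ t : unitInterval, IsSolution f₂ f₃ f₄ (t : ℝ) (γ t) := by
  have cov := isCoveringMap_solProj h hpos hpsd hE
  have hs' := vecPair_pairVec hs.hom_xi hs.hom_eta
  set e₀ : solSet f₂ f₃ f₄ := ⟨(0, pairVec s), by simp, by rw [hs']; exact hs⟩ with he₀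
  have hγ₀ : (ContinuousMap.id unitInterval) 0 = solProj f₂ f₃ f₄ e₀ := rfl
  set Γ := cov.liftPath (ContinuousMap.id unitInterval) e₀ hγ₀ with hΓ
  have hlift : ∀ t, solProj f₂ f₃ f₄ (Γ t) = t := fun t =>
    congrFun (cov.liftPath_lifts (ContinuousMap.id unitInterval) e₀ hγ₀) t
  have hzero : Γ 0 = e₀ := cov.liftPath_zero (ContinuousMap.id unitInterval) e₀ hγ₀
  refine ⟨fun t => vecPair (Γ t).1.2, ⟨?_, ?_, ?_⟩, ?_⟩
  · exact isContinuousFamily_vecPair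
      (continuous_snd.comp (continuous_subtype_val.comp Γ.continuous))
  · simp only [hzero, he₀, hs']
  · intro t
    have h1 := (Γ t).2.2
    rwa [show (Γ t).1.1 = (t : ℝ) from congrArg Subtype.val (hlift t)] at h1
  · rintro γ ⟨hγ, hγ0, hγs⟩
    have hmem : ∀ t : unitInterval, ((t : ℝ), pairVec (γ t)) ∈ solSet f₂ f₃ f₄ := fun t =>
      ⟨t.2, by rw [vecPair_pairVec (hγs t).hom_xi (hγs t).hom_eta]; exact hγs t⟩
    have hΔ : (fun t => (⟨_, hmem t⟩ : solSet f₂ f₃ f₄)) = Γ := by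
      rw [hΓ, cov.eq_liftPath_iff]
      refine ⟨(continuous_subtype_val.prodMk (continuous_pairVec hγ)).subtype_mk _, rfl, ?_⟩
      exact Subtype.ext (Prod.ext rfl (congrArg pairVec hγ0))
    ext1 t
    rw [← congrFun hΔ t, vecPair_pairVec (hγs t).hom_xi (hγs t).hom_eta]

end

/-! ### Solutions of `C_0` -/

theorem nonneg_of_nonneg_of_mul {s d : ℝ[X]} {r : ℝ} (hs : ∀ x, x ≠ r → 0 < s.eval x)
    (h : ∀ x, 0 ≤ (s * d).eval x) (x : ℝ) : 0 ≤ d.eval x := by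
  have hcl : IsClosed {x : ℝ | 0 ≤ d.eval x} := isClosed_le continuous_const d.continuous
  have hsub : ({r}ᶜ : Set ℝ) ⊆ {x : ℝ | 0 ≤ d.eval x} := by
    intro y hy
    have := h y
    rw [Polynomial.eval_mul] at this
    exact nonneg_of_mul_nonneg_right this (hs y hy)
  have := hcl.closure_subset_iff.2 hsub
  rw [(dense_compl_singleton r).closure_eq] at this
  exact this (Set.mem_univ x)

/-- Every monic quadratic polynomial without real zeros is the sum of a nonnegative multiple of a
given quadratic polynomial with positive outer coefficients and of a square. -/
theorem exists_quadratic_eq_mul_add_sq {q₂ q₁ q₀ s₁ s₀ : ℝ} (hq₂ : 0 < q₂) (hq₀ : 0 < q₀)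
    (hs : s₁ ^ 2 < 4 * s₀) :
    ∃ c m n : ℝ, ∀ x : ℝ, x ^ 2 + s₁ * x + s₀ =
      c ^ 2 * (q₂ * x ^ 2 + q₁ * x + q₀) + (m * x + n) ^ 2 := by
  have hs0 : 0 < s₀ := by nlinarith [sq_nonneg s₁]
  -- the multiple for which the difference degenerates is found by the intermediate value
  -- theorem, before one of the outer coefficients of the difference turns negative
  set M := min (1 / q₂) (s₀ / q₀) with hM
  have hM0 : 0 ≤ M := le_min (by positivity) (by positivity)
  set φ : ℝ → ℝ := fun c => 4 * (1 - c * q₂) * (s₀ - c * q₀) - (s₁ - c * q₁) ^ 2 with hφ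
  have hcont : ContinuousOn φ (Set.Icc 0 M) := by
    apply Continuous.continuousOn
    fun_prop
  have h0 : 0 ≤ φ 0 := by simp only [hφ]; nlinarith
  have h1 : φ M ≤ 0 := by
    have : (1 - M * q₂) * (s₀ - M * q₀) = 0 := by
      rcases min_choice (1 / q₂) (s₀ / q₀) with h | h
      · rw [hM, h]; field_simp; ring
      · rw [hM, h]; field_simp; ring
    simp only [hφ]
    nlinarith [sq_nonneg (s₁ - M * q₁)]
  obtain ⟨c, ⟨hc0, hcM⟩, hc⟩ := intermediate_value_Icc' hM0 hcont ⟨h1, h0⟩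
  have hm : 0 ≤ 1 - c * q₂ := by
    have : c * q₂ ≤ 1 / q₂ * q₂ :=
      mul_le_mul_of_nonneg_right (hcM.trans (min_le_left _ _)) hq₂.le
    rw [one_div, inv_mul_cancel₀ hq₂.ne'] at this
    linarith
  have hp : 0 ≤ s₀ - c * q₀ := by
    have : c * q₀ ≤ s₀ / q₀ * q₀ :=
      mul_le_mul_of_nonneg_right (hcM.trans (min_le_right _ _)) hq₀.le
    rw [div_mul_cancel₀ _ hq₀.ne'] at this
    linarith
  have e1 := Real.sq_sqrt hc0
  have e2 := Real.sq_sqrt hm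
  have e3 := Real.sq_sqrt hp
  have hn : (s₁ - c * q₁) ^ 2 = (2 * √(1 - c * q₂) * √(s₀ - c * q₀)) ^ 2 := by
    rw [mul_pow, mul_pow, e2, e3]
    simp only [hφ] at hc
    linarith
  rcases sq_eq_sq_iff_eq_or_eq_neg.1 hn with h | h
  · exact ⟨√c, √(1 - c * q₂), √(s₀ - c * q₀), fun x => by
      linear_combination (-(q₂ * x ^ 2 + q₁ * x + q₀)) * e1 - x ^ 2 * e2 - e3 + x * h⟩
  · exact ⟨√c, √(1 - c * q₂), -√(s₀ - c * q₀), fun x => by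
      linear_combination (-(q₂ * x ^ 2 + q₁ * x + q₀)) * e1 - x ^ 2 * e2 - e3 + x * h⟩

/-- A nonnegative polynomial is represented by the binary quadratic form `⟨q, 1⟩` over `ℝ[X]`, for
every positive definite quadratic polynomial `q`. This holds for quadratic factors, and the
represented elements are closed under multiplication. -/
theorem exists_eq_quadratic_mul_sq_add_sq {q : ℝ[X]} (hqd : q.natDegree ≤ 2) (hq₂ : 0 < q.coeff 2)
    (hq : ∀ x, 0 < q.eval x) (k : ℕ) (d : ℝ[X]) (hd : d.natDegree ≤ 2 * k)
    (hd0 : ∀ x, 0 ≤ d.eval x) :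
    ∃ u v : ℝ[X], u.degree < k ∧ v.natDegree ≤ k ∧ d = q * u ^ 2 + v ^ 2 := by
  have hconst : ∀ (k : ℕ) (d : ℝ[X]), d.natDegree = 0 → (∀ x, 0 ≤ d.eval x) →
      ∃ u v : ℝ[X], u.degree < k ∧ v.natDegree ≤ k ∧ d = q * u ^ 2 + v ^ 2 := by
    intro k d h h0
    obtain ⟨c, rfl⟩ := Polynomial.natDegree_eq_zero.1 h
    refine ⟨0, Polynomial.C √c, by simp, by simp, ?_⟩
    have := h0 0
    rw [Polynomial.eval_C] at this
    rw [← Polynomial.C_pow, Real.sq_sqrt this]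
    simp
  induction k generalizing d with
  | zero => exact hconst 0 d (by omega) hd0
  | succ k ih =>
    by_cases hdeg : d.natDegree = 0
    · exact hconst _ d hdeg hd0
    have hdne : d ≠ 0 := by rintro rfl; simp at hdeg
    by_cases hroot : ∃ r, d.eval r = 0
    · obtain ⟨r, hr⟩ := hroot
      have hder : (Polynomial.derivative d).eval r = 0 := by
        refine IsLocalMin.hasDerivAt_eq_zero (f := fun x => d.eval x) ?_ (d.hasDerivAt r)
        refine Filter.Eventually.of_forall fun x => ?_
        beta_reduce
        rw [hr]
        exact hd0 x
      have hmul := (Polynomial.one_lt_rootMultiplicity_iff_isRoot hdne).2 ⟨hr, hder⟩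
      obtain ⟨d', rfl⟩ := (Polynomial.le_rootMultiplicity_iff hdne).1 hmul
      have hd'0 : d' ≠ 0 := right_ne_zero_of_mul hdne
      have hX : (Polynomial.X - Polynomial.C r) ^ 2 ≠ 0 := left_ne_zero_of_mul hdne
      have hd' : d'.natDegree ≤ 2 * k := by
        rw [Nat.succ_eq_add_one, Polynomial.natDegree_mul hX hd'0, Polynomial.natDegree_pow,
          Polynomial.natDegree_X_sub_C] at hd
        omega
      obtain ⟨u, v, hu, hv, rfl⟩ := ih d' hd' (nonneg_of_nonneg_of_mul (r := r)
        (fun x hx => by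
          rw [Polynomial.eval_pow, Polynomial.eval_sub, Polynomial.eval_X, Polynomial.eval_C]
          exact lt_of_le_of_ne (sq_nonneg _) (pow_ne_zero 2 (sub_ne_zero.2 hx)).symm) hd0)
      refine ⟨(Polynomial.X - Polynomial.C r) * u, (Polynomial.X - Polynomial.C r) * v, ?_, ?_, ?_⟩
      · by_cases hu0 : u = 0
        · rw [hu0, mul_zero, Polynomial.degree_zero]
          exact WithBot.bot_lt_coe _
        rw [Polynomial.degree_mul, Polynomial.degree_X_sub_C, Polynomial.degree_eq_natDegree hu0]
        rw [Polynomial.degree_eq_natDegree hu0] at hu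
        have : u.natDegree < k := by exact_mod_cast hu
        exact_mod_cast (by omega : 1 + u.natDegree < k + 1)
      · refine Polynomial.natDegree_mul_le.trans ?_
        rw [Polynomial.natDegree_X_sub_C]
        omega
      · rw [Nat.succ_eq_add_one]
        ring
    · push Not at hroot
      obtain ⟨α, hα⟩ := IsAlgClosed.exists_aeval_eq_zero ℂ d
        (fun h => hdeg (Polynomial.natDegree_eq_of_degree_eq_some h))
      have him : α.im ≠ 0 := by
        intro h
        apply hroot α.re
        have h2 : ((α.re : ℝ) : ℂ) = α := Complex.ext (by simp) (by simp [h])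
        rw [← h2] at hα
        have h3 := Polynomial.aeval_algebraMap_apply ℂ α.re d
        rw [Complex.coe_algebraMap, hα] at h3
        have h4 : Polynomial.aeval α.re d = d.eval α.re := by simp
        rw [h4] at h3
        exact_mod_cast h3.symm
      obtain ⟨d', rfl⟩ := Polynomial.quadratic_dvd_of_aeval_eq_zero_im_ne_zero d hα him
      set s : ℝ[X] := Polynomial.X ^ 2 - Polynomial.C (2 * α.re) * Polynomial.X +
        Polynomial.C (‖α‖ ^ 2) with hs
      have hnorm : ‖α‖ ^ 2 = α.re ^ 2 + α.im ^ 2 := by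
        rw [← Complex.normSq_eq_norm_sq, Complex.normSq_apply]; ring
      have him2 : 0 < α.im ^ 2 := by positivity
      have hseval : ∀ x, s.eval x = x ^ 2 + (-(2 * α.re)) * x + ‖α‖ ^ 2 := by
        intro x; simp [hs]; ring
      have hspos : ∀ x, 0 < s.eval x := by
        intro x
        rw [hseval, hnorm]
        nlinarith [sq_nonneg (x - α.re)]
      have hsd : s.natDegree = 2 := by rw [hs]; compute_degree!
      have hd'0 : d' ≠ 0 := right_ne_zero_of_mul hdne
      have hd' : d'.natDegree ≤ 2 * k := by
        rw [Polynomial.natDegree_mul (left_ne_zero_of_mul hdne) hd'0, hsd] at hd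
        omega
      obtain ⟨u, v, hu, hv, huv⟩ := ih d' hd'
        (nonneg_of_nonneg_of_mul (r := 0) (fun x _ => hspos x) hd0)
      have hqe : ∀ x, q.eval x = q.coeff 2 * x ^ 2 + q.coeff 1 * x + q.coeff 0 := by
        intro x
        rw [Polynomial.eval_eq_sum_range' (Nat.lt_succ_of_le hqd)]
        simp [Finset.sum_range_succ]
        ring
      have hq₀ : 0 < q.coeff 0 := by
        have := hq 0
        rw [hqe] at this
        simpa using this
      obtain ⟨c, m, n, hcmn⟩ := exists_quadratic_eq_mul_add_sq (q₂ := q.coeff 2) (q₁ := q.coeff 1)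
        (q₀ := q.coeff 0) (s₁ := -(2 * α.re)) (s₀ := ‖α‖ ^ 2) hq₂ hq₀ (by rw [hnorm]; nlinarith)
      set l : ℝ[X] := Polynomial.C m * Polynomial.X + Polynomial.C n with hl
      have hsq : s = Polynomial.C c ^ 2 * q + l ^ 2 := by
        apply Polynomial.funext
        intro x
        rw [hseval, hcmn, ← hqe]
        simp [hl]
      have hld : l.natDegree ≤ 1 := Polynomial.natDegree_linear_le
      refine ⟨Polynomial.C c * v + l * u, l * v - q * Polynomial.C c * u, ?_, ?_, ?_⟩
      · have h1 : (Polynomial.C c * v).natDegree ≤ k :=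
          (Polynomial.natDegree_C_mul_le _ _).trans hv
        refine (Polynomial.degree_add_le _ _).trans_lt (max_lt ?_ ?_)
        · exact (Polynomial.degree_le_of_natDegree_le h1).trans_lt
            (by exact_mod_cast Nat.lt_succ_self k)
        · by_cases hu0 : u = 0
          · rw [hu0, mul_zero, Polynomial.degree_zero]
            exact WithBot.bot_lt_coe _
          rw [Polynomial.degree_eq_natDegree hu0] at hu
          have hu' : u.natDegree < k := by exact_mod_cast hu
          have h2 : (l * u).natDegree ≤ k := Polynomial.natDegree_mul_le.trans (by omega)
          exact (Polynomial.degree_le_of_natDegree_le h2).trans_lt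
            (by exact_mod_cast Nat.lt_succ_self k)
      · refine (Polynomial.natDegree_sub_le _ _).trans (max_le ?_ ?_)
        · exact Polynomial.natDegree_mul_le.trans (by omega)
        · by_cases hu0 : u = 0
          · simp [hu0]
          rw [Polynomial.degree_eq_natDegree hu0] at hu
          have hu' : u.natDegree < k := by exact_mod_cast hu
          have h3 : (q * Polynomial.C c).natDegree ≤ 2 :=
            (Polynomial.natDegree_mul_C_le _ _).trans hqd
          exact Polynomial.natDegree_mul_le.trans (by omega)
      · rw [huv, hsq]
        ring

section

variable {f₂ f₃ f₄ : MvPolynomial (Fin 2) ℝ}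

/-- For `t = 0`, the equation says `4 f₂ f₄ - f₃ ^ 2 = f₂ ξ ^ 2 + η ^ 2`. The left side is psd,
and `f₂` is positive definite, so that such a representation exists. -/
theorem exists_isSolution_zero (h : AreForms f₂ f₃ f₄)
    (hpsd : IsPSD (normalQuartic f₂ f₃ f₄ - X 2 ^ 4)) (hE₁ : disc 2 f₂ ≠ 0) :
    ∃ s, IsSolution f₂ f₃ f₄ 0 s := by
  have hpos := isPosDef_of_disc_ne_zero le_rfl h.hom₂ (isPSD_leading_of_isPSD_sub hpsd) hE₁
  have hD6 : (4 * f₂ * f₄ - f₃ ^ 2).IsHomogeneous 6 :=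
    ((isHomogeneous_ofNat_mul 4 h.hom₂).mul h.hom₄).sub (h.hom₃.pow 2)
  have ev4 : ∀ r : Fin 2 → ℝ, eval r (4 : MvPolynomial (Fin 2) ℝ) = 4 := fun r => map_ofNat _ _
  have hDpsd : ∀ r, r ≠ 0 → 0 ≤ eval r (4 * f₂ * f₄ - f₃ ^ 2) := by
    intro r hr
    have ha := hpos r hr
    have hq := forall_quadratic_nonneg_of_isPSD_sub hpsd r (-eval r f₃ / (2 * eval r f₂))
    simp only [map_sub, map_mul, map_pow, ev4]
    have : eval r f₂ * (-eval r f₃ / (2 * eval r f₂)) ^ 2 +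
        eval r f₃ * (-eval r f₃ / (2 * eval r f₂)) + eval r f₄ =
        (4 * eval r f₂ * eval r f₄ - eval r f₃ ^ 2) / (4 * eval r f₂) := by
      field_simp
      ring
    rw [this] at hq
    have h4 : 0 < 4 * eval r f₂ := by linarith
    rwa [le_div_iff₀ h4, zero_mul] at hq
  have hne : ∀ x : ℝ, (![x, 1] : Fin 2 → ℝ) ≠ 0 := fun x h => by simpa using congrFun h 1
  obtain ⟨u, v, hu, hv, huv⟩ := exists_eq_quadratic_mul_sq_add_sq (q := toPoly f₂)
    (natDegree_toPoly_le h.hom₂) (by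
      have h1 := hpos ![1, 0] (fun h => by simpa using congrFun h 0)
      rw [eval_form h.hom₂] at h1
      rw [coeff_toPoly h.hom₂, if_pos le_rfl]
      simpa [Finset.sum_range_succ] using h1)
    (fun x => by rw [← eval_eq_eval_toPoly h.hom₂]; exact hpos _ (hne x)) 3
    (toPoly (4 * f₂ * f₄ - f₃ ^ 2)) (natDegree_toPoly_le hD6)
    (fun x => by rw [← eval_eq_eval_toPoly hD6]; exact hDpsd _ (hne x))
  have hu' : u.natDegree ≤ 2 := by
    by_cases hu0 : u = 0
    · simp [hu0]
    rw [Polynomial.degree_eq_natDegree hu0] at hu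
    have : u.natDegree < 3 := by exact_mod_cast hu
    omega
  have h2 := isHomogeneous_homog 2 u
  have h3 := isHomogeneous_homog 3 v
  have hD : 4 * f₂ * f₄ - f₃ ^ 2 = f₂ * homog 2 u ^ 2 + homog 3 v ^ 2 := by
    refine form_ext hD6 ((h.hom₂.mul (h2.pow 2)).add (h3.pow 2)) ?_
    rw [huv, map_add, map_mul, map_pow, map_pow, toPoly_homog hu', toPoly_homog hv]
  have heq : homog 3 v ^ 2 + f₃ ^ 2 = f₂ * (4 * f₄ - homog 2 u ^ 2) := by
    linear_combination -hD
  refine ⟨(homog 2 u, homog 3 v), h2, h3, ?_, ?_, ?_⟩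
  · rw [C_0, zero_mul, sub_zero]
    exact heq
  · rw [C_0, zero_mul, sub_zero]
    exact isPSD_leading_of_isPSD_sub hpsd
  · intro r
    by_cases hr : r = 0
    · subst hr
      exact (eval_zero_form ((isHomogeneous_ofNat_mul 4 h.hom₄).sub (h2.pow 2)) four_ne_zero).ge
    · have e := congrArg (eval r) heq
      rw [map_add, map_pow, map_pow, map_mul] at e
      refine nonneg_of_mul_nonneg_right (a := eval r f₂) ?_ (hpos r hr)
      rw [← e]
      positivity

end

/-! ### Sums of three squares from solutions of `C_1` -/

theorem exists_eq_linear_mul {m : ℕ} {F : MvPolynomial (Fin 2) ℝ} (hF : F.IsHomogeneous (m + 1))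
    {r : Fin 2 → ℝ} (hr : r ≠ 0) (h0 : eval r F = 0) :
    ∃ G : MvPolynomial (Fin 2) ℝ, G.IsHomogeneous m ∧ F = (C (r 1) * X 0 - C (r 0) * X 1) * G := by
  have hlin : (C (r 1) * X 0 - C (r 0) * X 1 : MvPolynomial (Fin 2) ℝ).IsHomogeneous 1 :=
    ((isHomogeneous_X ℝ (0 : Fin 2)).C_mul (r 1)).sub ((isHomogeneous_X ℝ (1 : Fin 2)).C_mul (r 0))
  have htl : toPoly (C (r 1) * X 0 - C (r 0) * X 1) =
      Polynomial.C (r 1) * Polynomial.X - Polynomial.C (r 0) := by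
    simp [toPoly, Polynomial.C_eq_algebraMap]
  by_cases hr1 : r 1 = 0
  · have hr0 : r 0 ≠ 0 := by
      intro h
      apply hr
      ext i
      fin_cases i
      · exact h
      · exact hr1
    have hc : (toPoly F).coeff (m + 1) = 0 := by
      have h1 := aeval_form_of_eq_zero hF (p := fun i => (r i : ℂ)) (by simp [hr1])
      rw [aeval_ofReal, h0, coeff_dehom] at h1
      have h2 : r 0 ^ (m + 1) * (toPoly F).coeff (m + 1) = 0 := by exact_mod_cast h1.symm
      exact (mul_eq_zero.1 h2).resolve_left (pow_ne_zero _ hr0)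
    have hd : (toPoly F).natDegree ≤ m := by
      rw [Polynomial.natDegree_le_iff_coeff_eq_zero]
      intro N hN
      rcases Nat.lt_iff_add_one_le.1 hN |>.eq_or_lt with h | h
      · rw [← h, hc]
      · exact Polynomial.coeff_eq_zero_of_natDegree_lt
          (lt_of_le_of_lt (natDegree_toPoly_le hF) h)
    have hd' : (Polynomial.C (-(r 0))⁻¹ * toPoly F).natDegree ≤ m :=
      (Polynomial.natDegree_C_mul_le _ _).trans hd
    refine ⟨homog m (Polynomial.C (-(r 0))⁻¹ * toPoly F), isHomogeneous_homog _ _, ?_⟩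
    refine form_ext hF ?_ ?_
    · rw [add_comm]
      exact hlin.mul (isHomogeneous_homog _ _)
    · rw [map_mul, htl, toPoly_homog hd', hr1, Polynomial.C_0, zero_mul, zero_sub,
        ← Polynomial.C_neg, ← mul_assoc, ← Polynomial.C_mul,
        mul_inv_cancel₀ (neg_ne_zero.2 hr0), Polynomial.C_1, one_mul]
  · have hroot : (toPoly F).IsRoot (r 0 / r 1) := by
      have h1 := aeval_form_of_ne_zero hF (p := fun i => (r i : ℂ))
        (by simpa using hr1)
      have h2 : eval ![r 0 / r 1, 1] F = (toPoly F).eval (r 0 / r 1) := eval_eq_eval_toPoly hF _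
      have h3 : r = fun i => r 1 * (![r 0 / r 1, 1] : Fin 2 → ℝ) i := by
        ext i
        fin_cases i
        · simp [mul_div_cancel₀ _ hr1]
        · simp
      rw [h3, eval_smul_form hF] at h0
      rw [Polynomial.IsRoot, ← h2]
      exact (mul_eq_zero.1 h0).resolve_left (pow_ne_zero _ hr1)
    obtain ⟨w, hw⟩ := Polynomial.dvd_iff_isRoot.2 hroot
    have hwd : w.natDegree ≤ m := by
      by_cases hw0 : w = 0
      · simp [hw0]
      have h1 := natDegree_toPoly_le hF
      rw [hw, Polynomial.natDegree_mul (Polynomial.X_sub_C_ne_zero _) hw0,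
        Polynomial.natDegree_X_sub_C] at h1
      omega
    refine ⟨homog m (Polynomial.C (r 1)⁻¹ * w), isHomogeneous_homog _ _, ?_⟩
    refine form_ext hF ?_ ?_
    · rw [add_comm]
      exact hlin.mul (isHomogeneous_homog _ _)
    · rw [map_mul, htl, toPoly_homog ((Polynomial.natDegree_C_mul_le _ _).trans hwd), hw]
      have h1 : (Polynomial.C (r 1) * Polynomial.C (r 1)⁻¹ : ℝ[X]) = 1 := by
        rw [← Polynomial.C_mul, mul_inv_cancel₀ hr1, Polynomial.C_1]
      have h2 : Polynomial.C (r 0 / r 1) = Polynomial.C (r 0) * Polynomial.C (r 1)⁻¹ := by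
        rw [← Polynomial.C_mul, div_eq_mul_inv]
      rw [h2]
      linear_combination (-(Polynomial.X * w)) * h1

theorem linear_ne_zero {r : Fin 2 → ℝ} (hr : r ≠ 0) :
    (C (r 1) * X 0 - C (r 0) * X 1 : MvPolynomial (Fin 2) ℝ) ≠ 0 := by
  intro h
  apply hr
  have h0 := congrArg (eval ![1, 0]) h
  have h1 := congrArg (eval ![0, 1]) h
  ext i
  fin_cases i
  · simpa using h1
  · simpa using h0

section

variable {A B F E : MvPolynomial (Fin 2) ℝ}

/-- If `A` has a real zero, then `A = c l ^ 2` with `c > 0` and `l` linear, and `l` divides `E`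
and `F`. -/
theorem exists_sum_two_squares_of_real_zero (hA : A.IsHomogeneous 2) (hA0 : A ≠ 0)
    (hF : F.IsHomogeneous 3) (hE : E.IsHomogeneous 3) (hApsd : IsPSD A)
    (heq : E ^ 2 + F ^ 2 = A * B) {r : Fin 2 → ℝ} (hr : r ≠ 0) (hAr : eval r A = 0) :
    ∃ a₁ a₂ b₁ b₂ : MvPolynomial (Fin 2) ℝ, (a₁.IsHomogeneous 1 ∧ a₂.IsHomogeneous 1 ∧
      b₁.IsHomogeneous 2 ∧ b₂.IsHomogeneous 2) ∧ A = a₁ ^ 2 + a₂ ^ 2 ∧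
      F = 2 * (a₁ * b₁ + a₂ * b₂) ∧ B = 4 * (b₁ ^ 2 + b₂ ^ 2) := by
  set l : MvPolynomial (Fin 2) ℝ := C (r 1) * X 0 - C (r 0) * X 1 with hl
  have hl1 : l.IsHomogeneous 1 :=
    ((isHomogeneous_X ℝ (0 : Fin 2)).C_mul (r 1)).sub ((isHomogeneous_X ℝ (1 : Fin 2)).C_mul (r 0))
  have hl0 : l ≠ 0 := linear_ne_zero hr
  have hEF := congrArg (eval r) heq
  rw [map_mul, hAr, zero_mul, map_add, map_pow, map_pow] at hEF
  have hEr : eval r E = 0 := by nlinarith [sq_nonneg (eval r E), sq_nonneg (eval r F)]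
  have hFr : eval r F = 0 := by nlinarith [sq_nonneg (eval r E), sq_nonneg (eval r F)]
  obtain ⟨g, hg, hFg⟩ := exists_eq_linear_mul (m := 2) hF hr hFr
  obtain ⟨k, hk, hEk⟩ := exists_eq_linear_mul (m := 2) hE hr hEr
  obtain ⟨G, hG, hAG⟩ := exists_eq_linear_mul (m := 1) hA hr hAr
  rw [← hl] at hFg hEk hAG
  have hlr : eval r l = 0 := by simp [hl]; ring
  have hGr : eval r G = 0 := by
    have hd : ∀ i, eval r G * eval r (pderiv i l) = 0 := by
      intro i
      have h1 := eval_pderiv_eq_zero_of_isPSD hApsd hAr i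
      rw [hAG, Derivation.leibniz, smul_eq_mul, smul_eq_mul, map_add, map_mul, map_mul, hlr,
        zero_mul, zero_add] at h1
      exact h1
    by_contra hne
    apply hr
    have h0 := (mul_eq_zero.1 (hd 0)).resolve_left hne
    have h1 := (mul_eq_zero.1 (hd 1)).resolve_left hne
    simp [hl, pderiv_X] at h0 h1
    ext i
    fin_cases i
    · exact h1
    · exact h0
  obtain ⟨K, hK, hGK⟩ := exists_eq_linear_mul (m := 0) hG hr hGr
  rw [← hl] at hGK
  obtain ⟨c, rfl⟩ : ∃ c, K = C c :=
    ⟨_, totalDegree_eq_zero_iff_eq_C.1 ((totalDegree_zero_iff_isHomogeneous _).2 hK)⟩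
  have hAc : A = C c * l ^ 2 := by rw [hAG, hGK]; ring
  have hc0 : c ≠ 0 := by rintro rfl; exact hA0 (by rw [hAc]; simp)
  have hc : 0 < c := by
    obtain ⟨v, hv⟩ : ∃ v, eval v l ≠ 0 := by
      by_contra! h
      exact hl0 (MvPolynomial.funext fun v => by rw [h, map_zero])
    have h1 := hApsd v
    rw [hAc, map_mul, eval_C, map_pow] at h1
    have h2 : 0 < eval v l ^ 2 := lt_of_le_of_ne (sq_nonneg _) (pow_ne_zero 2 hv).symm
    exact lt_of_le_of_ne (nonneg_of_mul_nonneg_left h1 h2) hc0.symm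
  have hs := Real.sq_sqrt hc.le
  have hs0 : √c ≠ 0 := (Real.sqrt_pos.2 hc).ne'
  have hcB : C c * B = g ^ 2 + k ^ 2 := by
    apply mul_left_cancel₀ (pow_ne_zero 2 hl0)
    rw [hAc, hFg, hEk] at heq
    linear_combination -heq
  refine ⟨C √c * l, 0, C (2 * √c)⁻¹ * g, C (2 * √c)⁻¹ * k,
    ⟨hl1.C_mul _, isHomogeneous_zero _ _ _, hg.C_mul _, hk.C_mul _⟩, ?_, ?_, ?_⟩
  · rw [hAc, mul_pow, ← C_pow, hs]
    ring
  · have h1 : C √c * C (2 * √c)⁻¹ * 2 = (1 : MvPolynomial (Fin 2) ℝ) := by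
      rw [← map_ofNat C 2, ← C_mul, ← C_mul, ← C_1]
      congr 1
      field_simp
    rw [hFg]
    linear_combination (-(l * g)) * h1
  · have h1 : C c * (C (2 * √c)⁻¹ ^ 2 * 4) = (1 : MvPolynomial (Fin 2) ℝ) := by
      rw [← map_ofNat C 4, ← C_pow, ← C_mul, ← C_mul, ← C_1]
      congr 1
      rw [inv_pow, mul_pow, hs]
      field_simp
      norm_num
    have hCc : (C c : MvPolynomial (Fin 2) ℝ) ≠ 0 := by simpa using hc0
    apply mul_left_cancel₀ hCc
    linear_combination hcB - (g ^ 2 + k ^ 2) * h1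

/-- If `A = a₁ ^ 2 + a₂ ^ 2` is positive definite, then one of `a₁ ± i a₂` divides `F + i E` by
the equation `(F + i E) (F - i E) = A B`, and the quotient has the components `2 b₁, 2 b₂`. -/
theorem exists_sum_two_squares_of_isPosDef (hA : A.IsHomogeneous 2) (hF : F.IsHomogeneous 3)
    (hE : E.IsHomogeneous 3) (hpos : IsPosDef A) (heq : E ^ 2 + F ^ 2 = A * B) :
    ∃ a₁ a₂ b₁ b₂ : MvPolynomial (Fin 2) ℝ, (a₁.IsHomogeneous 1 ∧ a₂.IsHomogeneous 1 ∧
      b₁.IsHomogeneous 2 ∧ b₂.IsHomogeneous 2) ∧ A = a₁ ^ 2 + a₂ ^ 2 ∧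
      F = 2 * (a₁ * b₁ + a₂ * b₂) ∧ B = 4 * (b₁ ^ 2 + b₂ ^ 2) := by
  -- complete the square in `A`
  obtain ⟨m, n, e, hm, he, hAsq⟩ : ∃ m n e : ℝ, 0 < m ∧ 0 < e ∧
      A = (C m * X 0 + C n * X 1) ^ 2 + (C e * X 1) ^ 2 := by
    have hv : ∀ x y : ℝ, eval ![x, y] A =
        binCoeff 2 0 A * y ^ 2 + binCoeff 2 1 A * x * y + binCoeff 2 2 A * x ^ 2 := by
      intro x y
      rw [eval_form hA]
      simp [Finset.sum_range_succ]
    set p := binCoeff 2 0 A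
    set q := binCoeff 2 1 A
    set s := binCoeff 2 2 A
    have hs : 0 < s := by
      have := hpos ![1, 0] (fun h => by simpa using congrFun h 0)
      rw [hv] at this
      simpa using this
    have hd : 0 < p - q ^ 2 / (4 * s) := by
      have := hpos ![-q / (2 * s), 1] (fun h => by simpa using congrFun h 1)
      rw [hv] at this
      have e1 : p * 1 ^ 2 + q * (-q / (2 * s)) * 1 + s * (-q / (2 * s)) ^ 2 =
          p - q ^ 2 / (4 * s) := by
        field_simp
        ring
      rwa [e1] at this
    refine ⟨√s, q / (2 * √s), √(p - q ^ 2 / (4 * s)), Real.sqrt_pos.2 hs, Real.sqrt_pos.2 hd, ?_⟩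
    apply MvPolynomial.funext
    intro r
    have hr : r = ![r 0, r 1] := by
      ext i; fin_cases i <;> rfl
    rw [hr, hv]
    have hs1 := Real.sq_sqrt hs.le
    have hs2 := Real.sq_sqrt hd.le
    have hs0 : √s ≠ 0 := (Real.sqrt_pos.2 hs).ne'
    simp only [map_add, map_mul, map_pow, eval_C, eval_X, Matrix.cons_val_zero,
      Matrix.cons_val_one]
    have e2 : (q / (2 * √s)) ^ 2 = q ^ 2 / (4 * s) := by
      rw [div_pow, mul_pow, hs1]; norm_num
    have e3 : √s * (q / (2 * √s)) = q / 2 := by field_simp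
    linear_combination (-(r 0) ^ 2) * hs1 - (r 1) ^ 2 * hs2 - (r 1) ^ 2 * e2 -
      2 * r 0 * r 1 * e3
  have ha₁ : (C m * X 0 + C n * X 1 : MvPolynomial (Fin 2) ℝ).IsHomogeneous 1 :=
    ((isHomogeneous_X ℝ (0 : Fin 2)).C_mul m).add ((isHomogeneous_X ℝ (1 : Fin 2)).C_mul n)
  have ha₂ : (C e * X 1 : MvPolynomial (Fin 2) ℝ).IsHomogeneous 1 :=
    (isHomogeneous_X ℝ (1 : Fin 2)).C_mul e
  set p : Fin 2 → ℂ := ![-(n + e * Complex.I) / m, 1] with hp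
  have hmC : (m : ℂ) ≠ 0 := by exact_mod_cast hm.ne'
  set a₁ : MvPolynomial (Fin 2) ℝ := C m * X 0 + C n * X 1 with ha₁def
  set a₂ : MvPolynomial (Fin 2) ℝ := C e * X 1 with ha₂def
  have hpa : aeval p a₁ = -(e * Complex.I) ∧ aeval p a₂ = e := by
    constructor
    · simp [ha₁def, hp]
      field_simp
      ring
    · simp [ha₂def, hp]
  have hpA : aeval p A = 0 := by
    rw [hAsq, map_add, map_pow, map_pow, hpa.1, hpa.2]
    linear_combination (e : ℂ) ^ 2 * Complex.I_sq
  have hpne : p 0 * starRingEnd ℂ (p 1) ≠ starRingEnd ℂ (p 0) * p 1 := by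
    have h1 : p 1 = 1 := rfl
    have h0 : p 0 = -(n + e * Complex.I) / m := rfl
    rw [h1, map_one, mul_one, mul_one, h0]
    intro h
    have := congrArg Complex.im h
    rw [Complex.conj_im] at this
    have him : (-(n + e * Complex.I) / (m : ℂ)).im = -e / m := by
      rw [Complex.div_ofReal_im]; simp
    rw [him] at this
    have : -e / m = 0 := by linarith
    rw [div_eq_zero_iff] at this
    rcases this with h | h <;> linarith
  have hA0 : A ≠ 0 := by
    rintro rfl
    have := hpos ![1, 0] (fun h => by simpa using congrFun h 0)
    simp at this
  -- up to the sign of `E`, both real components of `(a₁ + i a₂) (F + i E)` vanish at `p`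
  have main : ∀ E : MvPolynomial (Fin 2) ℝ, E.IsHomogeneous 3 → E ^ 2 + F ^ 2 = A * B →
      aeval p E = -Complex.I * aeval p F →
      ∃ b₁ b₂ : MvPolynomial (Fin 2) ℝ, b₁.IsHomogeneous 2 ∧ b₂.IsHomogeneous 2 ∧
        F = 2 * (a₁ * b₁ + a₂ * b₂) ∧ B = 4 * (b₁ ^ 2 + b₂ ^ 2) := by
    intro E hE heq hpE
    obtain ⟨k₁, hk₁, e₁⟩ := exists_eq_mul_of_common_nonreal_zero (m := 2) (G := a₁ * F - a₂ * E)
      hA hA0 ((ha₁.mul hF).sub (ha₂.mul hE)) hpne hpA (by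
        rw [map_sub, map_mul, map_mul _ a₂, hpa.1, hpa.2, hpE]; ring)
    obtain ⟨k₂, hk₂, e₂⟩ := exists_eq_mul_of_common_nonreal_zero (m := 2) (G := a₂ * F + a₁ * E)
      hA hA0 ((ha₂.mul hF).add (ha₁.mul hE)) hpne hpA (by
        rw [map_add, map_mul, map_mul _ a₁, hpa.1, hpa.2, hpE]
        linear_combination (e : ℂ) * aeval p F * Complex.I_sq)
    have h2 : (C (1 / 2 : ℝ) * 2 : MvPolynomial (Fin 2) ℝ) = 1 := by
      rw [← map_ofNat C 2, ← C_mul, ← C_1]; norm_num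
    refine ⟨C (1 / 2) * k₁, C (1 / 2) * k₂, hk₁.C_mul _, hk₂.C_mul _, ?_, ?_⟩
    · have : A * F = A * (a₁ * k₁ + a₂ * k₂) := by
        linear_combination a₁ * e₁ + a₂ * e₂ + F * hAsq
      linear_combination mul_left_cancel₀ hA0 this - (a₁ * k₁ + a₂ * k₂) * h2
    · have : A ^ 2 * B = A ^ 2 * (k₁ ^ 2 + k₂ ^ 2) := by
        linear_combination (a₁ * F - a₂ * E + A * k₁) * e₁ + (a₂ * F + a₁ * E + A * k₂) * e₂ -
          A * heq + (E ^ 2 + F ^ 2) * hAsq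
      linear_combination mul_left_cancel₀ (pow_ne_zero 2 hA0) this -
        (k₁ ^ 2 + k₂ ^ 2) * (C (1 / 2) * 2 + 1) * h2
  have hsum := congrArg (aeval p) heq
  rw [map_mul, hpA, zero_mul, map_add, map_pow, map_pow] at hsum
  have hfac : (aeval p E + Complex.I * aeval p F) * (aeval p E - Complex.I * aeval p F) = 0 := by
    linear_combination hsum - (aeval p F) ^ 2 * Complex.I_sq
  rcases mul_eq_zero.1 hfac with h | h
  · obtain ⟨b₁, b₂, h1, h2, h3, h4⟩ := main E hE heq (by linear_combination h)
    exact ⟨a₁, a₂, b₁, b₂, ⟨ha₁, ha₂, h1, h2⟩, hAsq, h3, h4⟩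
  · obtain ⟨b₁, b₂, h1, h2, h3, h4⟩ := main (-E) hE.neg (by linear_combination heq)
      (by rw [map_neg]; linear_combination -h)
    exact ⟨a₁, a₂, b₁, b₂, ⟨ha₁, ha₂, h1, h2⟩, hAsq, h3, h4⟩

/-- A positive semidefinite binary quadratic polynomial `A z ^ 2 + F z + B / 4` over the forms in
`x, y`, whose discriminant is minus a square, is a sum of two squares. -/
theorem exists_sum_two_squares (hA : A.IsHomogeneous 2) (hA0 : A ≠ 0) (hF : F.IsHomogeneous 3)
    (hE : E.IsHomogeneous 3) (hApsd : IsPSD A) (heq : E ^ 2 + F ^ 2 = A * B) :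
    ∃ a₁ a₂ b₁ b₂ : MvPolynomial (Fin 2) ℝ, (a₁.IsHomogeneous 1 ∧ a₂.IsHomogeneous 1 ∧
      b₁.IsHomogeneous 2 ∧ b₂.IsHomogeneous 2) ∧ A = a₁ ^ 2 + a₂ ^ 2 ∧
      F = 2 * (a₁ * b₁ + a₂ * b₂) ∧ B = 4 * (b₁ ^ 2 + b₂ ^ 2) := by
  by_cases h : ∃ r : Fin 2 → ℝ, r ≠ 0 ∧ eval r A = 0
  · obtain ⟨r, hr, hr0⟩ := h
    exact exists_sum_two_squares_of_real_zero hA hA0 hF hE hApsd heq hr hr0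
  · push Not at h
    exact exists_sum_two_squares_of_isPosDef hA hF hE
      (fun r hr => lt_of_le_of_ne (hApsd r) (h r hr).symm) heq

end

/-- `f` is a sum of three squares of quadratic forms. -/
def IsSumThreeSq (f : MvPolynomial (Fin 3) ℝ) : Prop :=
  ∃ p : Fin 3 → MvPolynomial (Fin 3) ℝ, (∀ i, (p i).IsHomogeneous 2) ∧ f = ∑ i, p i ^ 2

/-- `f` is the sum of `(z ^ 2 + ξ / 2) ^ 2` and of the quadratic polynomial `(f₂ - ξ) z ^ 2 + f₃
z + (4 f₄ - ξ ^ 2) / 4` in `z`, whose discriminant is `-η ^ 2` for a solution of `C_1`. -/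
theorem isSumThreeSq_of_isSolution_one {f₂ f₃ f₄ : MvPolynomial (Fin 2) ℝ}
    (h : AreForms f₂ f₃ f₄) (h₃ : f₃ ≠ 0)
    {s : MvPolynomial (Fin 2) ℝ × MvPolynomial (Fin 2) ℝ} (hs : IsSolution f₂ f₃ f₄ 1 s) :
    IsSumThreeSq (normalQuartic f₂ f₃ f₄) := by
  have hA0 : f₂ - C 1 * s.1 ≠ 0 := by
    intro h0
    have heq := hs.eq
    rw [h0, zero_mul] at heq
    apply h₃
    apply MvPolynomial.funext
    intro r
    have := congrArg (eval r) heq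
    rw [map_add, map_pow, map_pow, map_zero] at this
    rw [map_zero]
    nlinarith [sq_nonneg (eval r s.2), sq_nonneg (eval r f₃)]
  obtain ⟨a₁, a₂, b₁, b₂, ⟨ha₁, ha₂, hb₁, hb₂⟩, hA, hF, hB⟩ :=
    exists_sum_two_squares (h.hom₂.sub (hs.hom_xi.C_mul 1)) hA0 h.hom₃ hs.hom_eta hs.psd_left hs.eq
  have hlift : ∀ {m : ℕ} {F : MvPolynomial (Fin 2) ℝ}, F.IsHomogeneous m →
      (lift F).IsHomogeneous m := fun hF => hF.rename_isHomogeneous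
  have hX := isHomogeneous_X ℝ (2 : Fin 3)
  have h2 : (C (1 / 2 : ℝ) * 2 : MvPolynomial (Fin 3) ℝ) = 1 := by
    rw [← map_ofNat C 2, ← C_mul, ← C_1]; norm_num
  refine ⟨![X 2 ^ 2 + C (1 / 2) * lift s.1, lift a₁ * X 2 + lift b₁, lift a₂ * X 2 + lift b₂],
    ?_, ?_⟩
  · intro i
    fin_cases i
    · exact (hX.pow 2).add ((hlift hs.hom_xi).C_mul _)
    · exact ((hlift ha₁).mul hX).add (hlift hb₁)
    · exact ((hlift ha₂).mul hX).add (hlift hb₂)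
  · have e2 := congrArg lift hA
    have e3 := congrArg lift hF
    have e4 := congrArg lift hB
    simp only [lift, map_add, map_sub, map_mul, map_pow, map_ofNat, one_mul, map_one] at e2 e3 e4
    simp only [Fin.sum_univ_three, Matrix.cons_val_zero, Matrix.cons_val_one, Matrix.cons_val,
      normalQuartic, lift]
    have h4 : (C (1 / 2 : ℝ) ^ 2 * 4 : MvPolynomial (Fin 3) ℝ) = 1 := by
      linear_combination (C (1 / 2) * 2 + 1) * h2
    linear_combination X 2 ^ 2 * e2 + X 2 * e3 + C (1 / 2) ^ 2 * e4 -
      X 2 ^ 2 * (rename Fin.castSucc s.1) * h2 +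
      (rename Fin.castSucc b₁ ^ 2 + rename Fin.castSucc b₂ ^ 2 - rename Fin.castSucc f₄) * h4

/-! ### Symmetric functions of the zeros of a binary form -/

section

variable {σ : Type*} {m : ℕ}

/-- The coefficients of the binary form `∏ i, (bᵢ x - aᵢ y)` with zeros `pᵢ = (aᵢ, bᵢ)`. -/
noncomputable def zerosCoeff (p : Fin m → ℂ × ℂ) (k : Fin (m + 1)) : ℂ :=
  (∏ i, (Polynomial.C (p i).2 * Polynomial.X - Polynomial.C (p i).1)).coeff k

theorem zerosCoeff_last (p : Fin m → ℂ × ℂ) : zerosCoeff p (Fin.last m) = ∏ i, (p i).2 := by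
  have h := Polynomial.coeff_prod_of_natDegree_le
    Finset.univ (fun i => Polynomial.C (p i).2 * Polynomial.X - Polynomial.C (p i).1) 1
    (fun i _ => by compute_degree)
  simp only [Finset.card_univ, Fintype.card_fin, mul_one] at h
  rw [zerosCoeff, Fin.val_last, h]
  simp

theorem continuous_zerosCoeff (k : Fin (m + 1)) :
    Continuous fun p : Fin m → ℂ × ℂ => zerosCoeff p k := by
  classical
  have h : ∀ (t : Finset (Fin m)) (k : ℕ), Continuous fun p : Fin m → ℂ × ℂ =>
      (∏ i ∈ t, (Polynomial.C (p i).2 * Polynomial.X - Polynomial.C (p i).1)).coeff k := by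
    intro t
    induction t using Finset.induction_on with
    | empty => intro k; simpa using continuous_const
    | insert i t hi ih =>
      intro k
      simp_rw [Finset.prod_insert hi, Polynomial.coeff_mul]
      refine continuous_finsetSum _ fun x _ => Continuous.mul ?_ (ih _)
      simp_rw [Polynomial.coeff_sub, Polynomial.coeff_C_mul, Polynomial.coeff_C]
      refine ((continuous_snd.comp (continuous_apply i)).mul continuous_const).sub ?_
      split_ifs
      · exact continuous_fst.comp (continuous_apply i)
      · exact continuous_const
  exact h _ _

theorem zerosCoeff_smul (t : Fin m → ℂ) (p : Fin m → ℂ × ℂ) :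
    zerosCoeff (fun i => t i • p i) = (∏ i, t i) • zerosCoeff p := by
  funext k
  have h : ∀ i, Polynomial.C (t i • p i).2 * Polynomial.X - Polynomial.C (t i • p i).1 =
      Polynomial.C (t i) * (Polynomial.C (p i).2 * Polynomial.X - Polynomial.C (p i).1) := by
    intro i
    simp only [Prod.smul_snd, Prod.smul_fst, smul_eq_mul, Polynomial.C_mul]
    ring
  simp only [zerosCoeff, h, Finset.prod_mul_distrib, ← map_prod, Polynomial.coeff_C_mul,
    Pi.smul_apply, smul_eq_mul]

/-- The list of zeros `(α, 1)` for the roots `α` of `q`, filled up with `(-1, 0)`, as a family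
indexed by `Fin m`. The product of the linear forms attached to it is `q` up to the leading
coefficient. -/
theorem exists_ofFn_eq_zeros {q : ℂ[X]} (hq : q.natDegree ≤ m) :
    ∃ p : Fin m → ℂ × ℂ, List.ofFn p = q.roots.toList.map (fun α => (α, (1 : ℂ))) ++
      List.replicate (m - q.natDegree) (-1, 0) ∧
      q.leadingCoeff • zerosCoeff p = fun k : Fin (m + 1) => q.coeff k := by
  have hcard : q.roots.card = q.natDegree :=
    Polynomial.splits_iff_card_roots.1 (IsAlgClosed.splits q)
  set L := q.roots.toList.map (fun α => (α, (1 : ℂ))) ++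
      List.replicate (m - q.natDegree) (-1, 0) with hL
  have hlen : L.length = m := by
    simp only [hL, List.length_append, List.length_map, Multiset.length_toList, hcard,
      List.length_replicate]
    omega
  refine ⟨fun i => L.get (i.cast hlen.symm), ?_, ?_⟩
  · refine List.ext_get (by simp [hlen]) fun i h1 h2 => ?_
    simp
  · funext k
    have h1 : ∏ i : Fin m, (Polynomial.C (L.get (i.cast hlen.symm)).2 * Polynomial.X -
        Polynomial.C (L.get (i.cast hlen.symm)).1) =
        (L.map fun x => Polynomial.C x.2 * Polynomial.X - Polynomial.C x.1).prod := by
      rw [← List.prod_ofFn]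
      congr 1
      refine List.ext_get (by simp [hlen]) fun i h1 h2 => ?_
      simp
    have h2 : (L.map fun x => Polynomial.C x.2 * Polynomial.X - Polynomial.C x.1).prod =
        (q.roots.map fun a => Polynomial.X - Polynomial.C a).prod := by
      rw [hL, List.map_append, List.prod_append, List.map_map, List.map_replicate]
      simp only [Function.comp_def, map_one, one_mul, map_zero, zero_mul, map_neg, sub_neg_eq_add,
        zero_add, List.prod_replicate, one_pow, mul_one]
      rw [← Multiset.prod_coe, ← Multiset.map_coe, Multiset.coe_toList]
    have h3 := (IsAlgClosed.splits q).eq_prod_roots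
    rw [Pi.smul_apply, zerosCoeff, h1, h2, smul_eq_mul, ← Polynomial.coeff_C_mul, ← h3]

theorem prod_ite_fin_zero {n : ℕ} (a : ℂ) : ∏ i : Fin (n + 1), (if i = 0 then a else 1) = a := by
  simp

/-- Every binary form has zeros. -/
theorem exists_zerosCoeff_eq (hm : m ≠ 0) (c : Fin (m + 1) → ℂ) :
    ∃ p : Fin m → ℂ × ℂ, zerosCoeff p = c := by
  obtain ⟨n, rfl⟩ := Nat.exists_eq_succ_of_ne_zero hm
  set q : ℂ[X] := ∑ i : Fin (n + 1 + 1), Polynomial.C (c i) * Polynomial.X ^ (i : ℕ) with hq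
  have hd : q.natDegree ≤ n + 1 := Polynomial.natDegree_sum_le_of_forall_le _ _ fun i _ =>
    (Polynomial.natDegree_C_mul_X_pow_le _ _).trans (by omega)
  obtain ⟨p, -, hp⟩ := exists_ofFn_eq_zeros hd
  -- the leading coefficient is absorbed into the homogeneous coordinates of one of the zeros
  refine ⟨fun i => (if i = 0 then q.leadingCoeff else 1) • p i, ?_⟩
  rw [zerosCoeff_smul, prod_ite_fin_zero, hp]
  funext k
  rw [hq, Polynomial.finsetSum_coeff, Finset.sum_eq_single k]
  · simp
  · intro j _ hj
    rw [Polynomial.coeff_C_mul_X_pow, if_neg (fun h => hj (Fin.ext h.symm))]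
  · simp

theorem dense_snd_ne_zero : Dense {p : Fin m → ℂ × ℂ | ∀ i, (p i).2 ≠ 0} := by
  have h : {p : Fin m → ℂ × ℂ | ∀ i, (p i).2 ≠ 0} =
      Set.pi Set.univ fun _ => (Set.univ : Set ℂ) ×ˢ {(0 : ℂ)}ᶜ := by
    ext p
    simp
  rw [h]
  exact dense_pi _ fun i _ => dense_univ.prod (dense_compl_singleton 0)

/-- A polynomial in quotients `λᵢ / c`, with `λᵢ` and `c` polynomials, becomes a polynomial after
multiplication by a power of `c`. -/
theorem exists_homogenization {τ ι : Type*} (a : MvPolynomial σ ℂ →+* MvPolynomial τ ℂ)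
    (l : ι → MvPolynomial τ ℂ) (c : MvPolynomial τ ℂ) (T : MvPolynomial ι (MvPolynomial σ ℂ)) :
    ∃ (N : ℕ) (Θ : MvPolynomial τ ℂ), ∀ w : τ → ℂ, eval w c ≠ 0 →
      eval₂ ((eval w).comp a) (fun i => eval w (l i) / eval w c) T * eval w c ^ N = eval w Θ := by
  induction T using MvPolynomial.induction_on with
  | C r => exact ⟨0, a r, fun w hw => by simp⟩
  | add p q hp hq =>
    obtain ⟨N₁, Θ₁, h₁⟩ := hp
    obtain ⟨N₂, Θ₂, h₂⟩ := hq
    refine ⟨N₁ + N₂, Θ₁ * c ^ N₂ + Θ₂ * c ^ N₁, fun w hw => ?_⟩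
    rw [eval₂_add, map_add, map_mul, map_mul, map_pow, map_pow, ← h₁ w hw, ← h₂ w hw]
    ring
  | mul_X p i hp =>
    obtain ⟨N, Θ, h⟩ := hp
    refine ⟨N + 1, Θ * l i, fun w hw => ?_⟩
    rw [eval₂_mul, eval₂_X, map_mul, ← h w hw, pow_succ]
    field_simp

/-- A polynomial over an infinite field which vanishes on a coordinate hyperplane is divisible by
the coordinate. -/
theorem X_dvd_of_eval_eq_zero {K τ : Type*} [Field K] [Infinite K] [DecidableEq τ] {i : τ}
    {Θ : MvPolynomial τ K} (h : ∀ w : τ → K, w i = 0 → eval w Θ = 0) : X i ∣ Θ := by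
  have h1 : ∀ q : MvPolynomial τ K,
      X i ∣ q - aeval (fun j => if j = i then (0 : MvPolynomial τ K) else X j) q := by
    intro q
    induction q using MvPolynomial.induction_on with
    | C r => simp
    | add p q hp hq =>
      rw [map_add, add_sub_add_comm]
      exact dvd_add hp hq
    | mul_X p j hp =>
      rw [map_mul, aeval_X]
      split_ifs with hj
      · subst hj
        simp
      · rw [← sub_mul]
        exact hp.mul_right _
  have h2 : aeval (fun j => if j = i then (0 : MvPolynomial τ K) else X j) Θ = 0 := by
    apply MvPolynomial.funext
    intro w
    have : eval w (aeval (fun j => if j = i then (0 : MvPolynomial τ K) else X j) Θ) =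
        eval (fun j => if j = i then 0 else w j) Θ := by
      rw [← MvPolynomial.coe_aeval_eq_eval, ← MvPolynomial.coe_aeval_eq_eval,
        RingHom.coe_coe, RingHom.coe_coe, ← AlgHom.comp_apply, comp_aeval]
      congr 2
      ext j
      split_ifs <;> simp
    rw [this, map_zero]
    exact h _ (by simp)
  have h3 := h1 Θ
  rwa [h2, sub_zero] at h3

/-- A function of the zeros of a binary form of degree `m` which is continuous, symmetric,
polynomial in the affine coordinates of the zeros and homogeneous in the homogeneous coordinates
is a polynomial in the coefficients of the form. -/
theorem exists_eval_zerosCoeff (hm : m ≠ 0) {d : ℕ} (S : (σ → ℂ) → (Fin m → ℂ × ℂ) → ℂ)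
    (s : MvPolynomial (Fin m) (MvPolynomial σ ℂ))
    (hs : ∀ v α, S v (fun i => (α i, 1)) = eval₂ (eval v) α s)
    (hsymm : ∀ v p (π : Equiv.Perm (Fin m)), S v (p ∘ π) = S v p)
    (hsmul : ∀ v (t : Fin m → ℂ) p, S v (fun i => t i • p i) = (∏ i, t i) ^ d * S v p)
    (hcont : ∀ v, Continuous (S v)) :
    ∃ Θ : MvPolynomial (σ ⊕ Fin (m + 1)) ℂ,
      ∀ v p, S v p = eval (Sum.elim v (zerosCoeff p)) Θ := by
  classical
  -- by continuity, an identity for finite zeros extends to zeros at infinity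
  have hext : ∀ N (Θ : MvPolynomial (σ ⊕ Fin (m + 1)) ℂ), (∀ v p, (∀ i, (p i).2 ≠ 0) →
      S v p * zerosCoeff p (Fin.last m) ^ N = eval (Sum.elim v (zerosCoeff p)) Θ) →
      ∀ v p, S v p * zerosCoeff p (Fin.last m) ^ N = eval (Sum.elim v (zerosCoeff p)) Θ := by
    intro N Θ h v
    refine fun p => congrFun (Continuous.ext_on dense_snd_ne_zero ?_ ?_ fun p hp => h v p hp) p
    · exact (hcont v).mul ((continuous_zerosCoeff _).pow _)
    · refine Θ.continuous_eval.comp (continuous_pi fun i => ?_)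
      rcases i with i | i
      · exact continuous_const
      · exact continuous_zerosCoeff i
  -- it suffices to treat the case of no zeros at infinity
  suffices H : ∃ Θ : MvPolynomial (σ ⊕ Fin (m + 1)) ℂ, ∀ v p, (∀ i, (p i).2 ≠ 0) →
      S v p * zerosCoeff p (Fin.last m) ^ 0 = eval (Sum.elim v (zerosCoeff p)) Θ by
    obtain ⟨Θ, hΘ⟩ := H
    refine ⟨Θ, fun v p => ?_⟩
    have h := hext 0 Θ hΘ v p
    rwa [pow_zero, mul_one] at h
  -- It also suffices to do so up to a power of the leading coefficient `c`: if `c * S` is a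
  -- polynomial `Θ` in the coefficients, then `Θ` vanishes for `c = 0`, because every binary form
  -- has zeros, and is therefore divisible by `c`.
  suffices H : ∃ N, ∃ Θ : MvPolynomial (σ ⊕ Fin (m + 1)) ℂ, ∀ v p, (∀ i, (p i).2 ≠ 0) →
      S v p * zerosCoeff p (Fin.last m) ^ N = eval (Sum.elim v (zerosCoeff p)) Θ by
    obtain ⟨N, hN⟩ := H
    induction N with
    | zero => exact hN
    | succ N ih =>
      obtain ⟨Θ, hΘ⟩ := hN
      obtain ⟨Θ', rfl⟩ : X (Sum.inr (Fin.last m)) ∣ Θ := by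
        refine X_dvd_of_eval_eq_zero fun w hw => ?_
        obtain ⟨p, hp⟩ := exists_zerosCoeff_eq hm (w ∘ Sum.inr)
        have h := hext _ _ hΘ (w ∘ Sum.inl) p
        have h0 : zerosCoeff p (Fin.last m) = 0 := by rw [hp]; exact hw
        rw [h0, pow_succ, mul_zero, mul_zero, hp, Sum.elim_comp_inl_inr] at h
        exact h.symm
      refine ih ⟨Θ', fun v p hp => ?_⟩
      have h := hΘ v p hp
      have h0 : zerosCoeff p (Fin.last m) ≠ 0 := by
        rw [zerosCoeff_last]
        exact Finset.prod_ne_zero_iff.2 fun i _ => hp i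
      rw [map_mul, eval_X, Sum.elim_inr] at h
      apply mul_left_cancel₀ h0
      rw [← h]
      ring
  -- `s` is a polynomial in the elementary symmetric functions, which are quotients of coefficients
  have hssymm : s ∈ symmetricSubalgebra (Fin m) (MvPolynomial σ ℂ) := by
    rw [mem_symmetricSubalgebra]
    intro π
    have h : ∀ v, map (eval v) (rename π s) = map (eval v) s := by
      intro v
      apply MvPolynomial.funext
      intro α
      rw [eval_map, eval_map, eval₂_rename, ← hs, ← hs, ← hsymm v (fun i => (α i, 1)) π]
      rfl
    ext1 e
    apply MvPolynomial.funext
    intro v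
    rw [← coeff_map, ← coeff_map, h v]
  obtain ⟨T, hT⟩ := esymmAlgHom_surjective (σ := Fin m) (n := m) (MvPolynomial σ ℂ)
    (by simp) ⟨s, hssymm⟩
  obtain ⟨N, Θ, hΘ⟩ := exists_homogenization (τ := σ ⊕ Fin (m + 1)) (ι := Fin m)
    (rename Sum.inl : MvPolynomial σ ℂ →ₐ[ℂ] _).toRingHom
    (fun i => C ((-1) ^ ((i : ℕ) + 1)) * X (Sum.inr i.rev.castSucc)) (X (Sum.inr (Fin.last m))) T
  refine ⟨N, Θ * X (Sum.inr (Fin.last m)) ^ d, fun v p hp => ?_⟩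
  set α : Fin m → ℂ := fun i => (p i).1 / (p i).2 with hα
  have hp' : p = fun i => (p i).2 • (α i, (1 : ℂ)) := by
    funext i
    refine Prod.ext ?_ ?_
    · simp [hα, mul_div_cancel₀ _ (hp i)]
    · simp
  have h0 : zerosCoeff p (Fin.last m) ≠ 0 := by
    rw [zerosCoeff_last]
    exact Finset.prod_ne_zero_iff.2 fun i _ => hp i
  have hS : S v p = zerosCoeff p (Fin.last m) ^ d * eval₂ (eval v) α s := by
    rw [← hs, zerosCoeff_last, ← hsmul, ← hp']
  have hTs : eval₂ (eval v) α s = eval₂ (eval v) (fun i : Fin m => eval₂ (eval v) α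
      (esymm (Fin m) (MvPolynomial σ ℂ) (i + 1))) T := by
    have h1 : s = aeval (fun i : Fin m => esymm (Fin m) (MvPolynomial σ ℂ) (i + 1)) T := by
      rw [← esymmAlgHom_apply, hT]
    have h2 : ∀ r, eval₂ (eval v) α r = eval₂Hom (eval v) α r := fun r => rfl
    have h3 : (eval₂Hom (eval v) α).comp
        (algebraMap (MvPolynomial σ ℂ) (MvPolynomial (Fin m) (MvPolynomial σ ℂ))) = eval v := by
      ext r
      · simp
      · simp
    rw [h1, h2, map_aeval, h3]
    rfl
  have hes : ∀ i : Fin m, eval₂ (eval v) α (esymm (Fin m) (MvPolynomial σ ℂ) (i + 1)) =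
      (-1) ^ ((i : ℕ) + 1) * zerosCoeff p i.rev.castSucc / zerosCoeff p (Fin.last m) := by
    intro i
    have hp2 : zerosCoeff p = zerosCoeff p (Fin.last m) • zerosCoeff fun i => (α i, (1 : ℂ)) := by
      rw [zerosCoeff_last, ← zerosCoeff_smul, ← hp']
    have h1 : zerosCoeff p i.rev.castSucc = zerosCoeff p (Fin.last m) *
        (zerosCoeff (fun i => (α i, (1 : ℂ))) i.rev.castSucc) := by
      conv_lhs => rw [hp2]
      rfl
    have h2 := Multiset.prod_X_sub_C_coeff (Finset.univ.val.map α)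
      (k := (i.rev.castSucc : ℕ)) (by simp)
    have h3 : (Multiset.card (Finset.univ.val.map α)) - (i.rev.castSucc : ℕ) = i + 1 := by
      simp [Fin.val_rev]; omega
    rw [h3, Multiset.map_map] at h2
    have h4 : zerosCoeff (fun i => (α i, (1 : ℂ))) i.rev.castSucc =
        (-1) ^ ((i : ℕ) + 1) * (Finset.univ.val.map α).esymm (i + 1) := by
      rw [← h2, zerosCoeff]
      simp [Finset.prod]
    rw [← eval_map, map_esymm, ← coe_aeval_eq_eval, RingHom.coe_coe,
      aeval_esymm_eq_multiset_esymm, h1, h4, eq_div_iff h0]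
    have h5 : ((-1 : ℂ) ^ ((i : ℕ) + 1)) * (-1) ^ ((i : ℕ) + 1) = 1 := by
      rw [← mul_pow]; simp
    linear_combination -(zerosCoeff p (Fin.last m) * (Finset.univ.val.map α).esymm (i + 1)) * h5
  have h := hΘ (Sum.elim v (zerosCoeff p)) (by simpa using h0)
  simp only [map_mul, map_pow, eval_X, Sum.elim_inr, eval_C] at h ⊢
  rw [← h, hS, hTs]
  simp_rw [hes]
  have hc : (eval (Sum.elim v (zerosCoeff p))).comp
      (rename Sum.inl : MvPolynomial σ ℂ →ₐ[ℂ] _).toRingHom = eval v := by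
    ext r
    · simp
    · simp
  rw [hc]
  ring

end

section

variable {σ : Type*}

theorem pairProd_perm {B : ℂ × ℂ → ℂ × ℂ → ℂ} (hB : ∀ p q, B p q = B q p) {l l' : List (ℂ × ℂ)}
    (h : l.Perm l') : pairProd B l = pairProd B l' := by
  induction h with
  | nil => rfl
  | cons x h ih => rw [pairProd, pairProd, ih, (h.map (B x)).prod_eq]
  | swap x y l =>
    simp only [pairProd, List.map_cons, List.prod_cons, hB y x]
    ring
  | trans _ _ ih₁ ih₂ => exact ih₁.trans ih₂

theorem pairProd_ofFn (B : ℂ × ℂ → ℂ × ℂ → ℂ) {m : ℕ} (p : Fin m → ℂ × ℂ) :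
    pairProd B (List.ofFn p) = ∏ i, ∏ j ∈ Finset.Ioi i, B (p i) (p j) := by
  induction m with
  | zero => simp [pairProd]
  | succ m ih =>
    rw [List.ofFn_succ, pairProd, ih, Fin.prod_univ_succ, Fin.prod_Ioi_zero, List.map_ofFn,
      List.prod_ofFn]
    simp [Fin.prod_Ioi_succ]

theorem prod_prod_Ioi_mul {m : ℕ} (t : Fin m → ℂ) :
    ∏ i, ∏ j ∈ Finset.Ioi i, t i * t j = (∏ i, t i) ^ (m - 1) := by
  induction m with
  | zero => simp
  | succ m ih =>
    rw [Fin.prod_univ_succ, Fin.prod_Ioi_zero, Fin.prod_univ_succ]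
    simp only [Fin.prod_Ioi_succ, ih fun i => t i.succ]
    rw [Finset.prod_mul_distrib, Finset.prod_const, Finset.card_univ, Fintype.card_fin,
      Nat.add_sub_cancel, mul_pow, mul_assoc]
    cases m with
    | zero => simp
    | succ m => rw [← pow_succ', Nat.add_sub_cancel]

/-- `∏ i < j, B(pᵢ, pⱼ)`, taken over the zeros of a binary form of degree `m` and normalized by a
power of the leading coefficient, is a polynomial in the coefficients. -/
theorem exists_eval_pairProd {m : ℕ} (hm : m ≠ 0) {e : ℕ}
    (B : (σ → ℂ) → ℂ × ℂ → ℂ × ℂ → ℂ) (b : MvPolynomial (Fin 2) (MvPolynomial σ ℂ))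
    (hb : ∀ v x y, B v (x, 1) (y, 1) = eval₂ (eval v) ![x, y] b)
    (hsymm : ∀ v p q, B v p q = B v q p)
    (hsmul : ∀ v (t : ℂ) p q, B v (t • p) q = t ^ e * B v p q)
    (hcont : ∀ v, Continuous fun x : (ℂ × ℂ) × (ℂ × ℂ) => B v x.1 x.2) :
    ∃ Θ : MvPolynomial (σ ⊕ Fin (m + 1)) ℂ, ∀ v (q : ℂ[X]), q.natDegree ≤ m →
      q.leadingCoeff ^ (e * (m - 1)) * pairProd (B v) (q.roots.toList.map (fun α => (α, (1 : ℂ))) ++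
        List.replicate (m - q.natDegree) (-1, 0)) =
      eval (Sum.elim v fun k : Fin (m + 1) => q.coeff k) Θ := by
  have hsm : ∀ v (t : Fin m → ℂ) p, pairProd (B v) (List.ofFn fun i => t i • p i) =
      (∏ i, t i) ^ (e * (m - 1)) * pairProd (B v) (List.ofFn p) := by
    intro v t p
    rw [pairProd_ofFn, pairProd_ofFn, mul_comm e, pow_mul, ← prod_prod_Ioi_mul,
      ← Finset.prod_pow, ← Finset.prod_mul_distrib]
    refine Finset.prod_congr rfl fun i _ => ?_
    rw [← Finset.prod_pow, ← Finset.prod_mul_distrib]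
    refine Finset.prod_congr rfl fun j _ => ?_
    rw [hsmul, hsymm, hsmul, hsymm]
    ring
  obtain ⟨Θ, hΘ⟩ := exists_eval_zerosCoeff hm (d := e * (m - 1))
    (fun v p => pairProd (B v) (List.ofFn p))
    (∏ i, ∏ j ∈ Finset.Ioi i, rename ![i, j] b) (by
      intro v α
      have h : ∀ r, eval₂ (eval v) α r = eval₂Hom (eval v) α r := fun r => rfl
      rw [pairProd_ofFn, h, map_prod]
      refine Finset.prod_congr rfl fun i _ => ?_
      rw [map_prod]
      refine Finset.prod_congr rfl fun j _ => ?_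
      rw [hb, ← h, eval₂_rename]
      congr 1
      ext k
      fin_cases k <;> rfl)
    (fun v p π => pairProd_perm (hsymm v) (π.ofFn_comp_perm p))
    hsm (by
      intro v
      simp only [pairProd_ofFn]
      refine continuous_finsetProd _ fun i _ => continuous_finsetProd _ fun j _ => ?_
      have hij : Continuous fun p : Fin m → ℂ × ℂ => (p i, p j) := by fun_prop
      exact (hcont v).comp hij)
  refine ⟨Θ, fun v q hq => ?_⟩
  obtain ⟨n, rfl⟩ := Nat.exists_eq_succ_of_ne_zero hm
  obtain ⟨p, hp, hc⟩ := exists_ofFn_eq_zeros hq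
  have h := hΘ v (fun i => (if i = 0 then q.leadingCoeff else 1) • p i)
  rw [hsm, prod_ite_fin_zero, zerosCoeff_smul, prod_ite_fin_zero, hc] at h
  rw [← h, hp]

/-- The discriminant is a polynomial in the coefficients. -/
theorem exists_eval_disc {m : ℕ} (hm : m ≠ 0) : ∃ Θ : MvPolynomial (Empty ⊕ Fin (m + 1)) ℂ,
    ∀ F, (dehom F).natDegree ≤ m →
      disc m F = eval (Sum.elim Empty.elim fun k : Fin (m + 1) => (dehom F).coeff k) Θ := by
  obtain ⟨Θ, hΘ⟩ := exists_eval_pairProd (σ := Empty) hm (e := 2)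
    (fun _ p q => (p.1 * q.2 - q.1 * p.2) ^ 2) ((X 0 - X 1) ^ 2) (by intro v x y; simp)
    (by intro v p q; ring) (by intro v t p q; simp; ring) (by intro v; fun_prop)
  refine ⟨Θ, fun F hF => ?_⟩
  rw [← hΘ _ _ hF, disc, projZeros, Nat.mul_sub]

/-- The invariant `Φ` is a polynomial in the coefficients. -/
theorem exists_eval_phiInv {m : ℕ} (n : ℕ) (hm : m ≠ 0) :
    ∃ Θ : MvPolynomial ((ℕ ⊕ ℕ) ⊕ Fin (m + 1)) ℂ, ∀ F G H, (dehom F).natDegree ≤ m →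
      phiInv m n F G H = eval (Sum.elim (Sum.elim (dehom G).coeff (dehom H).coeff)
        fun k : Fin (m + 1) => (dehom F).coeff k) Θ := by
  obtain ⟨Θ, hΘ⟩ := exists_eval_pairProd (σ := ℕ ⊕ ℕ) hm (e := n - 1)
    (fun v => bezoutianOf n (v ∘ Sum.inl) (v ∘ Sum.inr))
    (∑ k ∈ Finset.range (n + 1), ∑ j ∈ Finset.range k,
      C (X (Sum.inl k) * X (Sum.inr j) - X (Sum.inl j) * X (Sum.inr k)) *
      ∑ l ∈ Finset.range (k - j), X 0 ^ (j + l) * X 1 ^ (k - 1 - l))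
    (by intro v x y; simp [bezoutianOf, eval₂_sum, eval₂_mul, eval₂_pow])
    (fun v => bezoutianOf_symm n _ _) (by
      intro v t p q
      simp only [bezoutianOf, Finset.mul_sum]
      refine Finset.sum_congr rfl fun k hk => Finset.sum_congr rfl fun j hj =>
        Finset.sum_congr rfl fun l hl => ?_
      have hk' := Finset.mem_range.1 hk
      have hj' := Finset.mem_range.1 hj
      have hl' := Finset.mem_range.1 hl
      have e1 : t ^ (n - 1) = t ^ (j + l) * t ^ (n - 1 - (j + l)) := by
        rw [← pow_add]; congr 1; omega
      rw [e1]
      simp only [Prod.smul_fst, Prod.smul_snd, smul_eq_mul, mul_pow]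
      ring) (by intro v; unfold bezoutianOf; fun_prop)
  refine ⟨Θ, fun F G H hF => ?_⟩
  rw [← hΘ _ _ hF, phiInv, projZeros, mul_comm (m - 1)]
  rfl

end

/-! ### Polynomial functions of the twelve coefficients -/

/-- The indices of the twelve coefficients of `f₂, f₃, f₄`. -/
abbrev CoeffIndex : Type := Fin 3 ⊕ Fin 4 ⊕ Fin 5

/-- A real polynomial function of the twelve coefficients. -/
def IsPolyFun (φ : (CoeffIndex → ℝ) → ℝ) : Prop :=
  ∃ P : MvPolynomial CoeffIndex ℝ, ∀ w, φ w = eval w P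

/-- A complex-valued function of the twelve coefficients whose real and imaginary parts are
polynomial. -/
def IsPolyFunC (φ : (CoeffIndex → ℝ) → ℂ) : Prop :=
  IsPolyFun (fun w => (φ w).re) ∧ IsPolyFun fun w => (φ w).im

/-- A family of univariate polynomials whose coefficients are polynomial functions. -/
def IsPolyFamily (u : (CoeffIndex → ℝ) → ℝ[X]) : Prop :=
  ∀ k, IsPolyFun fun w => (u w).coeff k

namespace IsPolyFun

theorem const (r : ℝ) : IsPolyFun fun _ => r := ⟨C r, by simp⟩

theorem coord (i : CoeffIndex) : IsPolyFun fun w => w i := ⟨X i, by simp⟩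

variable {φ ψ : (CoeffIndex → ℝ) → ℝ}

theorem add (hφ : IsPolyFun φ) (hψ : IsPolyFun ψ) : IsPolyFun fun w => φ w + ψ w := by
  obtain ⟨P, hP⟩ := hφ
  obtain ⟨Q, hQ⟩ := hψ
  exact ⟨P + Q, fun w => by simp only [hP, hQ, map_add]⟩

theorem mul (hφ : IsPolyFun φ) (hψ : IsPolyFun ψ) : IsPolyFun fun w => φ w * ψ w := by
  obtain ⟨P, hP⟩ := hφ
  obtain ⟨Q, hQ⟩ := hψ
  exact ⟨P * Q, fun w => by simp only [hP, hQ, map_mul]⟩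

theorem sub (hφ : IsPolyFun φ) (hψ : IsPolyFun ψ) : IsPolyFun fun w => φ w - ψ w := by
  obtain ⟨P, hP⟩ := hφ
  obtain ⟨Q, hQ⟩ := hψ
  exact ⟨P - Q, fun w => by simp only [hP, hQ, map_sub]⟩

theorem sum {ι : Type*} {s : Finset ι} {φ : ι → (CoeffIndex → ℝ) → ℝ}
    (h : ∀ i, IsPolyFun (φ i)) : IsPolyFun fun w => ∑ i ∈ s, φ i w := by
  choose P hP using h
  exact ⟨∑ i ∈ s, P i, fun w => by rw [map_sum]; exact Finset.sum_congr rfl fun i _ => hP i w⟩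

theorem prod {ι : Type*} {s : Finset ι} {φ : ι → (CoeffIndex → ℝ) → ℝ}
    (h : ∀ i, IsPolyFun (φ i)) : IsPolyFun fun w => ∏ i ∈ s, φ i w := by
  choose P hP using h
  exact ⟨∏ i ∈ s, P i, fun w => by rw [map_prod]; exact Finset.prod_congr rfl fun i _ => hP i w⟩

theorem det {n : ℕ} {M : (CoeffIndex → ℝ) → Matrix (Fin n) (Fin n) ℝ}
    (h : ∀ i j, IsPolyFun fun w => M w i j) : IsPolyFun fun w => (M w).det := by
  simp only [Matrix.det_apply']
  exact sum fun π => (const _).mul (prod fun i => h _ _)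

theorem resultant {u v : (CoeffIndex → ℝ) → ℝ[X]} (hu : IsPolyFamily u) (hv : IsPolyFamily v)
    (m n : ℕ) : IsPolyFun fun w => Polynomial.resultant (u w) (v w) m n := by
  unfold Polynomial.resultant
  refine det fun i j => ?_
  simp only [Polynomial.sylvester, Matrix.of_apply]
  induction j using Fin.addCases with
  | left j =>
    simp only [Fin.addCases_left]
    split_ifs
    · exact hv _
    · exact const 0
  | right j =>
    simp only [Fin.addCases_right]
    split_ifs
    · exact hu _
    · exact const 0

theorem ofReal (hφ : IsPolyFun φ) : IsPolyFunC fun w => (φ w : ℂ) :=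
  ⟨hφ, by simpa using const 0⟩

end IsPolyFun

namespace IsPolyFunC

theorem const (c : ℂ) : IsPolyFunC fun _ => c := ⟨.const _, .const _⟩

variable {φ ψ : (CoeffIndex → ℝ) → ℂ}

theorem add (hφ : IsPolyFunC φ) (hψ : IsPolyFunC ψ) : IsPolyFunC fun w => φ w + ψ w :=
  ⟨hφ.1.add hψ.1, hφ.2.add hψ.2⟩

theorem mul (hφ : IsPolyFunC φ) (hψ : IsPolyFunC ψ) : IsPolyFunC fun w => φ w * ψ w :=
  ⟨(hφ.1.mul hψ.1).sub (hφ.2.mul hψ.2), (hφ.1.mul hψ.2).add (hφ.2.mul hψ.1)⟩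

theorem eval {τ : Type*} {φ : (CoeffIndex → ℝ) → τ → ℂ} (h : ∀ i, IsPolyFunC fun w => φ w i)
    (Θ : MvPolynomial τ ℂ) : IsPolyFunC fun w => MvPolynomial.eval (φ w) Θ := by
  induction Θ using MvPolynomial.induction_on with
  | C r => simpa using const r
  | add p q hp hq => simpa using hp.add hq
  | mul_X p i hp => simpa using hp.mul (h i)

/-- The real polynomial is the square of the absolute value. -/
theorem exists_eval_ne_zero_iff (hφ : IsPolyFunC φ) :
    ∃ Ψ : MvPolynomial CoeffIndex ℝ, ∀ w, MvPolynomial.eval w Ψ ≠ 0 ↔ φ w ≠ 0 := by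
  obtain ⟨Ψ, hΨ⟩ := (hφ.1.mul hφ.1).add (hφ.2.mul hφ.2)
  refine ⟨Ψ, fun w => ?_⟩
  have h := hΨ w
  beta_reduce at h
  rw [← h, ← Complex.normSq_apply, ne_eq, Complex.normSq_eq_zero]

end IsPolyFunC

namespace IsPolyFamily

variable {u v : (CoeffIndex → ℝ) → ℝ[X]}

theorem const (r : ℝ[X]) : IsPolyFamily fun _ => r := fun _ => .const _

theorem add (hu : IsPolyFamily u) (hv : IsPolyFamily v) : IsPolyFamily fun w => u w + v w :=
  fun k => by simpa using (hu k).add (hv k)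

theorem sub (hu : IsPolyFamily u) (hv : IsPolyFamily v) : IsPolyFamily fun w => u w - v w :=
  fun k => by simpa using (hu k).sub (hv k)

theorem mul (hu : IsPolyFamily u) (hv : IsPolyFamily v) : IsPolyFamily fun w => u w * v w := by
  intro k
  simp only [Polynomial.coeff_mul]
  exact .sum fun x => (hu _).mul (hv _)

theorem pow (hu : IsPolyFamily u) (n : ℕ) : IsPolyFamily fun w => u w ^ n := by
  induction n with
  | zero => simpa using const 1
  | succ n ih => simpa only [pow_succ] using ih.mul hu

theorem derivative (hu : IsPolyFamily u) :
    IsPolyFamily fun w => Polynomial.derivative (u w) := by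
  intro k
  simp only [Polynomial.coeff_derivative]
  exact (hu _).mul (.const _)

theorem coeff_dehom {F : (CoeffIndex → ℝ) → MvPolynomial (Fin 2) ℝ}
    (h : IsPolyFamily fun w => toPoly (F w)) (k : ℕ) :
    IsPolyFunC fun w => (dehom (F w)).coeff k := by
  simp only [TernaryQuartic.coeff_dehom]
  exact (h k).ofReal

theorem jac {F G : (CoeffIndex → ℝ) → MvPolynomial (Fin 2) ℝ} {m n : ℕ}
    (hF : ∀ w, (F w).IsHomogeneous m) (hG : ∀ w, (G w).IsHomogeneous n)
    (h : IsPolyFamily fun w => toPoly (F w)) (h' : IsPolyFamily fun w => toPoly (G w)) :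
    IsPolyFamily fun w => toPoly (jac (F w) (G w)) := by
  have e : ∀ w, toPoly (TernaryQuartic.jac (F w) (G w)) =
      ((m : ℝ[X]) * toPoly (F w) - Polynomial.X * Polynomial.derivative (toPoly (F w))) *
        Polynomial.derivative (toPoly (G w)) -
      ((n : ℝ[X]) * toPoly (G w) - Polynomial.X * Polynomial.derivative (toPoly (G w))) *
        Polynomial.derivative (toPoly (F w)) := by
    intro w
    rw [TernaryQuartic.jac, map_sub, map_mul, map_mul, toPoly_pderiv_zero, toPoly_pderiv_zero,
      toPoly_pderiv_one (hF w), toPoly_pderiv_one (hG w)]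
  simp only [e]
  exact ((((const _).mul h).sub ((const _).mul h.derivative)).mul h'.derivative).sub
    ((((const _).mul h').sub ((const _).mul h'.derivative)).mul h.derivative)

theorem vecForm {m : ℕ} (ι : Fin (m + 1) → CoeffIndex) :
    IsPolyFamily fun w => toPoly (vecForm m (w ∘ ι)) := by
  intro k
  simp only [toPoly_vecForm, Polynomial.finsetSum_coeff, Polynomial.coeff_C_mul, Function.comp]
  exact .sum fun i => (IsPolyFun.coord _).mul (.const _)

end IsPolyFamily

theorem exists_disc_ne_zero_iff {m : ℕ} (hm : m ≠ 0)
    {F : (CoeffIndex → ℝ) → MvPolynomial (Fin 2) ℝ} (hF : ∀ w, (F w).IsHomogeneous m)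
    (h : IsPolyFamily fun w => toPoly (F w)) :
    ∃ Ψ : MvPolynomial CoeffIndex ℝ, ∀ w, eval w Ψ ≠ 0 ↔ disc m (F w) ≠ 0 := by
  obtain ⟨Θ, hΘ⟩ := exists_eval_disc hm
  have e : ∀ w, disc m (F w) = _ := fun w =>
    hΘ (F w) (natDegree_dehom (F w) ▸ natDegree_toPoly_le (hF w))
  refine IsPolyFunC.exists_eval_ne_zero_iff ?_
  simp only [e]
  refine IsPolyFunC.eval (fun i => ?_) Θ
  rcases i with i | i
  · exact i.elim
  · exact h.coeff_dehom i

theorem exists_phiInv_ne_zero_iff {m n : ℕ} (hm : m ≠ 0)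
    {F G H : (CoeffIndex → ℝ) → MvPolynomial (Fin 2) ℝ} (hF : ∀ w, (F w).IsHomogeneous m)
    (h : IsPolyFamily fun w => toPoly (F w)) (hG : IsPolyFamily fun w => toPoly (G w))
    (hH : IsPolyFamily fun w => toPoly (H w)) :
    ∃ Ψ : MvPolynomial CoeffIndex ℝ, ∀ w, eval w Ψ ≠ 0 ↔ phiInv m n (F w) (G w) (H w) ≠ 0 := by
  obtain ⟨Θ, hΘ⟩ := exists_eval_phiInv n hm
  have e : ∀ w, phiInv m n (F w) (G w) (H w) = _ := fun w =>
    hΘ (F w) (G w) (H w) (natDegree_dehom (F w) ▸ natDegree_toPoly_le (hF w))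
  refine IsPolyFunC.exists_eval_ne_zero_iff ?_
  simp only [e]
  refine IsPolyFunC.eval (fun i => ?_) Θ
  rcases i with (i | i) | i
  · exact hG.coeff_dehom i
  · exact hH.coeff_dehom i
  · exact h.coeff_dehom i

theorem exists_isRelPrime_iff {m n : ℕ}
    {F G : (CoeffIndex → ℝ) → MvPolynomial (Fin 2) ℝ} (hF : ∀ w, (F w).IsHomogeneous (m + 1))
    (hG : ∀ w, (G w).IsHomogeneous (n + 1)) (h : IsPolyFamily fun w => toPoly (F w))
    (h' : IsPolyFamily fun w => toPoly (G w)) :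
    ∃ Ψ : MvPolynomial CoeffIndex ℝ, ∀ w, eval w Ψ ≠ 0 ↔ IsRelPrime (F w) (G w) := by
  obtain ⟨Ψ, hΨ⟩ := IsPolyFun.resultant h h' (m + 1) (n + 1)
  refine ⟨Ψ, fun w => ?_⟩
  rw [isRelPrime_iff_formRes_ne_zero (hF w) (hG w), formRes, ← hΨ w]

/-! ### The exceptional conditions are algebraic -/

/-- The quadratic form with given coefficient vector. -/
noncomputable def gen₂ (w : CoeffIndex → ℝ) : MvPolynomial (Fin 2) ℝ := vecForm 2 (w ∘ Sum.inl)

/-- The cubic form with given coefficient vector. -/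
noncomputable def gen₃ (w : CoeffIndex → ℝ) : MvPolynomial (Fin 2) ℝ :=
  vecForm 3 (w ∘ Sum.inr ∘ Sum.inl)

/-- The quartic form with given coefficient vector. -/
noncomputable def gen₄ (w : CoeffIndex → ℝ) : MvPolynomial (Fin 2) ℝ :=
  vecForm 4 (w ∘ Sum.inr ∘ Sum.inr)

theorem areForms_gen (w : CoeffIndex → ℝ) : AreForms (gen₂ w) (gen₃ w) (gen₄ w) :=
  ⟨isHomogeneous_vecForm _ _, isHomogeneous_vecForm _ _, isHomogeneous_vecForm _ _⟩

theorem coeffVec_gen (w : CoeffIndex → ℝ) : coeffVec (gen₂ w) (gen₃ w) (gen₄ w) = w := by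
  funext k
  rcases k with k | k | k
  · exact binCoeff_vecForm (m := 2) _ k
  · exact binCoeff_vecForm (m := 3) _ k
  · exact binCoeff_vecForm (m := 4) _ k

theorem gen_coeffVec {f₂ f₃ f₄ : MvPolynomial (Fin 2) ℝ} (h : AreForms f₂ f₃ f₄) :
    gen₂ (coeffVec f₂ f₃ f₄) = f₂ ∧ gen₃ (coeffVec f₂ f₃ f₄) = f₃ ∧
      gen₄ (coeffVec f₂ f₃ f₄) = f₄ :=
  ⟨vecForm_binCoeff h.hom₂, vecForm_binCoeff h.hom₃, vecForm_binCoeff h.hom₄⟩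

theorem isPolyFamily_gen₂ : IsPolyFamily fun w => toPoly (gen₂ w) := .vecForm _

theorem isPolyFamily_gen₃ : IsPolyFamily fun w => toPoly (gen₃ w) := .vecForm _

theorem isPolyFamily_gen₄ : IsPolyFamily fun w => toPoly (gen₄ w) := .vecForm _

theorem isPolyFamily_jac₂₃ : IsPolyFamily fun w => toPoly (jac (gen₂ w) (gen₃ w)) :=
  .jac (fun w => (areForms_gen w).hom₂) (fun w => (areForms_gen w).hom₃)
    isPolyFamily_gen₂ isPolyFamily_gen₃

theorem isPolyFamily_jac₂₄ : IsPolyFamily fun w => toPoly (jac (gen₂ w) (gen₄ w)) :=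
  .jac (fun w => (areForms_gen w).hom₂) (fun w => (areForms_gen w).hom₄)
    isPolyFamily_gen₂ isPolyFamily_gen₄

theorem isPolyFamily_jac₃₄ : IsPolyFamily fun w => toPoly (jac (gen₃ w) (gen₄ w)) :=
  .jac (fun w => (areForms_gen w).hom₃) (fun w => (areForms_gen w).hom₄)
    isPolyFamily_gen₃ isPolyFamily_gen₄

theorem isPolyFamily_formP : IsPolyFamily fun w => toPoly (formP (gen₂ w) (gen₃ w) (gen₄ w)) := by
  simp only [formP, map_sub, map_mul, map_pow]
  exact (isPolyFamily_jac₂₃.mul isPolyFamily_jac₃₄).sub (isPolyFamily_jac₂₄.pow 2)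

theorem isPolyFamily_formQ : IsPolyFamily fun w => toPoly (formQ (gen₂ w) (gen₃ w) (gen₄ w)) := by
  simp only [formQ, map_sub, map_mul, map_pow]
  exact ((isPolyFamily_gen₄.pow 2).mul isPolyFamily_jac₂₃).mul
    ((((IsPolyFamily.const _).mul isPolyFamily_gen₄).mul isPolyFamily_jac₂₃).sub
      (isPolyFamily_gen₃.mul isPolyFamily_jac₂₄))

theorem isPolyFamily_formR : IsPolyFamily fun w => toPoly (formR (gen₂ w) (gen₃ w) (gen₄ w)) := by
  simp only [formR, map_add, map_sub, map_mul, map_pow]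
  exact (((((IsPolyFamily.const _).mul isPolyFamily_gen₂).mul isPolyFamily_gen₄).sub
    ((IsPolyFamily.const _).mul (isPolyFamily_gen₃.pow 2))).mul isPolyFamily_jac₂₃).add
      ((((IsPolyFamily.const _).mul isPolyFamily_gen₂).mul isPolyFamily_gen₃).mul
        isPolyFamily_jac₂₄)

/-- With the exception of the divisibility condition, the exceptional conditions are algebraic
for all triples of forms. -/
theorem exists_eval_ne_zero_iff_not_exceptional {i : Fin 10} (hi : i ≠ 1) :
    ∃ Ψ : MvPolynomial CoeffIndex ℝ, ∀ w,
      eval w Ψ ≠ 0 ↔ ¬ Exceptional (gen₂ w) (gen₃ w) (gen₄ w) i := by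
  have h₂ := fun w => (areForms_gen w).hom₂
  have h₃ := fun w => (areForms_gen w).hom₃
  have h₄ := fun w => (areForms_gen w).hom₄
  have h₂₃ := fun w => isHomogeneous_jac (k := 3) (h₂ w) (h₃ w) rfl
  have h₂₄ := fun w => isHomogeneous_jac (k := 4) (h₂ w) (h₄ w) rfl
  have h₃₄ := fun w => isHomogeneous_jac (k := 5) (h₃ w) (h₄ w) rfl
  have hr : ∀ F G : (CoeffIndex → ℝ) → MvPolynomial (Fin 2) ℝ,
      (∃ Ψ : MvPolynomial CoeffIndex ℝ, ∀ w, eval w Ψ ≠ 0 ↔ IsRelPrime (F w) (G w)) →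
      ∃ Ψ : MvPolynomial CoeffIndex ℝ, ∀ w, eval w Ψ ≠ 0 ↔ ¬ ¬ IsRelPrime (F w) (G w) := by
    simp only [not_not, imp_self, implies_true]
  fin_cases i
  · exact exists_disc_ne_zero_iff (by norm_num) h₂ isPolyFamily_gen₂
  · exact absurd rfl hi
  · refine exists_disc_ne_zero_iff (m := 6) (by norm_num)
      (F := fun w => 4 * gen₂ w * gen₄ w - gen₃ w ^ 2) (fun w => ?_) ?_
    · exact ((isHomogeneous_ofNat_mul 4 (h₂ w)).mul (h₄ w)).sub ((h₃ w).pow 2)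
    · simp only [map_sub, map_mul, map_pow]
      exact (((IsPolyFamily.const _).mul isPolyFamily_gen₂).mul isPolyFamily_gen₄).sub
        (isPolyFamily_gen₃.pow 2)
  · exact exists_disc_ne_zero_iff (by norm_num) h₃ isPolyFamily_gen₃
  · exact hr _ _ <| exists_isRelPrime_iff h₃ h₄ isPolyFamily_gen₃ isPolyFamily_gen₄
  · exact hr _ _ <| exists_isRelPrime_iff h₂₃ h₂₄ isPolyFamily_jac₂₃ isPolyFamily_jac₂₄
  · exact hr _ _ <| exists_isRelPrime_iff h₂₄ h₃₄ isPolyFamily_jac₂₄ isPolyFamily_jac₃₄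
  · refine exists_phiInv_ne_zero_iff (m := 3) (n := 4) (by norm_num) h₃ isPolyFamily_gen₃
      (G := fun w => gen₂ w ^ 2) ?_ isPolyFamily_gen₄
    simpa only [map_pow] using isPolyFamily_gen₂.pow 2
  · exact exists_disc_ne_zero_iff (by norm_num) (fun w => (areForms_gen w).isHomogeneous_formP)
      isPolyFamily_formP
  · refine exists_phiInv_ne_zero_iff (m := 8) (n := 18) (by norm_num)
      (fun w => (areForms_gen w).isHomogeneous_formP)
      isPolyFamily_formP isPolyFamily_formQ (H := fun w => formR (gen₂ w) (gen₃ w) (gen₄ w) ^ 2) ?_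
    simpa only [map_pow] using isPolyFamily_formR.pow 2

theorem vecForm_two_mul_vecForm_one (c : Fin 3 → ℝ) (d : Fin 2 → ℝ) :
    vecForm 2 c * vecForm 1 d =
      vecForm 3 ![c 0 * d 0, c 1 * d 0 + c 0 * d 1, c 2 * d 0 + c 1 * d 1, c 2 * d 1] := by
  simp [vecForm, Fin.sum_univ_succ]
  ring

/-- The quotient of two forms can be taken to be a form, also if both are zero. -/
theorem exists_isHomogeneous_mul_of_dvd {τ : Type*} {m n k : ℕ} {F G : MvPolynomial τ ℝ}
    (hF : F.IsHomogeneous m) (hG : G.IsHomogeneous n) (hk : m + k = n) (h : F ∣ G) :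
    ∃ H : MvPolynomial τ ℝ, H.IsHomogeneous k ∧ G = F * H := by
  let := gradedAlgebra (σ := τ) (R := ℝ)
  obtain ⟨H, rfl⟩ := h
  have h1 := DirectSum.coe_decompose_mul_of_left_mem_of_le (homogeneousSubmodule τ ℝ)
    (b := H) ((mem_homogeneousSubmodule m F).2 hF) (show m ≤ n by omega)
  have h2 : ∀ (p : MvPolynomial τ ℝ) i,
      (DirectSum.decompose (homogeneousSubmodule τ ℝ) p i : MvPolynomial τ ℝ) =
        homogeneousComponent i p := fun p i => decomposition.decompose'_apply p i
  rw [h2, h2, homogeneousComponent_of_mem ((mem_homogeneousSubmodule n _).2 hG), if_pos rfl,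
    show n - m = k by omega] at h1
  exact ⟨_, homogeneousComponent_isHomogeneous k H, h1⟩

/-- The sum of the squares of the coefficients of the remainders of `f₃` modulo `f₂` in the two
affine charts, multiplied by powers of the leading coefficient of `f₂` in each chart. It vanishes if
and only if `f₂ ∣ f₃`, provided that one of the two leading coefficients is nonzero. -/
noncomputable def dvdPoly : MvPolynomial CoeffIndex ℝ :=
  let a : MvPolynomial CoeffIndex ℝ := X (Sum.inl 2)
  let b : MvPolynomial CoeffIndex ℝ := X (Sum.inl 1)
  let c : MvPolynomial CoeffIndex ℝ := X (Sum.inl 0)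
  let p : MvPolynomial CoeffIndex ℝ := X (Sum.inr (Sum.inl 3))
  let q : MvPolynomial CoeffIndex ℝ := X (Sum.inr (Sum.inl 2))
  let r : MvPolynomial CoeffIndex ℝ := X (Sum.inr (Sum.inl 1))
  let s : MvPolynomial CoeffIndex ℝ := X (Sum.inr (Sum.inl 0))
  (a ^ 2 * r - a * p * c - a * b * q + b ^ 2 * p) ^ 2 +
    (a ^ 2 * s - a * c * q + b * c * p) ^ 2 +
    (c ^ 2 * q - b * c * r + b ^ 2 * s - a * c * s) ^ 2 +
    (c ^ 2 * p - a * c * r + a * b * s) ^ 2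

/-- The psd hypothesis settles the case that the coefficients of `x ^ 2` and `y ^ 2` in `f₂`
vanish: it implies `f₂ = 0` and then `f₃ = 0`, so that `f₂ ∣ f₃`. -/
theorem eval_dvdPoly_eq_zero_iff {w : CoeffIndex → ℝ}
    (hpsd : IsPSD (normalQuartic (gen₂ w) (gen₃ w) (gen₄ w) - X 2 ^ 4)) :
    eval w dvdPoly = 0 ↔ gen₂ w ∣ gen₃ w := by
  set a := w (Sum.inl 2) with ha
  set b := w (Sum.inl 1) with hb
  set c := w (Sum.inl 0) with hc
  set p := w (Sum.inr (Sum.inl 3)) with hp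
  set q := w (Sum.inr (Sum.inl 2)) with hq
  set r := w (Sum.inr (Sum.inl 1)) with hr
  set s := w (Sum.inr (Sum.inl 0)) with hs
  have he : eval w dvdPoly = (a ^ 2 * r - a * p * c - a * b * q + b ^ 2 * p) ^ 2 +
    (a ^ 2 * s - a * c * q + b * c * p) ^ 2 +
    (c ^ 2 * q - b * c * r + b ^ 2 * s - a * c * s) ^ 2 +
    (c ^ 2 * p - a * c * r + a * b * s) ^ 2 := by
    simp [dvdPoly, ha, hb, hc, hp, hq, hr, hs]
  have h₂ : gen₂ w = vecForm 2 ![c, b, a] := by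
    rw [gen₂]
    congr 1
    funext k
    fin_cases k <;> rfl
  have h₃ : gen₃ w = vecForm 3 ![s, r, q, p] := by
    rw [gen₃]
    congr 1
    funext k
    fin_cases k <;> rfl
  have hdvd : ∀ v u : ℝ, s = c * v → r = b * v + c * u → q = a * v + b * u → p = a * u →
      gen₂ w ∣ gen₃ w := by
    intro v u e1 e2 e3 e4
    refine ⟨vecForm 1 ![v, u], ?_⟩
    rw [h₂, h₃, vecForm_two_mul_vecForm_one, e1, e2, e3, e4]
    simp
  constructor
  · intro h0
    rw [he] at h0
    obtain ⟨⟨⟨h1, h2⟩, h3⟩, h4⟩ : ((a ^ 2 * r - a * p * c - a * b * q + b ^ 2 * p = 0 ∧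
        a ^ 2 * s - a * c * q + b * c * p = 0) ∧
        c ^ 2 * q - b * c * r + b ^ 2 * s - a * c * s = 0) ∧
        c ^ 2 * p - a * c * r + a * b * s = 0 := by
      rw [add_eq_zero_iff_of_nonneg (by positivity) (by positivity),
        add_eq_zero_iff_of_nonneg (by positivity) (by positivity),
        add_eq_zero_iff_of_nonneg (by positivity) (by positivity)] at h0
      simpa only [pow_eq_zero_iff two_ne_zero] using h0
    by_cases ha0 : a = 0
    · by_cases hc0 : c = 0
      · have hb0 : b = 0 := by
          have hq := isPSD_leading_of_isPSD_sub hpsd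
          rw [h₂] at hq
          have e1 := hq ![1, 1]
          have e2 := hq ![1, -1]
          simp [eval_vecForm, Fin.sum_univ_succ, ha0, hc0] at e1 e2
          linarith
        have h20 : gen₂ w = 0 := by
          rw [h₂, ha0, hb0, hc0]
          simp [vecForm, Fin.sum_univ_succ]
        have h30 : gen₃ w = 0 := by
          apply MvPolynomial.funext
          intro v
          have h := forall_quadratic_nonneg_of_isPSD_sub hpsd v
          rw [h20, map_zero] at h
          rw [map_zero]
          by_contra hne
          have := h (-(eval v (gen₄ w) + 1) / eval v (gen₃ w))
          rw [mul_div_cancel₀ _ hne] at this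
          linarith
        rw [h20, h30]
      · refine hdvd (s / c) ((r - b * (s / c)) / c) ?_ ?_ ?_ ?_ <;> field_simp
        · ring
        · linear_combination h3
        · linear_combination h4
    · refine hdvd ((q - b * (p / a)) / a) (p / a) ?_ ?_ ?_ ?_ <;> field_simp
      · linear_combination h2
      · linear_combination h1
      · ring
  · intro h
    obtain ⟨H, hH, hd⟩ := exists_isHomogeneous_mul_of_dvd (k := 1) (areForms_gen w).hom₂
      (areForms_gen w).hom₃ rfl h
    rw [h₂, h₃, ← vecForm_binCoeff hH, vecForm_two_mul_vecForm_one] at hd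
    have hd' := vecForm_injective 3 hd
    have e0 := congrFun hd' 0
    have e1 := congrFun hd' 1
    have e2 := congrFun hd' 2
    have e3 := congrFun hd' 3
    simp at e0 e1 e2 e3
    rw [he, e0, e1, e2, e3]
    ring

/-! ### Triples of forms that are not exceptional -/

section

variable {m n : ℕ} {F G H : MvPolynomial (Fin 2) ℝ}

/-- If `F(x, 1)` is separable of full degree, a product over pairs of zeros of `F` is a product over
pairs of distinct numbers. -/
theorem pairProd_projZeros_ne_zero {B : ℂ × ℂ → ℂ × ℂ → ℂ} (hm : (toPoly F).natDegree = m)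
    (hs : (toPoly F).Separable) (hB : ∀ a b, (dehom F).eval a = 0 → (dehom F).eval b = 0 → a ≠ b →
      B (a, 1) (b, 1) ≠ 0) : pairProd B (projZeros m F) ≠ 0 := by
  rw [pairProd_ne_zero_iff, projZeros, natDegree_dehom, hm, Nat.sub_self, List.replicate_zero,
    List.append_nil, List.pairwise_map]
  have hnd : (dehom F).roots.toList.Nodup := by
    rw [← Multiset.coe_nodup, Multiset.coe_toList, dehom_eq_map]
    exact Polynomial.nodup_roots hs.map
  exact hnd.imp_of_mem fun {a b} ha hb hab =>
    hB a b (Polynomial.isRoot_of_mem_roots (Multiset.mem_toList.1 ha))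
      (Polynomial.isRoot_of_mem_roots (Multiset.mem_toList.1 hb)) hab

theorem disc_ne_zero_of_separable (hm : (toPoly F).natDegree = m) (hs : (toPoly F).Separable) :
    disc m F ≠ 0 := by
  have h0 : dehom F ≠ 0 := by
    rw [dehom_eq_map]
    exact (hs.map (f := algebraMap ℝ ℂ)).ne_zero
  refine mul_ne_zero (pow_ne_zero _ (Polynomial.leadingCoeff_ne_zero.2 h0)) ?_
  refine pairProd_projZeros_ne_zero hm hs fun a b _ _ hab => ?_
  simpa [sub_eq_zero] using hab

theorem phiInv_ne_zero_of_separable (hm : (toPoly F).natDegree = m) (hs : (toPoly F).Separable)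
    (hG : G.IsHomogeneous n) (hH : H.IsHomogeneous n)
    (h : ∀ a b : ℂ, aeval ![a, 1] F = 0 → aeval ![b, 1] F = 0 →
      aeval ![a, 1] G * aeval ![b, 1] H = aeval ![b, 1] G * aeval ![a, 1] H → a = b) :
    phiInv m n F G H ≠ 0 := by
  have hev : ∀ (K : MvPolynomial (Fin 2) ℝ) (a : ℂ), (dehom K).eval a = aeval ![a, 1] K := by
    intro K a
    rw [dehom]
    induction K using MvPolynomial.induction_on with
    | C r => simp
    | add p q hp hq => simp [hp, hq]
    | mul_X p i hp =>
      rw [map_mul, Polynomial.eval_mul, hp, map_mul, aeval_X, aeval_X]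
      fin_cases i <;> simp
  have h0 : dehom F ≠ 0 := by
    rw [dehom_eq_map]
    exact (hs.map (f := algebraMap ℝ ℂ)).ne_zero
  refine mul_ne_zero (pow_ne_zero _ (Polynomial.leadingCoeff_ne_zero.2 h0)) ?_
  refine pairProd_projZeros_ne_zero hm hs fun a b ha hb hab h' => hab (h a b ?_ ?_ ?_)
  · rw [← hev, ha]
  · rw [← hev, hb]
  · have e := bezoutian_mul_sub (n := n) (natDegree_dehom G ▸ natDegree_toPoly_le hG)
      (natDegree_dehom H ▸ natDegree_toPoly_le hH) a b
    rw [h', zero_mul, hev, hev, hev, hev] at e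
    exact sub_eq_zero.1 e.symm

end

/-- For `z ^ 4 + x y z ^ 2 + y ^ 3 z + x ^ 4 - x ^ 2 y ^ 2`, a zero `a` of the octic `P(x, 1)` is
recovered from the value `t` of `Q / R ^ 2` at `a`, so that this quotient takes distinct values
at distinct zeros. The powers of `t`, reduced modulo the octic, are polynomials in `a` of degree
at most `7` without constant term; `a` is obtained by inverting this system of linear
equations. -/
theorem eq_of_quotient_eq {a t : ℂ} (h : 8 * a ^ 8 + 18 * a ^ 3 - 9 * a = 0)
    (hR : -16 * a ^ 5 + 24 * a ^ 3 + 9 ≠ 0)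
    (ht : t = (30 * a ^ 12 - 78 * a ^ 10 + 66 * a ^ 8 - 18 * a ^ 6) /
      (-16 * a ^ 5 + 24 * a ^ 3 + 9) ^ 2) :
    a = -367948315616745669456/270170959877367173 * t -
      67417131719833005580544/270170959877367173 * t ^ 2 +
      940181735422623414980608/810512879632101519 * t ^ 3 +
      8516241008602543421390848/270170959877367173 * t ^ 4 +
      146636573408778350342701056/270170959877367173 * t ^ 5 +
      4344186322764527351243997184/810512879632101519 * t ^ 6 +
      6250995648000633043165380608/270170959877367173 * t ^ 7 := by
  -- the multipliers of `h` are the quotients of the division by the octic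
  have h1 : t = 75/5588 * a - 18/1397 * a ^ 2 - 25/5588 * a ^ 3 + 6/1397 * a ^ 4 -
    125/16764 * a ^ 5 + 10/1397 * a ^ 6 - 337/8382 * a ^ 7 := by
    rw [ht, div_eq_iff (pow_ne_zero 2 hR)]
    linear_combination (675/5588 - 162/1397 * a + 1125/5588 * a ^ 2 + 630/1397 * a ^ 3 -
      1581/5588 * a ^ 4 + 3244/1397 * a ^ 5 + 768/1397 * a ^ 6 - 15176/4191 * a ^ 7 -
      320/1397 * a ^ 8 + 5392/4191 * a ^ 9) * h
  have h2 : t ^ 2 = 16377/124902976 * a - 721953/249805952 * a ^ 2 - 17903/249805952 * a ^ 3 +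
    709161/124902976 * a ^ 4 - 13755/124902976 * a ^ 5 + 2463/31225744 * a ^ 6 +
    43719/62451488 * a ^ 7 := by
    rw [sq, h1]
    linear_combination (5459/374708928 - 61/178816 * a + 134005/2248253568 * a ^ 2 -
      2647/46838616 * a ^ 3 + 45725/562063392 * a ^ 4 - 1685/23419308 * a ^ 5 +
      113569/562063392 * a ^ 6) * h
  have h3 : t ^ 3 = 46396155/11167325278208 * a + 806514345/5583662639104 * a ^ 2 -
    11404707/5583662639104 * a ^ 3 - 44027865/87244728736 * a ^ 4 - 4364643/1395915659776 * a ^ 5 +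
    296152185/697957829888 * a ^ 6 - 5565327/174489457472 * a ^ 7 := by
    rw [pow_succ, h2, h1]
    linear_combination (15465385/33501975834624 + 63365/3996895232 * a +
      21750875/4187746979328 * a ^ 2 - 79093513/2791831319552 * a ^ 3 - 4965/174489457472 * a ^ 4 +
      160513/697957829888 * a ^ 5 - 4911101/1395915659776 * a ^ 6) * h
  have h4 : t ^ 4 = 2227636650105/62403013654626304 * a - 897977511729/124806027309252608 * a ^ 2 -
    8891760041973/124806027309252608 * a ^ 3 + 247126931571/7800376706828288 * a ^ 4 -
    4999874643/62403013654626304 * a ^ 5 - 3155350195463/62403013654626304 * a ^ 6 +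
    22703860371/31201506827313152 * a ^ 7 := by
    rw [pow_succ, h3, h1]
    linear_combination (247515183345/62403013654626304 - 71974623/89338602225664 * a -
      24054077637/124806027309252608 * a ^ 2 + 66171510733/31201506827313152 * a ^ 3 +
      13263936797/31201506827313152 * a ^ 4 - 33712988275/15600753413656576 * a ^ 5 +
      625171733/3900188353414144 * a ^ 6) * h
  have h5 : t ^ 5 = -7443640385551647/1394832161208207147008 * a +
    788571695684079/2789664322416414294016 * a ^ 2 +
    18616723558595379/1394832161208207147008 * a ^ 3 -
    4564678039462185/2789664322416414294016 * a ^ 4 -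
    1862637393177675/348708040302051786752 * a ^ 5 +
    2731912570058703/697416080604103573504 * a ^ 6 -
    5185098154881/174354020151025893376 * a ^ 7 := by
    rw [pow_succ, h4, h1]
    linear_combination (-827071153950183/1394832161208207147008 -
      43586279677/1996896436948041728 * a + 500633196609075/1394832161208207147008 * a ^ 2 -
      935420269661693/8368992967249242882048 * a ^ 3 -
      7936418188311/174354020151025893376 * a ^ 4 +
      1066077479115551/4184496483624621441024 * a ^ 5 -
      2550400315009/697416080604103573504 * a ^ 6) * h
  have h6 : t ^ 6 = 15358907273054309919/31177288467325846149922816 * a -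
    1412098500032338527/124709153869303384599691264 * a ^ 2 -
    45696351153653329473/31177288467325846149922816 * a ^ 3 +
    598272621980707449/7794322116831461537480704 * a ^ 4 +
    18102308611872202479/15588644233662923074961408 * a ^ 5 -
    7567256550238564491/31177288467325846149922816 * a ^ 6 -
    778872380883689673/1948580529207865384370176 * a ^ 7 := by
    rw [pow_succ, h5, h1]
    linear_combination (1706545252561589991/31177288467325846149922816 +
      598128526416101/89269258317325257408512 * a -
      1915621199215132869/31177288467325846149922816 * a ^ 2 -
      13911402826138287/62354576934651692299845632 * a ^ 3 +
      118385719311999615/3897161058415730768740352 * a ^ 4 -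
      307299653222318117/15588644233662923074961408 * a ^ 5 +
      582459359398299/3897161058415730768740352 * a ^ 6) * h
  have h7 : t ^ 7 = -99034172212993752237687/2787499007286669252572299132928 * a -
    93032869305676604745861/2787499007286669252572299132928 * a ^ 2 +
    170827843154474470899753/1393749503643334626286149566464 * a ^ 3 +
    44759039781258513920277/696874751821667313143074783232 * a ^ 4 -
    101092339516019287913955/696874751821667313143074783232 * a ^ 5 +
    2303668600624106668215/174218687955416828285768695808 * a ^ 6 +
    69048750848506572595737/696874751821667313143074783232 * a ^ 7 := by
    rw [pow_succ, h6, h1]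
    linear_combination (-11003796912554861359743/2787499007286669252572299132928 -
      8865311225112684057/1995346461908854153595060224 * a +
      2245894897382356998735/348437375910833656571537391616 * a ^ 2 +
      926752387997050456845/1393749503643334626286149566464 * a ^ 3 -
      1979353169422081444551/348437375910833656571537391616 * a ^ 4 +
      600815990594018049129/696874751821667313143074783232 * a ^ 5 +
      87493330785934473267/43554671988854207071442173952 * a ^ 6) * h
  rw [h7, h6, h5, h4, h3, h2, h1]
  ring 
/-- The octic and the quintic are coprime; the second factor below is an inverse of the quintic
modulo the octic. -/
theorem quintic_ne_zero_of_octic_eq_zero {a : ℂ} (h : 8 * a ^ 8 + 18 * a ^ 3 - 9 * a = 0) :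
    -16 * a ^ 5 + 24 * a ^ 3 + 9 ≠ 0 := by
  have hU : (-16 * a ^ 5 + 24 * a ^ 3 + 9) *
      (1/9 - 2912/23749 * a + 28736/213741 * a ^ 2 - 8264/71247 * a ^ 3 + 20224/213741 * a ^ 4 -
        7792/213741 * a ^ 5 + 3904/213741 * a ^ 6 - 5120/1923669 * a ^ 7) = 1 := by
    linear_combination (2912/23749 - 28736/213741 * a + 41632/641223 * a ^ 2 -
      7808/213741 * a ^ 3 + 10240/1923669 * a ^ 4) * h
  exact left_ne_zero_of_mul (hU ▸ one_ne_zero)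

/-- Each exceptional condition other than `f₂ ∣ f₃` fails for some triple. The last two fail for
`z ^ 4 + x y z ^ 2 + y ^ 3 z + x ^ 4 - x ^ 2 y ^ 2`; for the others, there are simpler choices. -/
theorem exists_not_exceptional {i : Fin 10} (hi : i ≠ 1) :
    ∃ f₂ f₃ f₄ : MvPolynomial (Fin 2) ℝ, AreForms f₂ f₃ f₄ ∧ ¬ Exceptional f₂ f₃ f₄ i := by
  have hX := fun (j : Fin 2) (k : ℕ) => isHomogeneous_X_pow (R := ℝ) j k
  have hXY : (X 0 * X 1 : MvPolynomial (Fin 2) ℝ).IsHomogeneous 2 :=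
    (isHomogeneous_X ℝ (0 : Fin 2)).mul (isHomogeneous_X ℝ (1 : Fin 2))
  have h0 := fun k => isHomogeneous_zero (Fin 2) ℝ k
  have hcub : (toPoly (X 0 ^ 3 + X 1 ^ 3)).natDegree = 3 ∧
      (toPoly (X 0 ^ 3 + X 1 ^ 3)).Separable := by
    have e : toPoly (X 0 ^ 3 + X 1 ^ 3) = Polynomial.X ^ 3 + 1 := by simp [toPoly]
    rw [e]
    refine ⟨by compute_degree!, 1, -Polynomial.C (1 / 3) * Polynomial.X, ?_⟩
    have : (Polynomial.C (1 / 3 : ℝ)) * 3 = 1 := by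
      rw [← map_ofNat Polynomial.C 3, ← map_mul]; norm_num
    simp only [Polynomial.derivative_add, Polynomial.derivative_X_pow, Polynomial.derivative_one,
      Nat.cast_ofNat, map_ofNat]
    linear_combination (-Polynomial.X ^ 3) * this
  -- the octic `formP` of the triple used for the last two conditions
  have hP : formP (X 0 * X 1) (X 1 ^ 3) (X 0 ^ 4 - X 0 ^ 2 * X 1 ^ 2) =
      -16 * X 0 ^ 8 - 36 * X 0 ^ 3 * X 1 ^ 5 + 18 * X 0 * X 1 ^ 7 := by
    simp [formP, jac, pderiv_X]
    ring
  have hPQR : AreForms (X 0 * X 1) (X 1 ^ 3) (X 0 ^ 4 - X 0 ^ 2 * X 1 ^ 2) :=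
    ⟨hXY, hX 1 3, (hX 0 4).sub ((hX 0 2).mul (hX 1 2))⟩
  have hoct : (toPoly (formP (X 0 * X 1) (X 1 ^ 3) (X 0 ^ 4 - X 0 ^ 2 * X 1 ^ 2))).natDegree = 8 ∧
      (toPoly (formP (X 0 * X 1) (X 1 ^ 3) (X 0 ^ 4 - X 0 ^ 2 * X 1 ^ 2))).Separable := by
    have e : toPoly (formP (X 0 * X 1) (X 1 ^ 3) (X 0 ^ 4 - X 0 ^ 2 * X 1 ^ 2)) =
        -16 * Polynomial.X ^ 8 - 36 * Polynomial.X ^ 3 + 18 * Polynomial.X := by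
      rw [hP]
      simp [toPoly]
    have ed : Polynomial.derivative
        (-16 * Polynomial.X ^ 8 - 36 * Polynomial.X ^ 3 + 18 * Polynomial.X : ℝ[X]) =
        -128 * Polynomial.X ^ 7 - 108 * Polynomial.X ^ 2 + 18 := by
      simp only [Polynomial.derivative_mul, Polynomial.derivative_add, Polynomial.derivative_neg,
        Polynomial.derivative_sub, Polynomial.derivative_ofNat, Polynomial.derivative_X_pow,
        Polynomial.derivative_X, Nat.cast_ofNat, map_ofNat]
      ring
    have hN : Polynomial.C (1 / 194636034 : ℝ) * 194636034 = 1 := by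
      rw [← map_ofNat Polynomial.C 194636034, ← map_mul]; norm_num
    rw [e]
    -- a Bézout identity between the octic and its derivative
    refine ⟨by compute_degree!,
      Polynomial.C (1 / 194636034) * (-4961250 + 101099592 * Polynomial.X +
        22680000 * Polynomial.X ^ 2 - 17287200 * Polynomial.X ^ 3 + 32400000 * Polynomial.X ^ 4 -
        24696000 * Polynomial.X ^ 5 + 134163712 * Polynomial.X ^ 6),
      Polynomial.C (1 / 194636034) * (10813113 + 4961250 * Polynomial.X -
        36220914 * Polynomial.X ^ 2 - 2835000 * Polynomial.X ^ 3 + 2160900 * Polynomial.X ^ 4 -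
        4050000 * Polynomial.X ^ 5 + 3087000 * Polynomial.X ^ 6 -
        16770464 * Polynomial.X ^ 7), ?_⟩
    rw [ed]
    linear_combination hN
  fin_cases i
  · refine ⟨X 0 ^ 2 + X 1 ^ 2, 0, 0, ⟨(hX 0 2).add (hX 1 2), h0 3, h0 4⟩, ?_⟩
    have e : toPoly (X 0 ^ 2 + X 1 ^ 2) = Polynomial.X ^ 2 + 1 := by simp [toPoly]
    refine disc_ne_zero_of_separable ?_ ?_ <;> rw [e]
    · compute_degree!
    · refine ⟨1, -Polynomial.C (1 / 2) * Polynomial.X, ?_⟩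
      have : (Polynomial.C (1 / 2 : ℝ)) * 2 = 1 := by
        rw [← map_ofNat Polynomial.C 2, ← map_mul]; norm_num
      simp only [Polynomial.derivative_add, Polynomial.derivative_X_pow, Polynomial.derivative_one,
        Nat.cast_ofNat, map_ofNat]
      linear_combination (-Polynomial.X ^ 2) * this
  · exact absurd rfl hi
  · refine ⟨X 0 ^ 2 + X 1 ^ 2, 0, X 0 ^ 4 - X 0 ^ 2 * X 1 ^ 2 + X 1 ^ 4,
      ⟨(hX 0 2).add (hX 1 2), h0 3, ((hX 0 4).sub ((hX 0 2).mul (hX 1 2))).add (hX 1 4)⟩, ?_⟩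
    have e : toPoly (4 * (X 0 ^ 2 + X 1 ^ 2) * (X 0 ^ 4 - X 0 ^ 2 * X 1 ^ 2 + X 1 ^ 4) - 0 ^ 2) =
        4 * Polynomial.X ^ 6 + 4 := by
      simp [toPoly]
      ring
    refine disc_ne_zero_of_separable ?_ ?_ <;> rw [e]
    · compute_degree!
    · refine ⟨Polynomial.C (1 / 4), -Polynomial.C (1 / 24) * Polynomial.X, ?_⟩
      have h4 : (Polynomial.C (1 / 4 : ℝ)) * 4 = 1 := by
        rw [← map_ofNat Polynomial.C 4, ← map_mul]; norm_num
      have h24 : (Polynomial.C (1 / 24 : ℝ)) * 24 = 1 := by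
        rw [← map_ofNat Polynomial.C 24, ← map_mul]; norm_num
      have ed : Polynomial.derivative (4 * Polynomial.X ^ 6 + 4 : ℝ[X]) =
          24 * Polynomial.X ^ 5 := by
        simp only [Polynomial.derivative_mul, Polynomial.derivative_add,
          Polynomial.derivative_ofNat, Polynomial.derivative_X_pow, Nat.cast_ofNat, map_ofNat]
        ring
      rw [ed]
      linear_combination (Polynomial.X ^ 6 + 1) * h4 - Polynomial.X ^ 6 * h24
  · exact ⟨0, X 0 ^ 3 + X 1 ^ 3, 0, ⟨h0 2, (hX 0 3).add (hX 1 3), h0 4⟩,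
      disc_ne_zero_of_separable hcub.1 hcub.2⟩
  · refine ⟨0, X 0 ^ 3, X 1 ^ 4, ⟨h0 2, hX 0 3, hX 1 4⟩, ?_⟩
    exact not_not.2 (isRelPrime_X_pow 3 4)
  · refine ⟨X 0 * X 1, X 0 ^ 3, X 1 ^ 4, ⟨hXY, hX 0 3, hX 1 4⟩, not_not.2 ?_⟩
    intro d h1 h2
    refine isRelPrime_X_pow 3 4 (d := d) ?_ ?_
    · have e1 : jac (X 0 * X 1) (X 0 ^ 3) = (3 * X 0 ^ 3 : MvPolynomial (Fin 2) ℝ) := by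
        simp [jac, pderiv_X]
        ring
      have e : (X 0 ^ 3 : MvPolynomial (Fin 2) ℝ) = C (1 / 3) * (3 * X 0 ^ 3) := by
        rw [← mul_assoc, ← map_ofNat C 3, ← map_mul]
        norm_num
      rw [e, ← e1]
      exact h1.mul_left _
    · have e1 : jac (X 0 * X 1) (X 1 ^ 4) = (-4 * X 1 ^ 4 : MvPolynomial (Fin 2) ℝ) := by
        simp [jac, pderiv_X]
        ring
      have e : (X 1 ^ 4 : MvPolynomial (Fin 2) ℝ) = C (-1 / 4) * (-4 * X 1 ^ 4) := by
        rw [← mul_assoc, ← map_ofNat C 4, ← map_neg, ← map_mul]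
        norm_num
      rw [e, ← e1]
      exact h2.mul_left _
  · refine ⟨X 0 * X 1, X 0 ^ 3, X 0 ^ 4 + X 1 ^ 4, ⟨hXY, hX 0 3, (hX 0 4).add (hX 1 4)⟩,
      not_not.2 ?_⟩
    intro d h1 h2
    have e1 : jac (X 0 * X 1) (X 0 ^ 4 + X 1 ^ 4) =
        (4 * (X 0 ^ 4 - X 1 ^ 4) : MvPolynomial (Fin 2) ℝ) := by
      simp [jac, pderiv_X]
      ring
    have e2 : jac (X 0 ^ 3) (X 0 ^ 4 + X 1 ^ 4) =
        (-12 * (X 0 ^ 2 * X 1 ^ 3) : MvPolynomial (Fin 2) ℝ) := by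
      simp [jac, pderiv_X]
      ring
    have c4 : (C (1 / 4) : MvPolynomial (Fin 2) ℝ) * 4 = 1 := by
      rw [← map_ofNat C 4, ← map_mul]; norm_num
    have c12 : (C (1 / 12) : MvPolynomial (Fin 2) ℝ) * 12 = 1 := by
      rw [← map_ofNat C 12, ← map_mul]; norm_num
    rw [e1] at h1
    rw [e2] at h2
    refine isRelPrime_X_pow 6 7 (d := d) ?_ ?_
    · have e : (X 0 ^ 6 : MvPolynomial (Fin 2) ℝ) =
          C (1 / 4) * X 0 ^ 2 * (4 * (X 0 ^ 4 - X 1 ^ 4)) +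
            -C (1 / 12) * X 1 * (-12 * (X 0 ^ 2 * X 1 ^ 3)) := by
        linear_combination (-X 0 ^ 2 * (X 0 ^ 4 - X 1 ^ 4)) * c4 - X 0 ^ 2 * X 1 ^ 4 * c12
      rw [e]
      exact dvd_add (h1.mul_left _) (h2.mul_left _)
    · have e : (X 1 ^ 7 : MvPolynomial (Fin 2) ℝ) =
          -C (1 / 4) * X 1 ^ 3 * (4 * (X 0 ^ 4 - X 1 ^ 4)) +
            -C (1 / 12) * X 0 ^ 2 * (-12 * (X 0 ^ 2 * X 1 ^ 3)) := by
        linear_combination (X 1 ^ 3 * (X 0 ^ 4 - X 1 ^ 4)) * c4 - X 0 ^ 4 * X 1 ^ 3 * c12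
      rw [e]
      exact dvd_add (h1.mul_left _) (h2.mul_left _)
  · refine ⟨X 0 ^ 2, X 0 ^ 3 + X 1 ^ 3, X 1 ^ 4,
      ⟨hX 0 2, (hX 0 3).add (hX 1 3), hX 1 4⟩,
      phiInv_ne_zero_of_separable hcub.1 hcub.2 ((hX 0 2).pow 2) (hX 1 4) ?_⟩
    intro a b ha hb hab
    simp at ha hb hab
    linear_combination a * ha - b * hb - hab
  · exact ⟨_, _, _, hPQR, disc_ne_zero_of_separable hoct.1 hoct.2⟩
  · refine ⟨_, _, _, hPQR, phiInv_ne_zero_of_separable hoct.1 hoct.2 hPQR.isHomogeneous_formQ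
      (hPQR.isHomogeneous_formR.pow 2) ?_⟩
    have hQ : ∀ a : ℂ, aeval ![a, 1] (formQ (X 0 * X 1) (X 1 ^ 3) (X 0 ^ 4 - X 0 ^ 2 * X 1 ^ 2)) =
        30 * a ^ 12 - 78 * a ^ 10 + 66 * a ^ 8 - 18 * a ^ 6 := by
      intro a
      simp [formQ, jac, pderiv_X]
      ring
    have hR : ∀ a : ℂ, aeval ![a, 1] (formR (X 0 * X 1) (X 1 ^ 3) (X 0 ^ 4 - X 0 ^ 2 * X 1 ^ 2)) =
        -16 * a ^ 5 + 24 * a ^ 3 + 9 := by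
      intro a
      simp [formR, jac, pderiv_X]
      ring
    intro a b ha hb hab
    rw [hP] at ha hb
    simp at ha hb
    have ha' : 8 * a ^ 8 + 18 * a ^ 3 - 9 * a = 0 := by linear_combination (-1 / 2) * ha
    have hb' : 8 * b ^ 8 + 18 * b ^ 3 - 9 * b = 0 := by linear_combination (-1 / 2) * hb
    have hRa := quintic_ne_zero_of_octic_eq_zero ha'
    have hRb := quintic_ne_zero_of_octic_eq_zero hb'
    rw [map_pow, map_pow, hQ, hQ, hR, hR] at hab
    rw [eq_of_quotient_eq ha' hRa rfl, eq_of_quotient_eq hb' hRb rfl,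
      (div_eq_div_iff (pow_ne_zero 2 hRa) (pow_ne_zero 2 hRb)).2 hab]

theorem exists_exceptionalPoly : ∃ Ψ : Fin 10 → MvPolynomial CoeffIndex ℝ, (∀ i, Ψ i ≠ 0) ∧
    ∀ f₂ f₃ f₄ : MvPolynomial (Fin 2) ℝ, AreForms f₂ f₃ f₄ →
      IsPSD (normalQuartic f₂ f₃ f₄ - X 2 ^ 4) →
      ∀ i, eval (coeffVec f₂ f₃ f₄) (Ψ i) ≠ 0 ↔ ¬ Exceptional f₂ f₃ f₄ i := by
  suffices H : ∀ i, ∃ Ψ : MvPolynomial CoeffIndex ℝ, Ψ ≠ 0 ∧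
      ∀ f₂ f₃ f₄ : MvPolynomial (Fin 2) ℝ, AreForms f₂ f₃ f₄ →
        IsPSD (normalQuartic f₂ f₃ f₄ - X 2 ^ 4) →
        (eval (coeffVec f₂ f₃ f₄) Ψ ≠ 0 ↔ ¬ Exceptional f₂ f₃ f₄ i) by
    choose Ψ hΨ0 hΨ using H
    exact ⟨Ψ, hΨ0, fun f₂ f₃ f₄ h hpsd i => hΨ i f₂ f₃ f₄ h hpsd⟩
  intro i
  by_cases hi : i = 1
  · subst hi
    refine ⟨dvdPoly, ?_, fun f₂ f₃ f₄ h hpsd => ?_⟩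
    · intro h0
      -- `y ^ 3` is not divisible by `x ^ 2`
      have := congrArg (eval (Sum.elim ![0, 0, 1] (Sum.elim ![1, 0, 0, 0] 0))) h0
      simp [dvdPoly] at this
    · obtain ⟨h2, h3, h4⟩ := gen_coeffVec h
      have := eval_dvdPoly_eq_zero_iff (w := coeffVec f₂ f₃ f₄) (by rwa [h2, h3, h4])
      rw [ne_eq, this, h2, h3]
      rfl
  · obtain ⟨Ψ, hΨ⟩ := exists_eval_ne_zero_iff_not_exceptional hi
    have key : ∀ f₂ f₃ f₄ : MvPolynomial (Fin 2) ℝ, AreForms f₂ f₃ f₄ →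
        (eval (coeffVec f₂ f₃ f₄) Ψ ≠ 0 ↔ ¬ Exceptional f₂ f₃ f₄ i) := by
      intro f₂ f₃ f₄ h
      obtain ⟨h2, h3, h4⟩ := gen_coeffVec h
      rw [hΨ, h2, h3, h4]
    refine ⟨Ψ, ?_, fun f₂ f₃ f₄ h _ => key f₂ f₃ f₄ h⟩
    rintro rfl
    obtain ⟨f₂, f₃, f₄, h, hne⟩ := exists_not_exceptional hi
    exact (key f₂ f₃ f₄ h).2 hne (map_zero _)

/-! ### Density of the generic forms -/

theorem abs_eval_vecForm_le {m : ℕ} {c : Fin (m + 1) → ℝ} {r : Fin 2 → ℝ} {η N : ℝ}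
    (hc : ∀ i, |c i| ≤ η) (hr : ∀ i, |r i| ≤ N) :
    |eval r (vecForm m c)| ≤ (m + 1) * η * N ^ m := by
  have hN : 0 ≤ N := (abs_nonneg _).trans (hr 0)
  have hη : 0 ≤ η := (abs_nonneg _).trans (hc 0)
  rw [eval_vecForm]
  refine (Finset.abs_sum_le_sum_abs _ _).trans ?_
  refine (Finset.sum_le_card_nsmul _ _ (η * N ^ m) fun i _ => ?_).trans ?_
  · have e : N ^ m = N ^ (i : ℕ) * N ^ (m - i) := by rw [← pow_add]; congr 1; omega
    rw [abs_mul, abs_mul, abs_pow, abs_pow, e, mul_assoc]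
    gcongr
    · exact hc i
    · exact hr 0
    · exact hr 1
  · simp
    rw [mul_assoc]

theorem eval_vecForm_eq_add {m : ℕ} (c c₀ u : Fin (m + 1) → ℝ) (δ : ℝ) (r : Fin 2 → ℝ) :
    eval r (vecForm m c) = eval r (vecForm m c₀) + δ * eval r (vecForm m u) +
      eval r (vecForm m (c - c₀ - δ • u)) := by
  simp only [eval_vecForm, Finset.mul_sum, ← Finset.sum_add_distrib]
  refine Finset.sum_congr rfl fun i _ => ?_
  simp only [Pi.sub_apply, Pi.smul_apply, smul_eq_mul]
  ring

/-- The coefficients of `(x ^ 2 + y ^ 2) z ^ 2 + (x ^ 2 + y ^ 2) ^ 2`. -/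
def roundVec : CoeffIndex → ℝ := Sum.elim ![1, 0, 1] (Sum.elim 0 ![1, 0, 2, 0, 1])

theorem abs_roundVec_le (k : CoeffIndex) : |roundVec k| ≤ 2 := by
  rcases k with k | k | k <;> fin_cases k <;> simp [roundVec]

/-- Small perturbations of the sum of `f₂ z ^ 2 + f₃ z + f₄` and of
`δ ((x ^ 2 + y ^ 2) z ^ 2 + (x ^ 2 + y ^ 2) ^ 2)` lie above `f₂ z ^ 2 + f₃ z + f₄`. -/
theorem eval_normalQuartic_gen_ge {w₀ w : CoeffIndex → ℝ} {δ : ℝ} (hδ : 0 < δ)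
    (hw : ∀ k, |w k - w₀ k - δ * roundVec k| ≤ δ / 14) (r : Fin 2 → ℝ) (z : ℝ) :
    eval r (gen₂ w₀) * z ^ 2 + eval r (gen₃ w₀) * z + eval r (gen₄ w₀) +
        δ / 2 * (r 0 ^ 2 + r 1 ^ 2) ^ 2 ≤
      eval r (gen₂ w) * z ^ 2 + eval r (gen₃ w) * z + eval r (gen₄ w) := by
  set N := √(r 0 ^ 2 + r 1 ^ 2) with hN
  have hN0 : 0 ≤ N := Real.sqrt_nonneg _
  have hN2 : N ^ 2 = r 0 ^ 2 + r 1 ^ 2 := Real.sq_sqrt (by positivity)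
  have hr : ∀ i, |r i| ≤ N := by
    intro i
    apply Real.abs_le_sqrt
    fin_cases i
    · show r 0 ^ 2 ≤ _
      nlinarith [sq_nonneg (r 1)]
    · show r 1 ^ 2 ≤ _
      nlinarith [sq_nonneg (r 0)]
  have e2 := eval_vecForm_eq_add (m := 2) (w ∘ Sum.inl) (w₀ ∘ Sum.inl) (roundVec ∘ Sum.inl) δ r
  have e3 := eval_vecForm_eq_add (m := 3) (w ∘ Sum.inr ∘ Sum.inl) (w₀ ∘ Sum.inr ∘ Sum.inl)
    (roundVec ∘ Sum.inr ∘ Sum.inl) δ r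
  have e4 := eval_vecForm_eq_add (m := 4) (w ∘ Sum.inr ∘ Sum.inr) (w₀ ∘ Sum.inr ∘ Sum.inr)
    (roundVec ∘ Sum.inr ∘ Sum.inr) δ r
  have b2 := abs_le.1 (abs_eval_vecForm_le (m := 2) (fun i => hw (Sum.inl i)) hr)
  have b3 := abs_eval_vecForm_le (m := 3) (fun i => hw (Sum.inr (Sum.inl i))) hr
  have b4 := abs_le.1 (abs_eval_vecForm_le (m := 4) (fun i => hw (Sum.inr (Sum.inr i))) hr)
  have u2 : eval r (vecForm 2 (roundVec ∘ Sum.inl)) = N ^ 2 := by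
    simp [eval_vecForm, Fin.sum_univ_succ, roundVec, hN2]
    ring
  have u3 : eval r (vecForm 3 (roundVec ∘ Sum.inr ∘ Sum.inl)) = 0 := by
    simp [eval_vecForm, roundVec]
  have u4 : eval r (vecForm 4 (roundVec ∘ Sum.inr ∘ Sum.inr)) = N ^ 4 := by
    have : N ^ 4 = (N ^ 2) ^ 2 := by ring
    simp [eval_vecForm, Fin.sum_univ_succ, roundVec, this, hN2]
    ring
  rw [u2] at e2
  rw [u3] at e3
  rw [u4] at e4
  rw [← hN2]
  unfold gen₂ gen₃ gen₄
  rw [e2, e3, e4]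
  have c2 : eval r (vecForm 2 (w ∘ Sum.inl - w₀ ∘ Sum.inl - δ • roundVec ∘ Sum.inl)) =
    eval r (vecForm 2 fun i => w (Sum.inl i) - w₀ (Sum.inl i) - δ * roundVec (Sum.inl i)) := rfl
  have c3 : eval r (vecForm 3 (w ∘ Sum.inr ∘ Sum.inl - w₀ ∘ Sum.inr ∘ Sum.inl -
      δ • roundVec ∘ Sum.inr ∘ Sum.inl)) =
    eval r (vecForm 3 fun i => w (Sum.inr (Sum.inl i)) - w₀ (Sum.inr (Sum.inl i)) -
      δ * roundVec (Sum.inr (Sum.inl i))) := rfl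
  have c4 : eval r (vecForm 4 (w ∘ Sum.inr ∘ Sum.inr - w₀ ∘ Sum.inr ∘ Sum.inr -
      δ • roundVec ∘ Sum.inr ∘ Sum.inr)) =
    eval r (vecForm 4 fun i => w (Sum.inr (Sum.inr i)) - w₀ (Sum.inr (Sum.inr i)) -
      δ * roundVec (Sum.inr (Sum.inr i))) := rfl
  rw [c2, c3, c4]
  set v2 := eval r (vecForm 2 fun i => w (Sum.inl i) - w₀ (Sum.inl i) - δ * roundVec (Sum.inl i))
  set v3 := eval r (vecForm 3 fun i => w (Sum.inr (Sum.inl i)) - w₀ (Sum.inr (Sum.inl i)) -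
      δ * roundVec (Sum.inr (Sum.inl i)))
  set v4 := eval r (vecForm 4 fun i => w (Sum.inr (Sum.inr i)) - w₀ (Sum.inr (Sum.inr i)) -
      δ * roundVec (Sum.inr (Sum.inr i)))
  push_cast at b2 b3 b4
  have i2 : -((2 + 1) * (δ / 14) * N ^ 2) * z ^ 2 ≤ v2 * z ^ 2 :=
    mul_le_mul_of_nonneg_right b2.1 (sq_nonneg z)
  have i3 : -((3 + 1) * (δ / 14) * N ^ 3 * |z|) ≤ v3 * z := by
    have := mul_le_mul_of_nonneg_right b3 (abs_nonneg z)
    rw [← abs_mul] at this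
    linarith [neg_abs_le (v3 * z)]
  have i4 := b4.1
  -- `2 N ^ 3 |z| ≤ N ^ 2 z ^ 2 + N ^ 4`
  have i5 : 2 * (N ^ 3 * |z|) ≤ N ^ 2 * z ^ 2 + N ^ 4 := by
    have := sq_nonneg (N * |z| - N ^ 2)
    have hz := sq_abs z
    nlinarith
  have i6 : 0 ≤ N ^ 2 * z ^ 2 := by positivity
  have i7 : 0 ≤ N ^ 4 := by positivity
  nlinarith [mul_le_mul_of_nonneg_left i5 hδ.le, mul_nonneg hδ.le i6, mul_nonneg hδ.le i7]

/-- The complement of the zero set of a nonzero polynomial is dense. -/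
theorem exists_near_eval_ne_zero {Ψ : MvPolynomial CoeffIndex ℝ} (hΨ : Ψ ≠ 0)
    (w₁ : CoeffIndex → ℝ) {η : ℝ} (hη : 0 < η) :
    ∃ w : CoeffIndex → ℝ, (∀ k, |w k - w₁ k| ≤ η) ∧ eval w Ψ ≠ 0 := by
  by_contra! H
  apply hΨ
  refine funext_set (fun k => Set.Icc (w₁ k - η) (w₁ k + η))
    (fun k => Set.Icc_infinite (by linarith)) fun w hw => ?_
  rw [map_zero]
  refine H w fun k => ?_
  have := hw k (Set.mem_univ k)
  rw [abs_le]
  constructor <;> linarith [this.1, this.2]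

/-- Generic positive definite forms are dense among the psd forms: adding a small multiple of
`(x ^ 2 + y ^ 2) z ^ 2 + (x ^ 2 + y ^ 2) ^ 2` makes a psd form positive definite with room for a
further perturbation. -/
theorem exists_near_generic {Ψ : MvPolynomial CoeffIndex ℝ} (hΨ : Ψ ≠ 0)
    {f₂ f₃ f₄ : MvPolynomial (Fin 2) ℝ} (h : AreForms f₂ f₃ f₄)
    (hpsd : IsPSD (normalQuartic f₂ f₃ f₄)) {ε : ℝ} (hε : 0 < ε) :
    ∃ g₂ g₃ g₄ : MvPolynomial (Fin 2) ℝ, AreForms g₂ g₃ g₄ ∧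
      IsPosDef (normalQuartic g₂ g₃ g₄) ∧
      (IsPSD (normalQuartic f₂ f₃ f₄ - X 2 ^ 4) → IsPSD (normalQuartic g₂ g₃ g₄ - X 2 ^ 4)) ∧
      eval (coeffVec g₂ g₃ g₄) Ψ ≠ 0 ∧
      ∀ k, |coeffVec g₂ g₃ g₄ k - coeffVec f₂ f₃ f₄ k| < ε := by
  set w₀ := coeffVec f₂ f₃ f₄ with hw₀
  obtain ⟨h2, h3, h4⟩ := gen_coeffVec h
  obtain ⟨w, hw, hΨw⟩ := exists_near_eval_ne_zero hΨ (fun k => w₀ k + ε / 4 * roundVec k)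
    (η := ε / 4 / 14) (by positivity)
  have hge := eval_normalQuartic_gen_ge (w₀ := w₀) (w := w) (δ := ε / 4) (by positivity)
    (fun k => by rw [sub_sub]; exact hw k)
  rw [h2, h3, h4] at hge
  have hsnoc : ∀ v : Fin 3 → ℝ, ∃ (r : Fin 2 → ℝ) (z : ℝ), v = Fin.snoc r z :=
    fun v => ⟨Fin.init v, v (Fin.last 2), (Fin.snoc_init_self v).symm⟩
  refine ⟨gen₂ w, gen₃ w, gen₄ w, areForms_gen w, ?_, ?_, ?_, ?_⟩
  · intro v hv
    obtain ⟨r, z, rfl⟩ := hsnoc v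
    have h0 := hpsd (Fin.snoc r z)
    rw [eval_normalQuartic] at h0 ⊢
    have h1 := hge r z
    by_cases hr : r = 0
    · have hz : z ≠ 0 := by
        rintro rfl
        apply hv
        subst hr
        ext i
        induction i using Fin.lastCases with
        | last => exact Fin.snoc_last (α := fun _ => ℝ) _ _
        | cast i => exact Fin.snoc_castSucc (α := fun _ => ℝ) _ _ i
      rw [hr, eval_zero_form (areForms_gen w).hom₂ two_ne_zero,
        eval_zero_form (areForms_gen w).hom₃ three_ne_zero,
        eval_zero_form (areForms_gen w).hom₄ four_ne_zero]
      have : 0 < z ^ 4 := by positivity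
      linarith
    · have h2 : 0 < r 0 ^ 2 + r 1 ^ 2 := by
        by_contra! hle
        apply hr
        have q0 : r 0 = 0 := pow_eq_zero_iff two_ne_zero |>.1
          (le_antisymm (by nlinarith [sq_nonneg (r 1)]) (sq_nonneg (r 0)))
        have q1 : r 1 = 0 := pow_eq_zero_iff two_ne_zero |>.1
          (le_antisymm (by nlinarith [sq_nonneg (r 0)]) (sq_nonneg (r 1)))
        ext i
        fin_cases i
        · exact q0
        · exact q1
      have : 0 < ε / 4 / 2 * (r 0 ^ 2 + r 1 ^ 2) ^ 2 := by positivity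
      linarith
  · intro hf v
    obtain ⟨r, z, rfl⟩ := hsnoc v
    have h0 := hf (Fin.snoc r z)
    rw [eval_normalQuartic_sub] at h0 ⊢
    have : 0 ≤ ε / 4 / 2 * (r 0 ^ 2 + r 1 ^ 2) ^ 2 := by positivity
    linarith [hge r z]
  · rwa [coeffVec_gen]
  · intro k
    rw [coeffVec_gen]
    have h1 := abs_le.1 (hw k)
    have h2 := abs_le.1 (abs_roundVec_le k)
    rw [abs_lt]
    constructor <;> nlinarith

/-! ### Ternary quadratic forms and limits of sums of three squares -/

/-- The ternary quadratic form with matrix `a`. -/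
noncomputable def quadForm (a : Fin 3 → Fin 3 → ℝ) : MvPolynomial (Fin 3) ℝ :=
  ∑ i, ∑ j, C (a i j) * (X i * X j)

theorem isHomogeneous_quadForm (a : Fin 3 → Fin 3 → ℝ) : (quadForm a).IsHomogeneous 2 :=
  IsHomogeneous.sum _ _ _ fun i _ => IsHomogeneous.sum _ _ _ fun j _ =>
    ((isHomogeneous_X ℝ i).mul (isHomogeneous_X ℝ j)).C_mul _

theorem eval_quadForm (a : Fin 3 → Fin 3 → ℝ) (v : Fin 3 → ℝ) :
    eval v (quadForm a) = ∑ i, ∑ j, a i j * (v i * v j) := by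
  simp [quadForm]

theorem eq_C_of_isHomogeneous_zero {τ : Type*} {p : MvPolynomial τ ℝ} (h : p.IsHomogeneous 0) :
    p = C (coeff 0 p) :=
  totalDegree_eq_zero_iff_eq_C.1 ((totalDegree_zero_iff_isHomogeneous _).2 h)

theorem exists_eq_quadForm {q : MvPolynomial (Fin 3) ℝ} (hq : q.IsHomogeneous 2) :
    ∃ a : Fin 3 → Fin 3 → ℝ, (∀ i j, a i j = a j i) ∧ q = quadForm a := by
  have hC : ∀ i j v, eval v (pderiv j (pderiv i q)) = coeff 0 (pderiv j (pderiv i q)) := by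
    intro i j v
    conv_lhs => rw [eq_C_of_isHomogeneous_zero (hq.pderiv (i := i).pderiv (i := j)), eval_C]
  set a : Fin 3 → Fin 3 → ℝ := fun i j => coeff 0 (pderiv j (pderiv i q)) with ha
  refine ⟨fun i j => (a i j + a j i) / 4, fun i j => by ring, ?_⟩
  apply MvPolynomial.funext
  intro v
  -- Euler's identity, applied twice
  have h2 : ∀ i, eval v (pderiv i q) = ∑ j, v j * a i j := by
    intro i
    have := congrArg (eval v) (hq.pderiv (i := i)).sum_X_mul_pderiv
    simpa [hC, ha] using this.symm
  have h3 := congrArg (eval v) hq.sum_X_mul_pderiv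
  simp only [map_sum, map_mul, eval_X, h2, nsmul_eq_mul, Nat.cast_ofNat] at h3
  rw [show eval v (2 : MvPolynomial (Fin 3) ℝ) = 2 from map_ofNat _ _] at h3
  rw [eval_quadForm]
  simp only [Fin.sum_univ_three] at h3 ⊢
  linear_combination (-1 / 2) * h3

/-- The matrix of a quadratic form is determined by finitely many of its values. -/
theorem polarization_quadForm {a : Fin 3 → Fin 3 → ℝ} (ha : ∀ i j, a i j = a j i) (i j : Fin 3) :
    2 * a i j = eval (Pi.single i 1 + Pi.single j 1) (quadForm a) -
      eval (Pi.single i 1) (quadForm a) - eval (Pi.single j 1) (quadForm a) := by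
  simp only [eval_quadForm, Pi.add_apply, Pi.single_apply, mul_add, add_mul, Finset.sum_add_distrib]
  simp [ha j i]
  ring

theorem isSumThreeSq_iff {f : MvPolynomial (Fin 3) ℝ} : IsSumThreeSq f ↔
    ∃ a : Fin 3 → Fin 3 → Fin 3 → ℝ, (∀ k i j, a k i j = a k j i) ∧
      ∀ v, eval v f = ∑ k, eval v (quadForm (a k)) ^ 2 := by
  constructor
  · rintro ⟨p, hp, rfl⟩
    choose a ha hpa using fun k => exists_eq_quadForm (hp k)
    refine ⟨a, ha, fun v => ?_⟩
    rw [map_sum]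
    refine Finset.sum_congr rfl fun k _ => ?_
    rw [map_pow, hpa]
  · rintro ⟨a, -, h⟩
    refine ⟨fun k => quadForm (a k), fun k => isHomogeneous_quadForm _, ?_⟩
    apply MvPolynomial.funext
    intro v
    rw [h, map_sum]
    simp only [map_pow]

/-- Sums of three squares of quadratic forms are closed under limits, because the coefficients of
the quadratic forms are bounded by values of their sum of squares. -/
theorem isSumThreeSq_of_tendsto {F : ℕ → MvPolynomial (Fin 3) ℝ} {f : MvPolynomial (Fin 3) ℝ}
    (hF : ∀ n, IsSumThreeSq (F n))
    (h : ∀ v, Filter.Tendsto (fun n => eval v (F n)) Filter.atTop (nhds (eval v f))) :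
    IsSumThreeSq f := by
  choose a ha hFa using fun n => isSumThreeSq_iff.1 (hF n)
  have hbd : ∀ v : Fin 3 → ℝ, ∃ M, ∀ n k, |eval v (quadForm (a n k))| ≤ M := by
    intro v
    obtain ⟨M, hM⟩ := (h v).bddAbove_range
    refine ⟨1 + M, fun n k => ?_⟩
    have h1 : eval v (F n) ≤ M := hM ⟨n, rfl⟩
    rw [hFa] at h1
    have h2 := Finset.single_le_sum (f := fun k => eval v (quadForm (a n k)) ^ 2)
      (fun k _ => sq_nonneg _) (Finset.mem_univ k)
    linarith [abs_le_one_add_sq (eval v (quadForm (a n k)))]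
  choose M hM using hbd
  have hmem : ∀ n, a n ∈ Set.pi Set.univ fun _ : Fin 3 => Set.pi Set.univ fun i : Fin 3 =>
      Set.pi Set.univ fun j : Fin 3 => Set.Icc
        (-(M (Pi.single i 1 + Pi.single j 1) + M (Pi.single i 1) + M (Pi.single j 1)))
        (M (Pi.single i 1 + Pi.single j 1) + M (Pi.single i 1) + M (Pi.single j 1)) := by
    intro n k _ i _ j _
    have hp := polarization_quadForm (ha n k) i j
    have h1 := abs_le.1 (hM (Pi.single i 1 + Pi.single j 1) n k)
    have h2 := abs_le.1 (hM (Pi.single i 1) n k)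
    have h3 := abs_le.1 (hM (Pi.single j 1) n k)
    constructor <;> linarith [h1.1, h1.2, h2.1, h2.2, h3.1, h3.2]
  obtain ⟨b, -, φ, hφ, hb⟩ := (isCompact_univ_pi fun _ => isCompact_univ_pi fun i =>
    isCompact_univ_pi fun j => isCompact_Icc).tendsto_subseq hmem
  refine isSumThreeSq_iff.2 ⟨b, fun k i j => ?_, fun v => ?_⟩
  · have hk : ∀ i j, Filter.Tendsto (fun n => a (φ n) k i j) Filter.atTop (nhds (b k i j)) :=
      fun i j => tendsto_pi_nhds.1 (tendsto_pi_nhds.1 (tendsto_pi_nhds.1 hb k) i) j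
    refine tendsto_nhds_unique (hk i j) ?_
    simp_rw [ha _ k i j]
    exact hk j i
  · refine tendsto_nhds_unique ((h v).comp hφ.tendsto_atTop) ?_
    have hc : Continuous fun c : Fin 3 → Fin 3 → Fin 3 → ℝ =>
        ∑ k, eval v (quadForm (c k)) ^ 2 := by
      simp only [eval_quadForm]
      fun_prop
    refine ((hc.tendsto b).comp hb).congr fun n => ?_
    exact (hFa (φ n) v).symm

theorem IsSumThreeSq.aeval {f : MvPolynomial (Fin 3) ℝ} (hf : IsSumThreeSq f)
    {M : Fin 3 → MvPolynomial (Fin 3) ℝ} (hM : ∀ i, (M i).IsHomogeneous 1) :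
    IsSumThreeSq (aeval M f) := by
  obtain ⟨p, hp, rfl⟩ := hf
  refine ⟨fun i => MvPolynomial.aeval M (p i), fun i => ?_, by simp only [map_sum, map_pow]⟩
  simpa using (hp i).aeval M hM

theorem IsSumThreeSq.C_mul {f : MvPolynomial (Fin 3) ℝ} (hf : IsSumThreeSq f) {c : ℝ}
    (hc : 0 ≤ c) : IsSumThreeSq (C c * f) := by
  obtain ⟨p, hp, rfl⟩ := hf
  refine ⟨fun i => C √c * p i, fun i => (hp i).C_mul _, ?_⟩
  rw [Finset.mul_sum]
  refine Finset.sum_congr rfl fun i _ => ?_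
  rw [mul_pow, ← C_pow, Real.sq_sqrt hc]

/-! ### The normal form of a positive definite ternary quartic -/

/-- A form is a multiple of `z` up to a form in `x, y`. -/
theorem exists_eq_mul_add_lift {m : ℕ} {F : MvPolynomial (Fin 3) ℝ}
    (hF : F.IsHomogeneous (m + 1)) :
    ∃ (G : MvPolynomial (Fin 3) ℝ) (H : MvPolynomial (Fin 2) ℝ), G.IsHomogeneous m ∧
      H.IsHomogeneous (m + 1) ∧ F = X 2 * G + lift H := by
  set H : MvPolynomial (Fin 2) ℝ := MvPolynomial.aeval ![X 0, X 1, 0] F with hH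
  have hHh : H.IsHomogeneous (m + 1) := by
    have := hF.aeval (n := 1) ![(X 0 : MvPolynomial (Fin 2) ℝ), X 1, 0] (by
      intro i
      fin_cases i
      · exact isHomogeneous_X _ _
      · exact isHomogeneous_X _ _
      · exact isHomogeneous_zero _ _ _)
    rwa [one_mul] at this
  have hd : X 2 ∣ F - lift H := by
    refine X_dvd_of_eval_eq_zero fun w hw => ?_
    have e : eval (w ∘ Fin.castSucc) H = eval w F := by
      rw [hH, ← coe_aeval_eq_eval, ← coe_aeval_eq_eval, RingHom.coe_coe, RingHom.coe_coe,
        ← AlgHom.comp_apply, comp_aeval]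
      congr 2
      ext i
      fin_cases i
      · simp
      · simp
      · simpa using hw.symm
    rw [map_sub, eval_lift, e, sub_self]
  obtain ⟨G, hG, e⟩ := exists_isHomogeneous_mul_of_dvd (k := m) (isHomogeneous_X ℝ (2 : Fin 3))
    (hF.sub (hHh.rename_isHomogeneous (f := Fin.castSucc))) (add_comm 1 m) hd
  exact ⟨G, H, hG, hHh, by rw [lift, ← e, sub_add_cancel]⟩

/-- A real polynomial of degree `3` takes negative values. -/
theorem eq_zero_of_forall_cubic_nonneg {b c d e : ℝ}
    (h : ∀ z : ℝ, 0 ≤ b * z ^ 3 + c * z ^ 2 + d * z + e) : b = 0 := by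
  have key : ∀ b c d : ℝ, b < 0 → ∃ z : ℝ, b * z ^ 3 + c * z ^ 2 + d * z + e < 0 := by
    intro b c d hb
    set N := (|c| + |d| + |e|) / (-b) + 1 with hN
    have hpos : 0 ≤ (|c| + |d| + |e|) / (-b) := div_nonneg (by positivity) (by linarith)
    have hN1 : 1 ≤ N := by linarith
    have hbN : (-b) * N = |c| + |d| + |e| + (-b) := by
      rw [hN, mul_add, mul_div_cancel₀ _ (by linarith : (-b) ≠ 0), mul_one]
    have h2 : N ≤ N ^ 2 := by nlinarith
    have h3 : (1 : ℝ) ≤ N ^ 2 := by nlinarith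
    refine ⟨N, ?_⟩
    have i1 : c * N ^ 2 ≤ |c| * N ^ 2 := by gcongr; exact le_abs_self c
    have i2 : d * N ≤ |d| * N ^ 2 :=
      (mul_le_mul_of_nonneg_right (le_abs_self d) (by linarith)).trans
        (mul_le_mul_of_nonneg_left h2 (abs_nonneg d))
    have i3 : e ≤ |e| * N ^ 2 :=
      (le_abs_self e).trans (le_mul_of_one_le_right (abs_nonneg e) h3)
    have i4 : b * N ^ 3 = -((|c| + |d| + |e| + (-b)) * N ^ 2) := by
      rw [← hbN]; ring
    nlinarith
  rcases lt_trichotomy b 0 with hb | hb | hb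
  · obtain ⟨z, hz⟩ := key b c d hb
    linarith [h z]
  · exact hb
  · obtain ⟨z, hz⟩ := key (-b) c (-d) (by linarith)
    have := h (-z)
    nlinarith

/-- A quartic form `f ≥ z ^ 4` which takes the value `1` at `(0, 0, 1)` is in normal form. -/
theorem exists_eq_normalQuartic {f : MvPolynomial (Fin 3) ℝ} (hf : f.IsHomogeneous 4)
    (h1 : eval (Fin.snoc (0 : Fin 2 → ℝ) 1 : Fin 3 → ℝ) f = 1)
    (hge : ∀ (r : Fin 2 → ℝ) (z : ℝ), z ^ 4 ≤ eval (Fin.snoc r z : Fin 3 → ℝ) f) :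
    ∃ f₂ f₃ f₄ : MvPolynomial (Fin 2) ℝ, AreForms f₂ f₃ f₄ ∧ f = normalQuartic f₂ f₃ f₄ := by
  obtain ⟨G₃, f₄, hG₃, hf₄, e₄⟩ := exists_eq_mul_add_lift hf
  obtain ⟨G₂, f₃, hG₂, hf₃, e₃⟩ := exists_eq_mul_add_lift hG₃
  obtain ⟨G₁, f₂, hG₁, hf₂, e₂⟩ := exists_eq_mul_add_lift hG₂
  obtain ⟨G₀, f₁, hG₀, hf₁, e₁⟩ := exists_eq_mul_add_lift hG₁
  obtain ⟨a, ha⟩ : ∃ a, G₀ = C a := ⟨_, eq_C_of_isHomogeneous_zero hG₀⟩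
  have hev : ∀ (r : Fin 2 → ℝ) (z : ℝ), eval (Fin.snoc r z : Fin 3 → ℝ) f =
      a * z ^ 4 + eval r f₁ * z ^ 3 + eval r f₂ * z ^ 2 + eval r f₃ * z + eval r f₄ := by
    intro r z
    have h2 : (Fin.snoc r z : Fin 3 → ℝ) 2 = z := Fin.snoc_last (α := fun _ => ℝ) z r
    rw [e₄, e₃, e₂, e₁, ha]
    simp only [map_add, map_mul, eval_X, eval_C, h2, eval_snoc_lift]
    ring
  have ha1 : a = 1 := by
    rw [hev, eval_zero_form hf₁ (by omega), eval_zero_form hf₂ (by omega),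
      eval_zero_form hf₃ (by omega), eval_zero_form hf₄ (by omega)] at h1
    linarith
  have hf1 : f₁ = 0 := by
    apply MvPolynomial.funext
    intro r
    rw [map_zero]
    refine eq_zero_of_forall_cubic_nonneg (c := eval r f₂) (d := eval r f₃) (e := eval r f₄)
      fun z => ?_
    have := hge r z
    rw [hev, ha1] at this
    linarith
  refine ⟨f₂, f₃, f₄, ⟨hf₂, hf₃, hf₄⟩, ?_⟩
  rw [e₄, e₃, e₂, e₁, ha, ha1, hf1, normalQuartic, lift, lift, lift, lift, map_zero, C_1]
  ring

/-- The reflection that exchanges the unit vector `p` and `(0, 0, 1)`, as a substitution. If the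
two vectors agree, the quotients are `0` and the substitution is the identity. -/
noncomputable def reflectionSubst (p : Fin 3 → ℝ) (i : Fin 3) : MvPolynomial (Fin 3) ℝ :=
  X i - C ((![0, 0, 1] i - p i) / (1 - p 2)) *
    (C (-p 0) * X 0 + C (-p 1) * X 1 + C (1 - p 2) * X 2)

theorem isHomogeneous_reflectionSubst (p : Fin 3 → ℝ) (i : Fin 3) :
    (reflectionSubst p i).IsHomogeneous 1 :=
  (isHomogeneous_X ℝ i).sub (((((isHomogeneous_X ℝ (0 : Fin 3)).C_mul _).add
    ((isHomogeneous_X ℝ (1 : Fin 3)).C_mul _)).add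
      ((isHomogeneous_X ℝ (2 : Fin 3)).C_mul _)).C_mul _)

/-- The reflection underlying `reflectionSubst`. -/
noncomputable def reflectionVec (p v : Fin 3 → ℝ) (i : Fin 3) : ℝ :=
  v i - (![0, 0, 1] i - p i) / (1 - p 2) * (-p 0 * v 0 + -p 1 * v 1 + (1 - p 2) * v 2)

theorem eval_aeval_reflectionSubst (p v : Fin 3 → ℝ) (f : MvPolynomial (Fin 3) ℝ) :
    eval v (aeval (reflectionSubst p) f) = eval (reflectionVec p v) f := by
  rw [← coe_aeval_eq_eval, ← coe_aeval_eq_eval, RingHom.coe_coe, RingHom.coe_coe,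
    ← AlgHom.comp_apply, comp_aeval]
  congr 2
  ext i
  simp [reflectionSubst, reflectionVec]

theorem exists_reflectionVec_eq {p : Fin 3 → ℝ} (h : 1 - p 2 ≠ 0) (v : Fin 3 → ℝ) :
    ∃ t, -p 0 * v 0 + -p 1 * v 1 + (1 - p 2) * v 2 = (1 - p 2) * t ∧
      ∀ i, reflectionVec p v i = v i - (![0, 0, 1] i - p i) * t := by
  refine ⟨(-p 0 * v 0 + -p 1 * v 1 + (1 - p 2) * v 2) / (1 - p 2), ?_, fun i => ?_⟩
  · rw [mul_div_cancel₀ _ h]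
  · rw [reflectionVec]
    ring

section

variable {p : Fin 3 → ℝ}

theorem sq_reflectionVec (hp : p 0 ^ 2 + p 1 ^ 2 + p 2 ^ 2 = 1) (v : Fin 3 → ℝ) :
    reflectionVec p v 0 ^ 2 + reflectionVec p v 1 ^ 2 + reflectionVec p v 2 ^ 2 =
      v 0 ^ 2 + v 1 ^ 2 + v 2 ^ 2 := by
  by_cases h : 1 - p 2 = 0
  · simp [reflectionVec, h]
  · obtain ⟨t, ht, e⟩ := exists_reflectionVec_eq h v
    simp only [e, Matrix.cons_val_zero, Matrix.cons_val_one, Matrix.cons_val]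
    linear_combination (-2 * t) * ht + t ^ 2 * hp

theorem reflectionVec_reflectionVec (hp : p 0 ^ 2 + p 1 ^ 2 + p 2 ^ 2 = 1) (v : Fin 3 → ℝ) :
    reflectionVec p (reflectionVec p v) = v := by
  ext i
  by_cases h : 1 - p 2 = 0
  · simp [reflectionVec, h]
  · obtain ⟨t, ht, e⟩ := exists_reflectionVec_eq h v
    obtain ⟨s, hs, e'⟩ := exists_reflectionVec_eq h (reflectionVec p v)
    simp only [e, Matrix.cons_val_zero, Matrix.cons_val_one, Matrix.cons_val] at hs
    have hst : s = -t := by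
      apply mul_left_cancel₀ h
      linear_combination -hs + ht - t * hp
    rw [e', e, hst]
    ring

theorem reflectionVec_snoc (hp : p 0 ^ 2 + p 1 ^ 2 + p 2 ^ 2 = 1) :
    reflectionVec p (Fin.snoc (0 : Fin 2 → ℝ) 1 : Fin 3 → ℝ) = p := by
  have e : (Fin.snoc (0 : Fin 2 → ℝ) 1 : Fin 3 → ℝ) = ![0, 0, 1] := by
    ext i
    fin_cases i <;> rfl
  rw [e]
  by_cases h : 1 - p 2 = 0
  · have h2 : p 2 = 1 := by linarith
    have h0 : p 0 = 0 := by nlinarith [sq_nonneg (p 0), sq_nonneg (p 1)]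
    have h1 : p 1 = 0 := by nlinarith [sq_nonneg (p 0), sq_nonneg (p 1)]
    ext i
    fin_cases i <;> simp [reflectionVec, h0, h1, h2]
  · ext i
    fin_cases i <;> simp [reflectionVec, h]

end

theorem sum_sq_pos {v : Fin 3 → ℝ} (hv : v ≠ 0) : 0 < v 0 ^ 2 + v 1 ^ 2 + v 2 ^ 2 := by
  by_contra! hle
  apply hv
  have h0 : v 0 = 0 := by nlinarith [sq_nonneg (v 0), sq_nonneg (v 1), sq_nonneg (v 2)]
  have h1 : v 1 = 0 := by nlinarith [sq_nonneg (v 0), sq_nonneg (v 1), sq_nonneg (v 2)]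
  have h2 : v 2 = 0 := by nlinarith [sq_nonneg (v 0), sq_nonneg (v 1), sq_nonneg (v 2)]
  ext i
  fin_cases i
  · exact h0
  · exact h1
  · exact h2

/-- A positive definite quartic is brought into normal form by moving a point `p` at which it
attains its minimum `c` on the sphere to `(0, 0, 1)`. Then `f - c (x ^ 2 + y ^ 2 + z ^ 2) ^ 2` is
psd. -/
theorem exists_normal_form {f : MvPolynomial (Fin 3) ℝ} (hf : f.IsHomogeneous 4)
    (hpos : IsPosDef f) : ∃ (p : Fin 3 → ℝ) (c : ℝ) (f₂ f₃ f₄ : MvPolynomial (Fin 2) ℝ),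
      p 0 ^ 2 + p 1 ^ 2 + p 2 ^ 2 = 1 ∧ 0 < c ∧ AreForms f₂ f₃ f₄ ∧
      IsPSD (normalQuartic f₂ f₃ f₄ - X 2 ^ 4) ∧
      aeval (reflectionSubst p) f = C c * normalQuartic f₂ f₃ f₄ := by
  have hS : IsCompact {v : Fin 3 → ℝ | v 0 ^ 2 + v 1 ^ 2 + v 2 ^ 2 = 1} := by
    refine (isCompact_univ_pi fun _ : Fin 3 =>
      isCompact_Icc (a := (-1 : ℝ)) (b := 1)).of_isClosed_subset
        (isClosed_eq (by fun_prop) continuous_const) ?_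
    intro v hv i _
    have hv' : v 0 ^ 2 + v 1 ^ 2 + v 2 ^ 2 = 1 := hv
    rw [Set.mem_Icc, ← abs_le, ← sq_le_one_iff_abs_le_one]
    fin_cases i
    · show v 0 ^ 2 ≤ 1
      nlinarith [sq_nonneg (v 1), sq_nonneg (v 2)]
    · show v 1 ^ 2 ≤ 1
      nlinarith [sq_nonneg (v 0), sq_nonneg (v 2)]
    · show v 2 ^ 2 ≤ 1
      nlinarith [sq_nonneg (v 0), sq_nonneg (v 1)]
  obtain ⟨p, hp, hmin⟩ := hS.exists_isMinOn ⟨![0, 0, 1], by simp⟩ f.continuous_eval.continuousOn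
  have hp' : p 0 ^ 2 + p 1 ^ 2 + p 2 ^ 2 = 1 := hp
  set c := eval p f with hc
  have hc0 : 0 < c := hpos p (by
    rintro rfl
    simp at hp')
  -- the value of `f` at `v` is at least `c ‖v‖ ^ 4`
  have hge : ∀ v : Fin 3 → ℝ, c * (v 0 ^ 2 + v 1 ^ 2 + v 2 ^ 2) ^ 2 ≤ eval v f := by
    intro v
    by_cases hv : v = 0
    · rw [hv, eval_zero_form hf four_ne_zero]
      simp
    · set N := √(v 0 ^ 2 + v 1 ^ 2 + v 2 ^ 2) with hN
      have hpos' := sum_sq_pos hv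
      have hN2 : N ^ 2 = v 0 ^ 2 + v 1 ^ 2 + v 2 ^ 2 := Real.sq_sqrt hpos'.le
      have hN0 : 0 < N := Real.sqrt_pos.2 hpos'
      have h1 : c ≤ eval (fun i => N⁻¹ * v i) f := hmin (by
        show (N⁻¹ * v 0) ^ 2 + (N⁻¹ * v 1) ^ 2 + (N⁻¹ * v 2) ^ 2 = 1
        rw [mul_pow, mul_pow, mul_pow, ← mul_add, ← mul_add, ← hN2, ← mul_pow,
          inv_mul_cancel₀ hN0.ne', one_pow])
      rw [eval_smul_form hf, inv_pow] at h1
      rw [← hN2, ← pow_mul]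
      have h2 := mul_le_mul_of_nonneg_right h1 (pow_nonneg hN0.le 4)
      rwa [mul_assoc, mul_comm (eval v f), ← mul_assoc, inv_mul_cancel₀ (pow_ne_zero 4 hN0.ne'),
        one_mul] at h2
  set g := C c⁻¹ * aeval (reflectionSubst p) f with hg
  have hgh : g.IsHomogeneous 4 := by
    have := hf.aeval (reflectionSubst p) (isHomogeneous_reflectionSubst p)
    rw [one_mul] at this
    exact this.C_mul _
  have hgev : ∀ v, eval v g = c⁻¹ * eval (reflectionVec p v) f := by
    intro v
    rw [hg, map_mul, eval_C, eval_aeval_reflectionSubst]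
  have hgge : ∀ (r : Fin 2 → ℝ) (z : ℝ), z ^ 4 ≤ eval (Fin.snoc r z : Fin 3 → ℝ) g := by
    intro r z
    rw [hgev, ← div_eq_inv_mul, le_div_iff₀ hc0]
    refine le_trans ?_ (hge _)
    rw [sq_reflectionVec hp', mul_comm]
    have h2 : (Fin.snoc r z : Fin 3 → ℝ) 2 = z := Fin.snoc_last (α := fun _ => ℝ) z r
    rw [h2]
    gcongr
    set s := (Fin.snoc r z : Fin 3 → ℝ)
    nlinarith [sq_nonneg (s 0), sq_nonneg (s 1), sq_nonneg z, sq_nonneg (s 0 ^ 2 + s 1 ^ 2)]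
  obtain ⟨f₂, f₃, f₄, h, e⟩ := exists_eq_normalQuartic hgh (by
    rw [hgev, reflectionVec_snoc hp', ← hc, inv_mul_cancel₀ hc0.ne']) hgge
  refine ⟨p, c, f₂, f₃, f₄, hp', hc0, h, ?_, ?_⟩
  · intro v
    rw [← Fin.snoc_init_self (α := fun _ => ℝ) v, eval_normalQuartic_sub]
    have := hgge (Fin.init v) (v (Fin.last 2))
    rw [e, eval_normalQuartic] at this
    linarith
  · rw [← e, hg, ← mul_assoc, ← C_mul, mul_inv_cancel₀ hc0.ne', C_1, one_mul]

/-! ### Sums of three squares -/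

/-- A solution of `C_0` is continued to a solution of `C_1`. -/
theorem isSumThreeSq_of_not_exceptional {f₂ f₃ f₄ : MvPolynomial (Fin 2) ℝ}
    (h : AreForms f₂ f₃ f₄) (hpos : IsPosDef (normalQuartic f₂ f₃ f₄))
    (hpsd : IsPSD (normalQuartic f₂ f₃ f₄ - X 2 ^ 4)) (hE : ∀ i, ¬ Exceptional f₂ f₃ f₄ i) :
    IsSumThreeSq (normalQuartic f₂ f₃ f₄) := by
  obtain ⟨s, hs⟩ := exists_isSolution_zero h hpsd (hE 0)
  obtain ⟨γ, ⟨-, -, hγ⟩, -⟩ := existsUnique_continuation h hpos hpsd hE hs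
  refine isSumThreeSq_of_isSolution_one h ?_ (s := γ 1) (by simpa using hγ 1)
  rintro rfl
  exact hE 1 (dvd_zero f₂)

/-- Approximation by non-exceptional forms. -/
theorem isSumThreeSq_of_isPSD_sub {f₂ f₃ f₄ : MvPolynomial (Fin 2) ℝ} (h : AreForms f₂ f₃ f₄)
    (hpsd : IsPSD (normalQuartic f₂ f₃ f₄ - X 2 ^ 4)) :
    IsSumThreeSq (normalQuartic f₂ f₃ f₄) := by
  obtain ⟨Ψ, hΨ0, hΨ⟩ := exists_exceptionalPoly
  have hf : IsPSD (normalQuartic f₂ f₃ f₄) := by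
    intro v
    have := hpsd v
    rw [map_sub, map_pow, eval_X] at this
    have h4 : 0 ≤ v 2 ^ 4 := by positivity
    linarith
  choose g₂ g₃ g₄ hg hpos hsub hne hlt using fun n : ℕ =>
    exists_near_generic (Finset.prod_ne_zero_iff.2 fun i (_ : i ∈ Finset.univ) => hΨ0 i) h hf
      (Nat.one_div_pos_of_nat (α := ℝ) (n := n))
  refine isSumThreeSq_of_tendsto (F := fun n => normalQuartic (g₂ n) (g₃ n) (g₄ n))
    (fun n => isSumThreeSq_of_not_exceptional (hg n) (hpos n) (hsub n hpsd) fun i => ?_) ?_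
  · rw [← hΨ _ _ _ (hg n) (hsub n hpsd)]
    have := hne n
    rw [map_prod, Finset.prod_ne_zero_iff] at this
    exact this i (Finset.mem_univ i)
  · have hlim : Filter.Tendsto (fun n => coeffVec (g₂ n) (g₃ n) (g₄ n)) Filter.atTop
        (nhds (coeffVec f₂ f₃ f₄)) := by
      rw [tendsto_pi_nhds]
      intro k
      rw [tendsto_iff_dist_tendsto_zero]
      refine squeeze_zero (fun n => dist_nonneg) (fun n => ?_)
        tendsto_one_div_add_atTop_nhds_zero_nat
      rw [Real.dist_eq]
      exact (hlt n k).le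
    intro v
    obtain ⟨r, z, rfl⟩ : ∃ (r : Fin 2 → ℝ) (z : ℝ), v = Fin.snoc r z :=
      ⟨Fin.init v, v (Fin.last 2), (Fin.snoc_init_self v).symm⟩
    have hcont : Continuous fun w => eval (Fin.snoc r z : Fin 3 → ℝ)
        (normalQuartic (gen₂ w) (gen₃ w) (gen₄ w)) := by
      simp only [eval_normalQuartic, gen₂, gen₃, gen₄, eval_vecForm]
      fun_prop
    have := (hcont.tendsto _).comp hlim
    obtain ⟨h2, h3, h4⟩ := gen_coeffVec h
    rw [h2, h3, h4] at this
    refine this.congr fun n => ?_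
    obtain ⟨h2, h3, h4⟩ := gen_coeffVec (hg n)
    rw [Function.comp_apply, h2, h3, h4]

/-- Reduction to the normal form. The reflection is an involution, so it also transforms the
representation back. -/
theorem isSumThreeSq_of_isPosDef {f : MvPolynomial (Fin 3) ℝ} (hf : f.IsHomogeneous 4)
    (hpos : IsPosDef f) : IsSumThreeSq f := by
  obtain ⟨p, c, f₂, f₃, f₄, hp, hc, h, hpsd, e⟩ := exists_normal_form hf hpos
  have h1 := ((isSumThreeSq_of_isPSD_sub h hpsd).C_mul hc.le).aeval
    (isHomogeneous_reflectionSubst p)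
  rw [← e] at h1
  convert h1
  apply MvPolynomial.funext
  intro v
  rw [eval_aeval_reflectionSubst, eval_aeval_reflectionSubst, reflectionVec_reflectionVec hp]

/-- Hilbert's theorem on ternary quartics. -/
theorem isSumThreeSq_of_isPSD {f : MvPolynomial (Fin 3) ℝ} (hf : f.IsHomogeneous 4)
    (hpsd : IsPSD f) : IsSumThreeSq f := by
  -- `f + (x ^ 2 + y ^ 2 + z ^ 2) ^ 2 / (n + 1)` is positive definite and tends to `f`
  set q : MvPolynomial (Fin 3) ℝ := (X 0 ^ 2 + X 1 ^ 2 + X 2 ^ 2) ^ 2 with hq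
  have hqh : q.IsHomogeneous 4 :=
    (((isHomogeneous_X_pow _ _).add (isHomogeneous_X_pow _ _)).add (isHomogeneous_X_pow _ _)).pow 2
  refine isSumThreeSq_of_tendsto (F := fun n : ℕ => f + C (1 / ((n : ℝ) + 1)) * q)
    (fun n => isSumThreeSq_of_isPosDef (hf.add (hqh.C_mul _)) ?_) ?_
  · intro v hv
    have hpos := sum_sq_pos hv
    have h1 : 0 < 1 / ((n : ℝ) + 1) := Nat.one_div_pos_of_nat
    have h2 : eval v q = (v 0 ^ 2 + v 1 ^ 2 + v 2 ^ 2) ^ 2 := by simp [hq]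
    rw [map_add, map_mul, eval_C, h2]
    have := hpsd v
    positivity
  · intro v
    simp only [map_add, map_mul, eval_C]
    have := (tendsto_one_div_add_atTop_nhds_zero_nat (𝕜 := ℝ)).mul_const (eval v q)
    rw [zero_mul] at this
    simpa using this.const_add (eval v f)

end TernaryQuartic

theorem mainTheorem1 :
    -- every psd ternary quartic form is a sum of three squares of quadratic forms
    (∀ f : MvPolynomial (Fin 3) ℝ, f.IsHomogeneous 4 → IsPSD f →
      ∃ p : Fin 3 → MvPolynomial (Fin 3) ℝ,
        (∀ i, (p i).IsHomogeneous 2) ∧ f = ∑ i, p i ^ 2) ∧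
    -- for generic `f`, solutions of `C_0` exist and extend uniquely along `0 ≤ t ≤ 1`
    (∀ f₂ f₃ f₄ : MvPolynomial (Fin 2) ℝ, AreForms f₂ f₃ f₄ →
      IsPosDef (normalQuartic f₂ f₃ f₄) → IsPSD (normalQuartic f₂ f₃ f₄ - X 2 ^ 4) →
      (∀ i, ¬ Exceptional f₂ f₃ f₄ i) →
        (∃ s, IsSolution f₂ f₃ f₄ 0 s) ∧
        ∀ s, IsSolution f₂ f₃ f₄ 0 s →
          ∃! γ : unitInterval → MvPolynomial (Fin 2) ℝ × MvPolynomial (Fin 2) ℝ,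
            IsContinuousFamily γ ∧ γ 0 = s ∧
              ∀ t : unitInterval, IsSolution f₂ f₃ f₄ (t : ℝ) (γ t)) ∧
    -- the exceptional cases are given by nonzero polynomials, and generic forms are dense
    (∃ Ψ : Fin 10 → MvPolynomial (Fin 3 ⊕ Fin 4 ⊕ Fin 5) ℝ,
      (∀ i, Ψ i ≠ 0) ∧
      (∀ f₂ f₃ f₄ : MvPolynomial (Fin 2) ℝ, AreForms f₂ f₃ f₄ →
        IsPSD (normalQuartic f₂ f₃ f₄ - X 2 ^ 4) →
        ∀ i, eval (coeffVec f₂ f₃ f₄) (Ψ i) ≠ 0 ↔ ¬ Exceptional f₂ f₃ f₄ i) ∧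
      (∀ f₂ f₃ f₄ : MvPolynomial (Fin 2) ℝ, AreForms f₂ f₃ f₄ →
        IsPSD (normalQuartic f₂ f₃ f₄) → ∀ ε : ℝ, 0 < ε →
        ∃ g₂ g₃ g₄ : MvPolynomial (Fin 2) ℝ, AreForms g₂ g₃ g₄ ∧
          IsPosDef (normalQuartic g₂ g₃ g₄) ∧
          (IsPSD (normalQuartic f₂ f₃ f₄ - X 2 ^ 4) →
            IsPSD (normalQuartic g₂ g₃ g₄ - X 2 ^ 4)) ∧
          (∏ i, eval (coeffVec g₂ g₃ g₄) (Ψ i)) ≠ 0 ∧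
          ∀ k, |coeffVec g₂ g₃ g₄ k - coeffVec f₂ f₃ f₄ k| < ε)) := by
  refine ⟨fun f hf hpsd => isSumThreeSq_of_isPSD hf hpsd, fun f₂ f₃ f₄ h hpos hpsd hE =>
    ⟨exists_isSolution_zero h hpsd (hE 0), fun s hs =>
      existsUnique_continuation h hpos hpsd hE hs⟩, ?_⟩
  obtain ⟨Ψ, hΨ0, hΨ⟩ := exists_exceptionalPoly
  refine ⟨Ψ, hΨ0, hΨ, fun f₂ f₃ f₄ h hpsd ε hε => ?_⟩
  have := exists_near_generic (Finset.prod_ne_zero_iff.2 fun i (_ : i ∈ Finset.univ) => hΨ0 i)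
    h hpsd hε
  simpa only [map_prod] using this
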